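/- Let $d\ge 1$, let $\Omega$ be a bounded open subset of $\mathbb{R}^d$, and let $\alpha,\beta>0$. Let $\mathcal M(\alpha,\beta;\Omega)$ be the set of measurable invertible matrix-valued functions $A:\Omega\to\mathbb{R}^{d\times d}$ such that, for a.e. $x\in\Omega$ and all $\eta\in\mathbb{R}^d$, $A(x)\eta\cdot\eta\ge\alpha|\eta|^2$ and $A(x)^{-1}\eta\cdot\eta\ge\beta^{-1}|\eta|^2$. A sequence $A_\varepsilon$ in $\mathcal M(\alpha,\beta;\Omega)$ is said to $H$-converge to the measurable matrix-valued function $A_*$ if, for every $f\in H^{-1}(\Omega)$, the solution $u_\varepsilon\in H^1_0(\Omega)$ of $\mathrm{div}(A_\varepsilon\nabla u_\varepsilon)=f$ satisfies $u_\varepsilon\rightharpoonup u_*$ weakly in $H^1_0(\Omega)$ and $A_\varepsilon\nabla u_\varepsilon\rightharpoonup A_*\nabla u_*$ weakly in $L^2(\Omega)^d$, where $u_*\in H^1_0(\Omega)$ solves $\mathrm{div}(A_*\nabla u_*)=f$. Let $A_\varepsilon$ be a sequence of symmetric matrix-valued functions in $\mathcal M(\alpha,\beta;\Omega)$ which $H$-converges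 to $A_*$, and let $\xi_\varepsilon$ be a sequence in $L^2(\Omega)^d$ such that $$\xi_\varepsilon\rightharpoonup\xi\ \text{ weakly in } L^2(\Omega)^d\quad\text{and}\quad \mathrm{div}(\xi_\varepsilon)\to\mathrm{div}(\xi)\ \text{ strongly in } H^{-1}(\Omega).$$ Assume also that $A_\varepsilon^{-1}\xi_\varepsilon\cdot\xi_\varepsilon\rightharpoonup\zeta$ weakly-$*$ in the space $\mathcal M(\Omega)$ of finite signed Borel measures on $\Omega$ (tested against continuous functions with compact support in $\Omega$). Then $A_*^{-1}\xi\cdot\xi$ is integrable on $\Omega$ and $$\zeta\ \ge\ A_*^{-1}\xi\cdot\xi\quad\text{in }\mathcal M(\Omega),$$ where a function stands for the measure having it as density with respect to Lebesgue measure. Moreover, this inequality is an equality if and only if $\mathrm{curl}(A_\varepsilon^{-1}\xi_\varepsilon)$ lies in a compact subset of $H^{-1}_{\mathrm{loc}}(\Omega)^{d\times d}$, where $\mathrm{curl}(U)=\big(\partial U_i/\partial x_j-\partial U_j/\partial x_i\big)_{1\le i,j\le d}$ in the sense of distributions. -/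

import Mathlib

open MeasureTheory Filter Topology Set
open scoped ContDiff

noncomputable section

namespace HConv

/-- The Euclidean space `ℝ^d`. -/
abbrev Vec (d : ℕ) : Type := EuclideanSpace ℝ (Fin d)

/-- Lebesgue measure on `Ω`. -/
abbrev leb {d : ℕ} (Ω : Set (Vec d)) : Measure (Vec d) := volume.restrict Ω

/-- `L²(Ω)`. -/
abbrev L2 {d : ℕ} (Ω : Set (Vec d)) : Type := Lp ℝ 2 (leb Ω)

/-- `L²(Ω)^d`. -/
abbrev L2V {d : ℕ} (Ω : Set (Vec d)) : Type := Lp (Vec d) 2 (leb Ω)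

/-- The product of a matrix and a vector of `ℝ^d`. -/
def act {d : ℕ} (M : Matrix (Fin d) (Fin d) ℝ) (v : Vec d) : Vec d :=
  WithLp.toLp 2 (M.mulVec v.ofLp)

/-- The measurable matrix-valued functions on `Ω` (measurable entries). -/
def MeasurableField {d : ℕ} (Ω : Set (Vec d)) (A : Vec d → Matrix (Fin d) (Fin d) ℝ) : Prop :=
  ∀ i j, AEMeasurable (fun x => A x i j) (leb Ω)

/-- The class `M(α, β; Ω)`: measurable, invertible, `A(x) η · η ≥ α |η|²` and
`A(x)⁻¹ η · η ≥ β⁻¹ |η|²` for all `η`, for a.e. `x ∈ Ω`. -/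
def MClass {d : ℕ} (α β : ℝ) (Ω : Set (Vec d)) (A : Vec d → Matrix (Fin d) (Fin d) ℝ) : Prop :=
  MeasurableField Ω A ∧
    ∀ᵐ x ∂(leb Ω), IsUnit (A x) ∧
      ∀ η : Vec d, α * ‖η‖ ^ 2 ≤ inner ℝ (act (A x) η) η ∧
        β⁻¹ * ‖η‖ ^ 2 ≤ inner ℝ (act (A x)⁻¹ η) η

/-- The ambient Hilbert space `L²(ℝ^d) × L²(ℝ^d)^d` with norm `(‖u‖² + ‖g‖²)^{1/2}`. -/
abbrev Ambient (d : ℕ) : Type :=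
  WithLp 2 (Lp ℝ 2 (volume : Measure (Vec d)) × Lp (Vec d) 2 (volume : Measure (Vec d)))

/-- The pairs `(φ, ∇φ)` with `φ ∈ C_c^∞(Ω)`. -/
def testGraph {d : ℕ} (Ω : Set (Vec d)) : Set (Ambient d) :=
  {p | ∃ φ : Vec d → ℝ, ContDiff ℝ ∞ φ ∧ HasCompactSupport φ ∧ tsupport φ ⊆ Ω ∧
    p.fst =ᵐ[volume] φ ∧ p.snd =ᵐ[volume] gradient φ}

/-- The Sobolev space `H¹₀(Ω)`: the closure of `C_c^∞(Ω)` in the `H¹` norm. A function `u` is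
represented by the pair `(u, ∇u)`, both extended by zero outside `Ω`; the norm is the `H¹` norm. -/
def H10 {d : ℕ} (Ω : Set (Vec d)) : Submodule ℝ (Ambient d) :=
  (Submodule.span ℝ (testGraph Ω)).topologicalClosure

/-- `H⁻¹(Ω)`, the dual of `H¹₀(Ω)`, with the dual norm. -/
abbrev HNeg {d : ℕ} (Ω : Set (Vec d)) : Type := StrongDual ℝ (H10 Ω)

/-- The weak gradient `∇ : H¹₀(Ω) → L²(Ω)^d`. -/
def grad {d : ℕ} (Ω : Set (Vec d)) : H10 Ω →L[ℝ] L2V Ω :=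
  (LpToLpRestrictCLM (Vec d) (Vec d) ℝ volume 2 Ω).comp
    ((WithLp.sndL 2 ℝ (Lp ℝ 2 (volume : Measure (Vec d)))
      (Lp (Vec d) 2 (volume : Measure (Vec d)))).comp (H10 Ω).subtypeL)

/-- The `i`-th component `L²(Ω)^d → L²(Ω)`. -/
def comp {d : ℕ} (Ω : Set (Vec d)) (i : Fin d) : L2V Ω →L[ℝ] L2 Ω :=
  (EuclideanSpace.proj i : Vec d →L[ℝ] ℝ).compLpL 2 (leb Ω)

/-- The distributional derivative `∂ᵢ g ∈ H⁻¹(Ω)` of `g ∈ L²(Ω)`: `⟨∂ᵢ g, u⟩ = -∫_Ω g ∂ᵢu`. -/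
def partialD {d : ℕ} {Ω : Set (Vec d)} (i : Fin d) (g : L2 Ω) : HNeg Ω :=
  -((innerSL ℝ g).comp ((comp Ω i).comp (grad Ω)))

/-- `div ξ = ∑ᵢ ∂ᵢ ξᵢ ∈ H⁻¹(Ω)`. -/
def dv {d : ℕ} {Ω : Set (Vec d)} (ξ : L2V Ω) : HNeg Ω :=
  ∑ i, partialD i (comp Ω i ξ)

/-- `(curl η)ᵢⱼ = ∂ⱼ ηᵢ - ∂ᵢ ηⱼ ∈ H⁻¹(Ω)`. -/
def curl {d : ℕ} {Ω : Set (Vec d)} (η : L2V Ω) (i j : Fin d) : HNeg Ω :=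
  partialD j (comp Ω i η) - partialD i (comp Ω j η)

/-- Weak convergence of a sequence in a normed space. -/
def WeakConv {X : Type*} [NormedAddCommGroup X] [NormedSpace ℝ X] (x : ℕ → X) (a : X) : Prop :=
  ∀ ℓ : StrongDual ℝ X, Tendsto (fun n => ℓ (x n)) atTop (𝓝 (ℓ a))

/-- `τ ∈ L²(Ω)^d` is the field `x ↦ A(x) ∇u(x)`. -/
def IsFlux {d : ℕ} {Ω : Set (Vec d)} (A : Vec d → Matrix (Fin d) (Fin d) ℝ) (u : H10 Ω)
    (τ : L2V Ω) : Prop :=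
  τ =ᵐ[leb Ω] fun x => act (A x) (grad Ω u x)

/-- `H`-convergence of a sequence `A n` of `M(α, β; Ω)` to the matrix-valued function `As`:
for every `f ∈ H⁻¹(Ω)`, the solutions `u n ∈ H¹₀(Ω)` of `div (A n ∇(u n)) = f` satisfy `u n ⇀ us`
weakly in `H¹₀(Ω)` and `A n ∇(u n) ⇀ As ∇us` weakly in `L²(Ω)^d`, where `us ∈ H¹₀(Ω)` solves
`div (As ∇us) = f`. -/
def HConverges {d : ℕ} (Ω : Set (Vec d)) (A : ℕ → Vec d → Matrix (Fin d) (Fin d) ℝ)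
    (As : Vec d → Matrix (Fin d) (Fin d) ℝ) : Prop :=
  ∀ (f : HNeg Ω) (u : ℕ → H10 Ω) (τ : ℕ → L2V Ω),
    (∀ n, IsFlux (A n) (u n) (τ n)) → (∀ n, dv (τ n) = f) →
      ∃ (us : H10 Ω) (τs : L2V Ω), IsFlux As us τs ∧ dv τs = f ∧ WeakConv u us ∧ WeakConv τ τs

/-- The open sets `D` that are relatively compact in `Ω`. -/
abbrev Inner {d : ℕ} (Ω : Set (Vec d)) : Type :=
  {D : Set (Vec d) // IsOpen D ∧ IsCompact (closure D) ∧ closure D ⊆ Ω}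

theorem H10_mono {d : ℕ} {D Ω : Set (Vec d)} (h : D ⊆ Ω) : H10 D ≤ H10 Ω := by
  apply Submodule.topologicalClosure_mono
  apply Submodule.span_mono
  rintro p ⟨φ, h1, h2, h3, h4⟩
  exact ⟨φ, h1, h2, h3.trans h, h4⟩

/-- The inclusion `H¹₀(D) ⊆ H¹₀(Ω)` (extension by zero) for `D ⊆ Ω`. -/
def incl {d : ℕ} {D Ω : Set (Vec d)} (h : D ⊆ Ω) : H10 D →L[ℝ] H10 Ω :=
  (H10 D).subtypeL.codRestrict (H10 Ω) fun u => H10_mono h u.2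

/-- `H⁻¹_loc(Ω)`: the distributions on `Ω` whose restriction to every open `D` relatively compact in
`Ω` belongs to `H⁻¹(D)`, given by the consistent family of these restrictions. Its topology is the
coarsest that makes every restriction map to the normed space `H⁻¹(D)` continuous. -/
abbrev HNegLoc {d : ℕ} (Ω : Set (Vec d)) : Type :=
  {T : (D : Inner Ω) → HNeg D.1 //
    ∀ (D D' : Inner Ω) (h : D.1 ⊆ D'.1), (T D').comp (incl h) = T D}

/-- The canonical map `H⁻¹(Ω) → H⁻¹_loc(Ω)`. -/
def toLoc {d : ℕ} {Ω : Set (Vec d)} (T : HNeg Ω) : HNegLoc Ω :=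
  ⟨fun D => T.comp (incl (subset_closure.trans D.2.2.2)), fun _ _ _ => rfl⟩

/-- The vector fields `U n` belong to `L²(Ω)^d` and the sequence `curl (U n)` lies in a compact
subset of `H⁻¹_loc(Ω)^{d × d}`. -/
def CurlCompactLoc {d : ℕ} (Ω : Set (Vec d)) (U : ℕ → Vec d → Vec d) : Prop :=
  ∃ η : ℕ → L2V Ω, (∀ n, η n =ᵐ[leb Ω] U n) ∧
    ∃ K : Set (Fin d → Fin d → HNegLoc Ω), IsCompact K ∧
      ∀ n, (fun i j => toLoc (curl (η n) i j)) ∈ K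

/-- Weak-* convergence in `M(Ω)` of the functions `g n` (integrable on `Ω`) to the measure `ζ`,
tested against the continuous functions with compact support in `Ω`. -/
def WeakStarConv {d : ℕ} (Ω : Set (Vec d)) (g : ℕ → Vec d → ℝ) (ζ : SignedMeasure (Vec d)) :
    Prop :=
  ∀ φ : Vec d → ℝ, Continuous φ → HasCompactSupport φ → tsupport φ ⊆ Ω →
    Tendsto (fun n => ∫ x in Ω, g n x * φ x) atTop (𝓝 (∫ᵛ x, φ x ∂<•ζ))

end HConv

end

/-! ### Fourier analysis of Schwartz functions: the `H⁻¹(ℝ^d)` norm and an approximate Helmholtz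
decomposition. -/

noncomputable section

namespace HConv

open SchwartzMap FourierTransform LineDeriv Real

variable {d : ℕ}

/-! Write `w n = (A n)⁻¹ ξ n` and `W = As⁻¹ ξ₀`. The idea is to compare `w n` with correctors `P n`:
fields that oscillate like solutions of the equations, have strongly convergent curls, and converge
weakly to a field `P₀` that can be chosen arbitrarily close to `W` in `L²`. Since `A n` is symmetric
and `A n (w n) = ξ n`, the energy of the difference expands as `A n (w n - P n)·(w n - P n) = w n·ξ
n - 2 P n·ξ n + A n (P n)·P n`. The last two products converge in the sense of distributions by
compensated compactness (a strongly convergent divergence against a gradient), so the left side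
tends to `ζ - W·ξ₀ + As (W - P₀)·(W - P₀)` (`tendsto_energy_sub`). It is nonnegative; letting `P₀ →
W` gives `ζ ≥ W·ξ₀` (`le_of_tendsto_energy`).

If `ζ = W·ξ₀`, the same limit and coercivity show that `w n - P n` is asymptotically as small in
local `L²` as `W - P₀`, while the curls of `P n` converge strongly; hence `curl (w n) → curl W` in
`H⁻¹_loc` (`curlConvLoc`). Conversely, if the curls are compact, then along a subsequence `w n`
converges weakly to some `w` with strong local convergence of curls. The div-curl lemma against the
oscillating fluxes gives `As w = ξ₀` (`matL_limit_eq`), and against `ξ n` it gives convergence of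
the energy to `w·ξ₀` (`tendsto_energy_eq`).

Three ingredients support this. Compensated compactness rests on Rellich's theorem, proved by
Fourier transform (`tendsto_negSq`, `tendsto_inner_val`); the div-curl lemma (`tendsto_div_curl`)
follows from it through an approximate Helmholtz decomposition (`exists_potential`,
`exists_potential_of_curl`). The correctors are finite sums of localized gradients of solutions `u
n` whose weak limits are localized linear functions; such solutions exist because the limit solution
operator is coercive, hence onto (`exists_solutions_tendsto`). Finally, ellipticity and symmetry
pass to the `H`-limit (`elliptic_symm`), which makes `As⁻¹` bounded and `W·ξ₀` integrable. -/

/-- The `i`-th vector of the standard basis. -/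
abbrev stdb (i : Fin d) : Vec d := EuclideanSpace.single i 1

/-- The `i`-th partial derivative of a Schwartz function. -/
abbrev pd (i : Fin d) (f : 𝓢(Vec d, ℂ)) : 𝓢(Vec d, ℂ) := ∂_{stdb i} f

/-- The symbol of `(1 - Δ)⁻¹`. -/
def wt (k : Vec d) : ℝ := (1 + ‖(2 * π) • k‖ ^ 2)⁻¹

theorem wt_pos (k : Vec d) : 0 < wt k := by unfold wt; positivity

theorem wt_le_one (k : Vec d) : wt k ≤ 1 := by
  unfold wt; exact inv_le_one_of_one_le₀ (by nlinarith [sq_nonneg ‖(2 * π) • k‖])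

theorem wt_mul (k : Vec d) : wt k * (1 + ∑ i, (2 * π * k i) ^ 2) = 1 := by
  have : ‖(2 * π) • k‖ ^ 2 = ∑ i, (2 * π * k i) ^ 2 := by
    rw [EuclideanSpace.norm_sq_eq]; simp [mul_pow]
  unfold wt; rw [this]
  have : 0 ≤ ∑ i, (2 * π * k i) ^ 2 := Finset.sum_nonneg fun i _ => sq_nonneg _
  field_simp

theorem wt_temperate : (wt : Vec d → ℝ).HasTemperateGrowth := by
  have h1 := Function.hasTemperateGrowth_one_add_norm_sq_rpow (Vec d) (-1)
  have h2 : Function.HasTemperateGrowth (fun k : Vec d => (2 * π) • k) :=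
    ((2 * π) • ContinuousLinearMap.id ℝ (Vec d)).hasTemperateGrowth
  have h3 := h1.comp h2
  convert! h3 using 1
  ext k
  simp only [wt, Function.comp]
  rw [Real.rpow_neg_one]

theorem wt_continuous : Continuous (wt : Vec d → ℝ) := wt_temperate.1.continuous

/-- The operator `(1 - Δ)⁻¹` on Schwartz functions. -/
def bessel (f : 𝓢(Vec d, ℂ)) : 𝓢(Vec d, ℂ) := 𝓕⁻ (smulLeftCLM ℂ wt (𝓕 f))

theorem fourier_bessel (f : 𝓢(Vec d, ℂ)) (k : Vec d) : 𝓕 (bessel f) k = wt k * 𝓕 f k := by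
  unfold bessel
  rw [FourierTransform.fourier_fourierInv_eq, smulLeftCLM_apply_apply wt_temperate]
  simp

theorem fourier_lineDeriv (f : 𝓢(Vec d, ℂ)) (i : Fin d) (k : Vec d) :
    𝓕 (pd i f) k = Complex.I * ((2 * π * k i : ℝ) : ℂ) * 𝓕 f k := by
  rw [fourier_lineDerivOp_eq]
  have : (inner ℝ · (stdb i) : Vec d → ℝ).HasTemperateGrowth := by fun_prop
  rw [_root_.smul_apply, smulLeftCLM_apply_apply this]
  simp [EuclideanSpace.inner_single_right]
  ring

theorem norm_fourier_lineDeriv_sq (f : 𝓢(Vec d, ℂ)) (i : Fin d) (k : Vec d) :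
    ‖𝓕 (pd i f) k‖ ^ 2 = (2 * π * k i) ^ 2 * ‖𝓕 f k‖ ^ 2 := by
  rw [fourier_lineDeriv, norm_mul, norm_mul, Complex.norm_I, one_mul, Complex.norm_real, mul_pow, Real.norm_eq_abs, sq_abs]

theorem integrable_norm_sq (f : 𝓢(Vec d, ℂ)) : Integrable (fun x => ‖f x‖ ^ 2) :=
  (memLp_two_iff_integrable_sq_norm f.continuous.aestronglyMeasurable).1 (f.memLp 2)

theorem integrable_wt_mul (f : 𝓢(Vec d, ℂ)) : Integrable (fun x => wt x * ‖f x‖ ^ 2) := by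
  refine (integrable_norm_sq f).mono
    (wt_continuous.mul (f.continuous.norm.pow 2)).aestronglyMeasurable (.of_forall fun x => ?_)
  rw [norm_mul, Real.norm_of_nonneg (wt_pos x).le]
  exact mul_le_of_le_one_left (norm_nonneg _) (wt_le_one x)

/-- The squared `H⁻¹(ℝ^d)` norm of a Schwartz function. -/
def negSq (f : 𝓢(Vec d, ℂ)) : ℝ := ∫ k, wt k * ‖𝓕 f k‖ ^ 2

/-- The squared `L²(ℝ^d)` norm of a Schwartz function. -/
def lSq (f : 𝓢(Vec d, ℂ)) : ℝ := ∫ x, ‖f x‖ ^ 2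

theorem lSq_eq (f : 𝓢(Vec d, ℂ)) : lSq f = ∫ k, ‖𝓕 f k‖ ^ 2 := (integral_norm_sq_fourier f).symm

theorem negSq_nonneg (f : 𝓢(Vec d, ℂ)) : 0 ≤ negSq f :=
  integral_nonneg fun k => mul_nonneg (wt_pos k).le (sq_nonneg _)

theorem wt_mul_sq_le (i : Fin d) (k : Vec d) : wt k * (2 * π * k i) ^ 2 ≤ 1 := by
  rw [← wt_mul k]
  refine mul_le_mul_of_nonneg_left ?_ (wt_pos k).le
  have := Finset.single_le_sum (f := fun i => (2 * π * k i) ^ 2) (fun i _ => sq_nonneg _)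
    (Finset.mem_univ i)
  simp only at this
  linarith

theorem negSq_lineDeriv_le (f : 𝓢(Vec d, ℂ)) (i : Fin d) : negSq (pd i f) ≤ lSq f := by
  rw [lSq_eq]
  refine integral_mono (integrable_wt_mul _) (integrable_norm_sq _) fun k => ?_
  simp only
  rw [norm_fourier_lineDeriv_sq, ← mul_assoc]
  exact mul_le_of_le_one_left (sq_nonneg _) (wt_mul_sq_le i k)

/-- Cauchy-Schwarz inequality for the duality of `H⁻¹(ℝ^d)` and `H¹(ℝ^d)`. -/
theorem norm_integral_inner_sq_le (f g : 𝓢(Vec d, ℂ)) :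
    ‖∫ x, inner ℂ (f x) (g x)‖ ≤ √(negSq f) * √(lSq g + ∑ i, lSq (pd i g)) := by
  rw [← integral_inner_fourier_fourier]
  have e : lSq g + ∑ i, lSq (pd i g) = ∫ k, (wt k)⁻¹ * ‖𝓕 g k‖ ^ 2 := by
    simp_rw [lSq_eq]
    rw [← integral_finsetSum _ fun i _ => integrable_norm_sq _, ← integral_add
      (integrable_norm_sq _) (integrable_finsetSum _ fun i _ => integrable_norm_sq _)]
    congr 1; ext k
    simp_rw [norm_fourier_lineDeriv_sq]
    rw [← Finset.sum_mul, ← one_add_mul, ← inv_eq_of_mul_eq_one_right (wt_mul k)]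
  have hint : Integrable fun k => (wt k)⁻¹ * ‖𝓕 g k‖ ^ 2 := by
    have : Integrable (fun k => ‖𝓕 g k‖ ^ 2 + ∑ i, ‖𝓕 (pd i g) k‖ ^ 2) :=
      (integrable_norm_sq _).add (integrable_finsetSum _ fun i _ => integrable_norm_sq _)
    refine this.congr (.of_forall fun k => ?_)
    simp only
    simp_rw [norm_fourier_lineDeriv_sq]
    rw [← Finset.sum_mul, ← one_add_mul, ← inv_eq_of_mul_eq_one_right (wt_mul k)]
  have hc : Continuous fun k : Vec d => √(wt k) := wt_continuous.sqrt
  have hpos : ∀ k : Vec d, 0 < √(wt k) := fun k => Real.sqrt_pos.2 (wt_pos k)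
  have cF : Continuous fun k => ‖𝓕 f k‖ := (𝓕 f).continuous.norm
  have cG : Continuous fun k => ‖𝓕 g k‖ := (𝓕 g).continuous.norm
  have hsq : ∀ k : Vec d, √(wt k) ^ 2 = wt k := fun k => Real.sq_sqrt (wt_pos k).le
  have mF : MemLp (fun k => √(wt k) * ‖𝓕 f k‖) 2 := by
    refine (memLp_two_iff_integrable_sq (hc.mul cF).aestronglyMeasurable).2 ?_
    simp only [Pi.mul_apply, mul_pow, hsq]
    exact integrable_wt_mul _
  have mG : MemLp (fun k => (√(wt k))⁻¹ * ‖𝓕 g k‖) 2 := by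
    refine (memLp_two_iff_integrable_sq
      ((hc.inv₀ fun k => (hpos k).ne').mul cG).aestronglyMeasurable).2 ?_
    simp only [Pi.mul_apply, Pi.inv_apply, mul_pow, inv_pow, hsq]
    exact hint
  calc ‖∫ k, inner ℂ (𝓕 f k) (𝓕 g k)‖ ≤ ∫ k, (√(wt k) * ‖𝓕 f k‖) * ((√(wt k))⁻¹ * ‖𝓕 g k‖) := by
        refine norm_integral_le_of_norm_le (mF.integrable_mul mG) (.of_forall fun k => ?_)
        refine (norm_inner_le_norm _ _).trans (le_of_eq ?_)
        have := (hpos k).ne'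
        field_simp
    _ ≤ (∫ k, (√(wt k) * ‖𝓕 f k‖) ^ (2 : ℝ)) ^ (1 / (2 : ℝ)) *
        (∫ k, ((√(wt k))⁻¹ * ‖𝓕 g k‖) ^ (2 : ℝ)) ^ (1 / (2 : ℝ)) :=
        integral_mul_le_Lp_mul_Lq_of_nonneg ⟨by norm_num, by norm_num, by norm_num⟩
          (.of_forall fun _ => by positivity) (.of_forall fun _ => by positivity)
          (by rwa [ENNReal.ofReal_ofNat]) (by rwa [ENNReal.ofReal_ofNat])
    _ = _ := by
        rw [e, ← Real.sqrt_eq_rpow, ← Real.sqrt_eq_rpow]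
        simp_rw [Real.rpow_two, mul_pow, inv_pow, hsq]
        rfl

/-- The Riesz representative `z = (1 - Δ)⁻¹ f` attains the `H⁻¹` norm. Its bounds come from `wt ≤ 1`
and `wt k * (2πkᵢ)² ≤ 1`. It turns an `H⁻¹` norm into a pairing that can be estimated. -/
theorem exists_dual (f : 𝓢(Vec d, ℂ)) : ∃ z : 𝓢(Vec d, ℂ),
    ∫ x, inner ℂ (f x) (z x) = negSq f ∧ lSq z ≤ negSq f ∧
      ∀ i, lSq (pd i z) ≤ negSq f := by
  refine ⟨bessel f, ?_, ?_, fun i => ?_⟩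
  · rw [← integral_inner_fourier_fourier, negSq, ← integral_complex_ofReal]
    congr 1; ext k
    rw [fourier_bessel]
    rw [← smul_eq_mul, inner_smul_right, inner_self_eq_norm_sq_to_K]
    push_cast; rfl
  · rw [lSq_eq]
    refine integral_mono (integrable_norm_sq _) (integrable_wt_mul _) fun k => ?_
    simp only
    rw [fourier_bessel, norm_mul, mul_pow, Complex.norm_real, Real.norm_of_nonneg (wt_pos k).le]
    refine mul_le_mul_of_nonneg_right ?_ (sq_nonneg _)
    nlinarith [wt_pos k, wt_le_one k]
  · rw [lSq_eq]
    refine integral_mono (integrable_norm_sq _) (integrable_wt_mul _) fun k => ?_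
    simp only
    rw [norm_fourier_lineDeriv_sq, fourier_bessel, norm_mul, Complex.norm_real,
      Real.norm_of_nonneg (wt_pos k).le]
    calc _ = wt k * (2 * π * k i) ^ 2 * (wt k * ‖𝓕 f k‖ ^ 2) := by ring
      _ ≤ _ := mul_le_of_le_one_left (mul_nonneg (wt_pos k).le (sq_nonneg _)) (wt_mul_sq_le i k)

theorem norm_sum_mul_sq_le (a : Fin d → ℝ) (z : Fin d → ℂ) :
    ‖∑ i, (a i : ℂ) * z i‖ ^ 2 ≤ (∑ i, a i ^ 2) * ∑ i, ‖z i‖ ^ 2 := by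
  have h1 : ‖∑ i, (a i : ℂ) * z i‖ ≤ ∑ i, |a i| * ‖z i‖ := by
    refine (norm_sum_le _ _).trans (le_of_eq ?_)
    simp
  calc _ ≤ (∑ i, |a i| * ‖z i‖) ^ 2 := by gcongr
    _ ≤ (∑ i, |a i| ^ 2) * ∑ i, ‖z i‖ ^ 2 := Finset.sum_mul_sq_le_sq_mul_sq _ _ _
    _ = _ := by simp

/-- Helmholtz decomposition: a vector field is close to a gradient if it is small in `H⁻¹`
together with its curl. -/
theorem exists_potential (t : Fin d → 𝓢(Vec d, ℂ)) : ∃ q : 𝓢(Vec d, ℂ),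
    lSq q ≤ ∑ i, lSq (t i) ∧ (∀ j, lSq (pd j q) ≤ ∑ i, lSq (t i)) ∧
    ∀ j, lSq (t j - pd j q) ≤
      negSq (t j) + ∑ i, negSq (pd i (t j) - pd j (t i)) := by
  -- With `q = -(1 - Δ)⁻¹ div t`, the error satisfies `(1 - Δ)(tⱼ - ∂ⱼq) = tⱼ - ∑ᵢ ∂ᵢ(∂ᵢtⱼ - ∂ⱼtᵢ)`,
  -- so only `tⱼ` and its curl enter.
  set q := bessel (-∑ i, pd i (t i)) with hq
  have Fq : ∀ k, 𝓕 q k = -(wt k * (Complex.I * ∑ i, ((2 * π * k i : ℝ) : ℂ) * 𝓕 (t i) k)) := by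
    intro k
    have e1 : 𝓕 (-∑ i, pd i (t i)) = -∑ i, 𝓕 (pd i (t i)) := by
      rw [← fourierCLM_apply (R := ℂ), map_neg, map_sum]
      rfl
    rw [hq, fourier_bessel, e1, _root_.neg_apply, _root_.sum_apply, Finset.mul_sum]
    simp_rw [fourier_lineDeriv]
    rw [mul_neg]
    congr 2
    exact Finset.sum_congr rfl fun i _ => by ring
  have S1 : ∀ k : Vec d, wt k * ∑ i, (2 * π * k i) ^ 2 ≤ 1 := fun k => by
    have := wt_mul k
    nlinarith [wt_pos k]
  have S0 : ∀ k : Vec d, 0 ≤ ∑ i, (2 * π * k i) ^ 2 := fun k =>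
    Finset.sum_nonneg fun i _ => sq_nonneg _
  have T0 : ∀ k : Vec d, 0 ≤ ∑ i, ‖𝓕 (t i) k‖ ^ 2 := fun k =>
    Finset.sum_nonneg fun i _ => sq_nonneg _
  have nq : ∀ k, ‖𝓕 q k‖ ^ 2 ≤ wt k * ∑ i, ‖𝓕 (t i) k‖ ^ 2 := by
    intro k
    rw [Fq, norm_neg, norm_mul, norm_mul, Complex.norm_I, one_mul, Complex.norm_real,
      Real.norm_of_nonneg (wt_pos k).le, mul_pow]
    have := norm_sum_mul_sq_le (fun i => 2 * π * k i) (fun i => 𝓕 (t i) k)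
    calc _ ≤ wt k ^ 2 * ((∑ i, (2 * π * k i) ^ 2) * ∑ i, ‖𝓕 (t i) k‖ ^ 2) := by gcongr
      _ = wt k * ((wt k * ∑ i, (2 * π * k i) ^ 2) * ∑ i, ‖𝓕 (t i) k‖ ^ 2) := by ring
      _ ≤ wt k * (1 * ∑ i, ‖𝓕 (t i) k‖ ^ 2) := by
        have := (wt_pos k).le
        have := T0 k
        gcongr
        exact S1 k
      _ = _ := by ring
  have hsum : ∑ i, lSq (t i) = ∫ k, ∑ i, ‖𝓕 (t i) k‖ ^ 2 := by
    simp_rw [lSq_eq]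
    rw [← integral_finsetSum _ fun i _ => integrable_norm_sq _]
  have hint : Integrable fun k => ∑ i, ‖𝓕 (t i) k‖ ^ 2 :=
    integrable_finsetSum _ fun i _ => integrable_norm_sq _
  refine ⟨q, ?_, fun j => ?_, fun j => ?_⟩
  · rw [hsum, lSq_eq]
    refine integral_mono (integrable_norm_sq _) hint fun k => (nq k).trans ?_
    exact mul_le_of_le_one_left (T0 k) (wt_le_one k)
  · rw [hsum, lSq_eq]
    refine integral_mono (integrable_norm_sq _) hint fun k => ?_
    simp only
    rw [norm_fourier_lineDeriv_sq]
    calc _ ≤ (2 * π * k j) ^ 2 * (wt k * ∑ i, ‖𝓕 (t i) k‖ ^ 2) := by gcongr; exact nq k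
      _ = (wt k * (2 * π * k j) ^ 2) * ∑ i, ‖𝓕 (t i) k‖ ^ 2 := by ring
      _ ≤ _ := mul_le_of_le_one_left (T0 k) (wt_mul_sq_le j k)
  · rw [lSq_eq]
    simp_rw [negSq]
    rw [← integral_finsetSum _ fun i _ => integrable_wt_mul _, ← integral_add
      (integrable_wt_mul _) (integrable_finsetSum _ fun i _ => integrable_wt_mul _)]
    refine integral_mono (integrable_norm_sq _)
      ((integrable_wt_mul _).add (integrable_finsetSum _ fun i _ => integrable_wt_mul _))
      fun k => ?_
    simp only
    have fsub : ∀ a b : 𝓢(Vec d, ℂ), 𝓕 (a - b) = 𝓕 a - 𝓕 b := fun a b => by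
      rw [← fourierCLM_apply (R := ℂ), map_sub]; rfl
    set c : Fin d → ℂ := fun i => 𝓕 (pd i (t j) - pd j (t i)) k with hc
    have hci : ∀ i, c i = Complex.I * (((2 * π * k i : ℝ) : ℂ) * 𝓕 (t j) k -
        ((2 * π * k j : ℝ) : ℂ) * 𝓕 (t i) k) := fun i => by
      simp only [hc]
      rw [fsub, _root_.sub_apply, fourier_lineDeriv, fourier_lineDeriv]; ring
    have e : 𝓕 (t j - pd j q) k =
        wt k * (𝓕 (t j) k + -Complex.I * ∑ i, ((2 * π * k i : ℝ) : ℂ) * c i) := by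
      rw [fsub, _root_.sub_apply, fourier_lineDeriv, Fq]
      have hw : (wt k : ℂ) * (1 + ∑ i, ((2 * π * k i : ℝ) : ℂ) ^ 2) = 1 := by
        exact_mod_cast wt_mul k
      have h2 : ∑ i, ((2 * π * k i : ℝ) : ℂ) * c i = Complex.I *
          ((∑ i, ((2 * π * k i : ℝ) : ℂ) ^ 2) * 𝓕 (t j) k - ((2 * π * k j : ℝ) : ℂ) *
            ∑ i, ((2 * π * k i : ℝ) : ℂ) * 𝓕 (t i) k) := by
        rw [Finset.sum_mul, Finset.mul_sum, ← Finset.sum_sub_distrib, Finset.mul_sum]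
        exact Finset.sum_congr rfl fun i _ => by rw [hci]; ring
      rw [h2]
      linear_combination (-𝓕 (t j) k) * hw + ((wt k : ℂ) * 𝓕 (t j) k *
        (∑ i, ((2 * π * k i : ℝ) : ℂ) ^ 2)) * Complex.I_sq
    rw [e, norm_mul, Complex.norm_real, Real.norm_of_nonneg (wt_pos k).le, mul_pow]
    -- Cauchy-Schwarz for the vectors `(1, 2πk)` and `(𝓕 tⱼ, c)`; the factor `1 + |2πk|²` then
    -- cancels one of the two powers of `wt`.
    have hn : ‖𝓕 (t j) k + -Complex.I * ∑ i, ((2 * π * k i : ℝ) : ℂ) * c i‖ ^ 2 ≤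
        (1 + ∑ i, (2 * π * k i) ^ 2) * (‖𝓕 (t j) k‖ ^ 2 + ∑ i, ‖c i‖ ^ 2) := by
      have h3 := norm_sum_mul_sq_le (fun i => 2 * π * k i) c
      have h4 : ‖𝓕 (t j) k + -Complex.I * ∑ i, ((2 * π * k i : ℝ) : ℂ) * c i‖ ≤
          ‖𝓕 (t j) k‖ + ‖∑ i, ((2 * π * k i : ℝ) : ℂ) * c i‖ := by
        refine (norm_add_le _ _).trans (le_of_eq ?_)
        rw [norm_mul, norm_neg, Complex.norm_I, one_mul]
      set A := ‖𝓕 (t j) k‖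
      set B := ‖∑ i, ((2 * π * k i : ℝ) : ℂ) * c i‖
      set X := ∑ i, (2 * π * k i) ^ 2
      set Y := ∑ i, ‖c i‖ ^ 2
      have hX : 0 ≤ X := S0 k
      have hY : 0 ≤ Y := Finset.sum_nonneg fun i _ => sq_nonneg _
      calc _ ≤ (A + B) ^ 2 := by gcongr
        _ ≤ (1 + X) * (A ^ 2 + Y) := by
          have hB : 0 ≤ B := norm_nonneg _
          have hA : 0 ≤ A := norm_nonneg _
          have hAB : 2 * (A * B) ≤ X * A ^ 2 + Y := by
            refine abs_le_of_sq_le_sq' ?_ (by positivity) |>.2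
            calc (2 * (A * B)) ^ 2 = 4 * A ^ 2 * B ^ 2 := by ring
              _ ≤ 4 * A ^ 2 * (X * Y) := by gcongr
              _ ≤ _ := by nlinarith [sq_nonneg (X * A ^ 2 - Y)]
          nlinarith
    calc _ ≤ wt k ^ 2 * ((1 + ∑ i, (2 * π * k i) ^ 2) * (‖𝓕 (t j) k‖ ^ 2 + ∑ i, ‖c i‖ ^ 2)) := by
          gcongr
      _ = (wt k * (1 + ∑ i, (2 * π * k i) ^ 2)) * (wt k * (‖𝓕 (t j) k‖ ^ 2 + ∑ i, ‖c i‖ ^ 2)) := by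
          ring
      _ = _ := by rw [wt_mul, one_mul, mul_add, Finset.mul_sum]

end HConv

end

/-! ### Multiplication of `L²` functions by bounded operator fields, and weak convergence. -/

noncomputable section

namespace HConv

section FieldMul

variable {α E F : Type*} {mα : MeasurableSpace α} {μ : Measure α}
  [NormedAddCommGroup E] [NormedSpace ℝ E] [NormedAddCommGroup F] [NormedSpace ℝ F]

/-- Essentially bounded measurable fields. -/
def AEBdd (μ : Measure α) (b : α → E) : Prop :=
  AEStronglyMeasurable b μ ∧ ∃ C, ∀ᵐ x ∂μ, ‖b x‖ ≤ C

theorem AEBdd.norm_apply_le {b : α → E →L[ℝ] F} (h : AEBdd μ b) (f : α → E) :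
    ∀ᵐ x ∂μ, ‖b x (f x)‖ ≤ h.2.choose * ‖f x‖ := by
  filter_upwards [h.2.choose_spec] with x hx
  exact (b x).le_of_opNorm_le hx _

theorem AEBdd.memLp_apply {b : α → E →L[ℝ] F} (h : AEBdd μ b) {f : α → E} (hf : MemLp f 2 μ) :
    MemLp (fun x => b x (f x)) 2 μ :=
  hf.of_le_mul ((ContinuousLinearMap.apply ℝ F).flip.aestronglyMeasurable_comp₂ h.1 hf.1)
    (h.norm_apply_le f)

open Classical in
/-- Pointwise application of an essentially bounded field of operators to an `L²` function. -/
def fieldMul (μ : Measure α) (b : α → E →L[ℝ] F) : Lp E 2 μ →L[ℝ] Lp F 2 μ :=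
  if h : AEBdd μ b then
    LinearMap.mkContinuous
      { toFun := fun f => (h.memLp_apply (Lp.memLp f)).toLp
        map_add' := fun f g => by
          rw [← MemLp.toLp_add, MemLp.toLp_eq_toLp_iff]
          filter_upwards [Lp.coeFn_add f g] with x hx
          rw [hx]
          exact map_add _ _ _
        map_smul' := fun c f => by
          rw [RingHom.id_apply, ← MemLp.toLp_const_smul, MemLp.toLp_eq_toLp_iff]
          filter_upwards [Lp.coeFn_smul c f] with x hx
          rw [hx]
          exact map_smul _ _ _ } h.2.choose fun f => Lp.norm_le_mul_norm_of_ae_le_mul (by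
            filter_upwards [(h.memLp_apply (Lp.memLp f)).coeFn_toLp, h.norm_apply_le f] with x h1 h2
            simpa [h1] using h2)
  else 0

theorem fieldMul_ae {b : α → E →L[ℝ] F} (h : AEBdd μ b) (f : Lp E 2 μ) :
    fieldMul μ b f =ᵐ[μ] fun x => b x (f x) := by
  rw [fieldMul, dif_pos h]
  exact (h.memLp_apply (Lp.memLp f)).coeFn_toLp

end FieldMul

section Weak

variable {X Y : Type*} [NormedAddCommGroup X] [NormedSpace ℝ X]
  [NormedAddCommGroup Y] [NormedSpace ℝ Y]

/-- The uniform boundedness principle, applied to the sequence seen in the bidual, where it is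
pointwise bounded. -/
theorem WeakConv.bounded {x : ℕ → X} {a : X} (h : WeakConv x a) : ∃ C, ∀ n, ‖x n‖ ≤ C := by
  obtain ⟨C, hC⟩ := banach_steinhaus
    (g := fun n => NormedSpace.inclusionInDoubleDual ℝ X (x n)) fun ℓ => by
      obtain ⟨C, hC⟩ := (h ℓ).norm.bddAbove_range
      exact ⟨C, fun n => hC ⟨n, rfl⟩⟩
  refine ⟨C, fun n => ?_⟩
  have := hC n
  rwa [show ‖NormedSpace.inclusionInDoubleDual ℝ X (x n)‖ = ‖x n‖ from
    (NormedSpace.inclusionInDoubleDualLi ℝ (E := X)).norm_map (x n)] at this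

theorem WeakConv.map {x : ℕ → X} {a : X} (h : WeakConv x a) (T : X →L[ℝ] Y) :
    WeakConv (fun n => T (x n)) (T a) := fun ℓ => h (ℓ.comp T)

theorem WeakConv.map_zero {x : ℕ → X} (h : WeakConv x 0) (T : X →L[ℝ] Y) :
    WeakConv (fun n => T (x n)) 0 := by simpa using h.map T

theorem WeakConv.sub_zero {x y : ℕ → X} (h : WeakConv x 0) (h' : WeakConv y 0) :
    WeakConv (fun n => x n - y n) 0 := fun ℓ => by
  simpa using (h ℓ).sub (h' ℓ)

theorem WeakConv.sub {x y : ℕ → X} {a b : X} (h : WeakConv x a) (h' : WeakConv y b) :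
    WeakConv (fun n => x n - y n) (a - b) := fun ℓ => by
  simpa using (h ℓ).sub (h' ℓ)

theorem WeakConv.add {x y : ℕ → X} {a b : X} (h : WeakConv x a) (h' : WeakConv y b) :
    WeakConv (fun n => x n + y n) (a + b) := fun ℓ => by
  simpa using (h ℓ).add (h' ℓ)

theorem WeakConv.congr_fun {x y : ℕ → X} {a : X} (h : WeakConv x a) (hxy : ∀ n, x n = y n) :
    WeakConv y a := (funext hxy : x = y) ▸ h

theorem weakConv_const (a : X) : WeakConv (fun _ => a) a := fun _ => tendsto_const_nhds

theorem WeakConv.sub_const {x : ℕ → X} {a : X} (h : WeakConv x a) :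
    WeakConv (fun n => x n - a) 0 := by simpa using h.sub (weakConv_const a)

theorem WeakConv.comp_tendsto {x : ℕ → X} {a : X} (h : WeakConv x a) {k : ℕ → ℕ}
    (hk : Tendsto k atTop atTop) : WeakConv (fun n => x (k n)) a := fun ℓ => (h ℓ).comp hk

theorem _root_.Filter.Tendsto.weakConv {x : ℕ → X} {a : X} (h : Tendsto x atTop (𝓝 a)) :
    WeakConv x a := fun ℓ => (ℓ.continuous.tendsto a).comp h

theorem WeakConv.unique {x : ℕ → X} {a b : X} (h : WeakConv x a) (h' : WeakConv x b) : a = b :=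
  (SeparatingDual.eq_iff_forall_dual_eq (R := ℝ)).2 fun ℓ => tendsto_nhds_unique (h ℓ) (h' ℓ)

end Weak

section WeakInner

variable {H : Type*} [NormedAddCommGroup H] [InnerProductSpace ℝ H]

theorem WeakConv.inner_left {x : ℕ → H} {a : H} (h : WeakConv x a) (b : H) :
    Tendsto (fun n => inner ℝ (x n) b) atTop (𝓝 (inner ℝ a b)) := by
  simpa [real_inner_comm] using h (innerSL ℝ b)

theorem WeakConv.inner_right {x : ℕ → H} {a : H} (h : WeakConv x a) (b : H) :
    Tendsto (fun n => inner ℝ b (x n)) atTop (𝓝 (inner ℝ b a)) := h (innerSL ℝ b)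

theorem tendsto_inner_of_bounded_of_zero {x y : ℕ → H} {C : ℝ} (hx : ∀ n, ‖x n‖ ≤ C)
    (hy : Tendsto (fun n => ‖y n‖) atTop (𝓝 0)) :
    Tendsto (fun n => inner ℝ (x n) (y n)) atTop (𝓝 0) := by
  refine squeeze_zero_norm (a := fun n => C * ‖y n‖) (fun n => ?_) (by simpa using hy.const_mul C)
  exact (norm_inner_le_norm _ _).trans (by gcongr; exact hx n)

end WeakInner

end HConv

end

/-! ### Test functions, the structure of `H¹₀(Ω)`, divergence and curl as functionals. -/

noncomputable section

namespace HConv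

variable {d : ℕ} {Ω : Set (Vec d)} {φ ψ : Vec d → ℝ}

/-- Test functions on `Ω`. -/
def IsTest (Ω : Set (Vec d)) (φ : Vec d → ℝ) : Prop :=
  ContDiff ℝ ∞ φ ∧ HasCompactSupport φ ∧ tsupport φ ⊆ Ω

/-- The `i`-th partial derivative. -/
def dd (i : Fin d) (φ : Vec d → ℝ) (x : Vec d) : ℝ := fderiv ℝ φ x (stdb i)

namespace IsTest

theorem continuous (h : IsTest Ω φ) : Continuous φ := h.1.continuous

theorem differentiable (h : IsTest Ω φ) : Differentiable ℝ φ := h.1.differentiable (by simp)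

theorem mono {D : Set (Vec d)} (h : IsTest D φ) (hD : D ⊆ Ω) : IsTest Ω φ :=
  ⟨h.1, h.2.1, h.2.2.trans hD⟩

theorem pderiv (h : IsTest Ω φ) (i : Fin d) : IsTest Ω (dd i φ) := by
  refine ⟨(h.1.fderiv_right (m := ∞) le_rfl).clm_apply contDiff_const, ?_,
    (tsupport_fderiv_apply_subset ℝ _).trans h.2.2⟩
  exact h.2.1.fderiv_apply (𝕜 := ℝ) _

theorem eq_zero (h : IsTest Ω φ) {x : Vec d} (hx : x ∉ Ω) : φ x = 0 :=
  image_eq_zero_of_notMem_tsupport fun h' => hx (h.2.2 h')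

theorem zero : IsTest Ω (0 : Vec d → ℝ) :=
  ⟨contDiff_const, HasCompactSupport.zero, by simp [tsupport]⟩

theorem add (h : IsTest Ω φ) (h' : IsTest Ω ψ) : IsTest Ω (φ + ψ) :=
  ⟨h.1.add h'.1, h.2.1.add h'.2.1, (tsupport_add _ _).trans (union_subset h.2.2 h'.2.2)⟩

theorem const_smul (h : IsTest Ω φ) (c : ℝ) : IsTest Ω (c • φ) :=
  ⟨h.1.const_smul c, h.2.1.mono (Function.support_const_smul_subset c φ),
    (closure_mono (Function.support_const_smul_subset c φ)).trans h.2.2⟩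

theorem mul_left (h : IsTest Ω φ) {f : Vec d → ℝ} (hf : ContDiff ℝ ∞ f) :
    IsTest Ω (fun x => f x * φ x) :=
  ⟨hf.mul h.1, h.2.1.mul_left, (tsupport_mul_subset_right).trans h.2.2⟩

theorem mul_right (h : IsTest Ω φ) {f : Vec d → ℝ} (hf : ContDiff ℝ ∞ f) :
    IsTest Ω (fun x => φ x * f x) :=
  ⟨h.1.mul hf, h.2.1.mul_right, (tsupport_mul_subset_left).trans h.2.2⟩

theorem memLp (h : IsTest Ω φ) (μ : Measure (Vec d)) [IsFiniteMeasureOnCompacts μ] :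
    MemLp φ 2 μ := h.continuous.memLp_of_hasCompactSupport h.2.1

theorem bounded (h : IsTest Ω φ) : ∃ C, ∀ x, ‖φ x‖ ≤ C :=
  h.2.1.exists_bound_of_continuous h.continuous

end IsTest

theorem gradient_apply {x : Vec d} (i : Fin d) :
    gradient φ x i = dd i φ x := by
  have := (InnerProductSpace.toDual_symm_apply (𝕜 := ℝ) (y := fderiv ℝ φ x) (x := stdb i))
  rw [dd, ← this, gradient, EuclideanSpace.inner_single_right]
  simp

theorem IsTest.gradient_eq_zero (h : IsTest Ω φ) {x : Vec d} (hx : x ∉ Ω) : gradient φ x = 0 := by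
  ext i
  rw [gradient_apply, (h.pderiv i).eq_zero hx]
  rfl

theorem IsTest.continuous_gradient (h : IsTest Ω φ) : Continuous (gradient φ) := by
  refine (PiLp.continuous_toLp 2 _).comp (f := fun x i => gradient φ x i) (continuous_pi fun i => ?_)
  simp_rw [gradient_apply]
  exact (h.pderiv i).continuous

theorem IsTest.gradient_compact (h : IsTest Ω φ) : HasCompactSupport (gradient φ) := by
  refine h.2.1.mono' fun x hx => ?_
  by_contra h'
  apply hx
  ext i
  rw [gradient_apply]
  refine image_eq_zero_of_notMem_tsupport fun h'' => h' ?_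
  exact (tsupport_fderiv_apply_subset ℝ _) h''

theorem IsTest.memLp_gradient (h : IsTest Ω φ) (μ : Measure (Vec d))
    [IsFiniteMeasureOnCompacts μ] : MemLp (gradient φ) 2 μ :=
  h.continuous_gradient.memLp_of_hasCompactSupport h.gradient_compact

theorem dd_mul {x : Vec d} (hφ : DifferentiableAt ℝ φ x) (hψ : DifferentiableAt ℝ ψ x) (i : Fin d) :
    dd i (fun x => φ x * ψ x) x = φ x * dd i ψ x + ψ x * dd i φ x := by
  simp only [dd]
  rw [fderiv_fun_mul hφ hψ]
  simp

/-- Integration by parts. -/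
theorem IsTest.integral_mul_dd (h : IsTest Ω φ) (hψ : ContDiff ℝ ∞ ψ) (i : Fin d) :
    ∫ x, ψ x * dd i φ x = -∫ x, dd i ψ x * φ x := by
  have c1 : Continuous (fun x => dd i ψ x) :=
    ((hψ.fderiv_right (m := ∞) le_rfl).clm_apply contDiff_const).continuous
  refine integral_mul_fderiv_eq_neg_fderiv_mul_of_integrable ?_ ?_ ?_
    (fun x _ => hψ.differentiable (by simp) x) (fun x _ => h.differentiable x)
  · exact (c1.mul h.continuous).integrable_of_hasCompactSupport h.2.1.mul_left
  · exact (hψ.continuous.mul (h.pderiv i).continuous).integrable_of_hasCompactSupport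
      (h.pderiv i).2.1.mul_left
  · exact (hψ.continuous.mul h.continuous).integrable_of_hasCompactSupport h.2.1.mul_left

open Classical in
/-- The element of the ambient space defined by a test function. -/
def testA (φ : Vec d → ℝ) : Ambient d :=
  if h : IsTest univ φ then
    WithLp.toLp 2 ((h.memLp volume).toLp, (h.memLp_gradient volume).toLp) else 0

theorem testA_fst (h : IsTest Ω φ) : (testA φ).fst =ᵐ[volume] φ := by
  rw [testA, dif_pos (h.mono (subset_univ _))]; exact (h.memLp volume).coeFn_toLp

theorem testA_snd (h : IsTest Ω φ) : (testA φ).snd =ᵐ[volume] gradient φ := by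
  rw [testA, dif_pos (h.mono (subset_univ _))]; exact (h.memLp_gradient volume).coeFn_toLp

theorem testA_mem (h : IsTest Ω φ) : testA φ ∈ H10 Ω :=
  Submodule.le_topologicalClosure _ (Submodule.subset_span
    ⟨φ, h.1, h.2.1, h.2.2, testA_fst h, testA_snd h⟩)

theorem eq_testA {p : Ambient d} (h : IsTest Ω φ) (h1 : p.fst =ᵐ[volume] φ)
    (h2 : p.snd =ᵐ[volume] gradient φ) : p = testA φ := by
  have e1 : p.fst = (testA φ).fst := Lp.ext (h1.trans (testA_fst h).symm)
  have e2 : p.snd = (testA φ).snd := Lp.ext (h2.trans (testA_snd h).symm)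
  exact (WithLp.ofLp_injective 2) (Prod.ext e1 e2)

theorem gradient_add_apply (h : IsTest Ω φ) (h' : IsTest Ω ψ) (x : Vec d) :
    gradient (φ + ψ) x = gradient φ x + gradient ψ x := by
  ext i
  rw [PiLp.add_apply]
  simp_rw [gradient_apply, dd]
  rw [fderiv_add (h.differentiable x) (h'.differentiable x)]
  rfl

theorem gradient_smul_apply (h : IsTest Ω φ) (c : ℝ) (x : Vec d) :
    gradient (c • φ) x = c • gradient φ x := by
  ext i
  rw [PiLp.smul_apply]
  simp_rw [gradient_apply, dd]
  rw [fderiv_const_smul (h.differentiable x)]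
  rfl

open Classical in
/-- The element of `H¹₀(Ω)` defined by a test function. -/
def testH (Ω : Set (Vec d)) (φ : Vec d → ℝ) : H10 Ω :=
  if h : IsTest Ω φ then ⟨testA φ, testA_mem h⟩ else 0

theorem testH_coe (h : IsTest Ω φ) : (testH Ω φ : Ambient d) = testA φ := by
  rw [testH, dif_pos h]

theorem testA_add (h : IsTest Ω φ) (h' : IsTest Ω ψ) : testA (φ + ψ) = testA φ + testA ψ := by
  symm
  refine eq_testA (h.add h') ?_ ?_
  · filter_upwards [testA_fst h, testA_fst h', Lp.coeFn_add (testA φ).fst (testA ψ).fst] with x a b c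
    rw [WithLp.add_fst, c, Pi.add_apply, a, b]; rfl
  · filter_upwards [testA_snd h, testA_snd h', Lp.coeFn_add (testA φ).snd (testA ψ).snd] with x a b c
    rw [WithLp.add_snd, c, Pi.add_apply, a, b, gradient_add_apply h h']

theorem testA_smul (h : IsTest Ω φ) (c : ℝ) : testA (c • φ) = c • testA φ := by
  symm
  refine eq_testA (h.const_smul c) ?_ ?_
  · filter_upwards [testA_fst h, Lp.coeFn_smul c (testA φ).fst] with x a b
    rw [WithLp.smul_fst, b, Pi.smul_apply, a]; rfl
  · filter_upwards [testA_snd h, Lp.coeFn_smul c (testA φ).snd] with x a b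
    rw [WithLp.smul_snd, b, Pi.smul_apply, a, gradient_smul_apply h]

theorem testH_add (h : IsTest Ω φ) (h' : IsTest Ω ψ) :
    testH Ω (φ + ψ) = testH Ω φ + testH Ω ψ := by
  ext1
  rw [Submodule.coe_add, testH_coe h, testH_coe h', testH_coe (h.add h'), testA_add h h']

theorem testH_smul (h : IsTest Ω φ) (c : ℝ) : testH Ω (c • φ) = c • testH Ω φ := by
  ext1
  rw [Submodule.coe_smul, testH_coe h, testH_coe (h.const_smul c), testA_smul h]

/-- Test functions are stable under linear combinations, so the span adds nothing, and every element
of `H¹₀(Ω)` is a limit of single test functions. This yields `H10_induction`, by which closed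
statements are checked on test functions only. -/
theorem span_testGraph (p : Ambient d) (hp : p ∈ Submodule.span ℝ (testGraph Ω)) :
    ∃ φ, IsTest Ω φ ∧ p = testA φ := by
  induction hp using Submodule.span_induction with
  | mem x hx =>
    obtain ⟨φ, h1, h2, h3, h4, h5⟩ := hx
    exact ⟨φ, ⟨h1, h2, h3⟩, eq_testA ⟨h1, h2, h3⟩ h4 h5⟩
  | zero => 
    refine ⟨0, .zero, ?_⟩
    have := testA_smul (.zero : IsTest Ω 0) 0
    rwa [zero_smul, zero_smul, eq_comm] at this
  | add x y _ _ hx hy =>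
    obtain ⟨φ, h1, rfl⟩ := hx
    obtain ⟨ψ, h2, rfl⟩ := hy
    exact ⟨_, h1.add h2, (testA_add h1 h2).symm⟩
  | smul c x _ hx =>
    obtain ⟨φ, h1, rfl⟩ := hx
    exact ⟨_, h1.const_smul c, (testA_smul h1 c).symm⟩

theorem exists_testH_near (u : H10 Ω) {ε : ℝ} (hε : 0 < ε) :
    ∃ φ, IsTest Ω φ ∧ ‖u - testH Ω φ‖ < ε := by
  obtain ⟨p, hp, hd⟩ := Metric.mem_closure_iff.1 u.2 ε hε
  obtain ⟨φ, h, rfl⟩ := span_testGraph p hp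
  refine ⟨φ, h, ?_⟩
  rw [dist_eq_norm] at hd
  rwa [← Submodule.norm_coe, Submodule.coe_sub, testH_coe h]

theorem H10_induction {P : H10 Ω → Prop} (hc : IsClosed {u | P u})
    (h : ∀ φ, IsTest Ω φ → P (testH Ω φ)) (u : H10 Ω) : P u := by
  have : u ∈ closure {u | P u} := Metric.mem_closure_iff.2 fun ε hε => by
    obtain ⟨φ, hφ, hd⟩ := exists_testH_near u hε
    exact ⟨_, h φ hφ, by rwa [dist_eq_norm]⟩
  rwa [hc.closure_eq] at this

/-- The embedding `H¹₀(Ω) → L²(Ω)`. -/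
def val (Ω : Set (Vec d)) : H10 Ω →L[ℝ] L2 Ω :=
  (LpToLpRestrictCLM (Vec d) ℝ ℝ volume 2 Ω).comp
    ((WithLp.fstL 2 ℝ (Lp ℝ 2 (volume : Measure (Vec d)))
      (Lp (Vec d) 2 (volume : Measure (Vec d)))).comp (H10 Ω).subtypeL)

theorem val_testH (h : IsTest Ω φ) : val Ω (testH Ω φ) =ᵐ[leb Ω] φ := by
  refine (LpToLpRestrictCLM_coeFn ℝ Ω _).trans (ae_restrict_of_ae ?_)
  have := testA_fst h
  rw [← testH_coe h] at this
  exact this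

theorem grad_testH (h : IsTest Ω φ) : grad Ω (testH Ω φ) =ᵐ[leb Ω] gradient φ := by
  refine (LpToLpRestrictCLM_coeFn ℝ Ω _).trans (ae_restrict_of_ae ?_)
  have := testA_snd h
  rw [← testH_coe h] at this
  exact this

theorem norm_sq_toLp {α E : Type*} {mα : MeasurableSpace α} {μ : Measure α} [NormedAddCommGroup E]
    [InnerProductSpace ℝ E] (f : Lp E 2 μ) : ‖f‖ ^ 2 = ∫ x, ‖f x‖ ^ 2 ∂μ := by
  rw [← real_inner_self_eq_norm_sq, L2.inner_def]
  simp

theorem IsTest.norm_val_sq (h : IsTest Ω φ) : ‖val Ω (testH Ω φ)‖ ^ 2 = ∫ x, φ x ^ 2 := by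
  rw [norm_sq_toLp, ← setIntegral_eq_integral_of_forall_compl_eq_zero (s := Ω)
    (f := fun x => φ x ^ 2) (fun x hx => by simp [h.eq_zero hx])]
  refine integral_congr_ae ?_
  filter_upwards [val_testH h] with x hx
  simp [hx]

theorem IsTest.norm_grad_sq (h : IsTest Ω φ) :
    ‖grad Ω (testH Ω φ)‖ ^ 2 = ∫ x, ‖gradient φ x‖ ^ 2 := by
  rw [norm_sq_toLp, ← setIntegral_eq_integral_of_forall_compl_eq_zero (s := Ω)
    (f := fun x => ‖gradient φ x‖ ^ 2) (fun x hx => by simp [h.gradient_eq_zero hx])]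
  refine integral_congr_ae ?_
  filter_upwards [grad_testH h] with x hx
  simp [hx]

/-- The ambient norm integrates over the whole space while `val` and `grad` restrict to `Ω`; no mass
is lost because test functions and their gradients vanish outside `Ω`. -/
theorem norm_sq_eq (u : H10 Ω) : ‖u‖ ^ 2 = ‖val Ω u‖ ^ 2 + ‖grad Ω u‖ ^ 2 := by
  refine H10_induction (P := fun u => ‖u‖ ^ 2 = ‖val Ω u‖ ^ 2 + ‖grad Ω u‖ ^ 2) ?_ ?_ u
  · exact isClosed_eq (by fun_prop) (by fun_prop)
  · intro φ h
    rw [h.norm_val_sq, h.norm_grad_sq, ← Submodule.norm_coe, testH_coe h,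
      WithLp.prod_norm_sq_eq_of_L2, norm_sq_toLp, norm_sq_toLp]
    congr 1
    · exact integral_congr_ae (by filter_upwards [testA_fst h] with x hx; simp [hx])
    · exact integral_congr_ae (by filter_upwards [testA_snd h] with x hx; simp [hx])

theorem norm_val_le (u : H10 Ω) : ‖val Ω u‖ ≤ ‖u‖ := by
  have := norm_sq_eq u
  exact abs_le_of_sq_le_sq' (by nlinarith [sq_nonneg ‖grad Ω u‖]) (norm_nonneg _) |>.2

theorem norm_grad_le (u : H10 Ω) : ‖grad Ω u‖ ≤ ‖u‖ := by
  have := norm_sq_eq u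
  exact abs_le_of_sq_le_sq' (by nlinarith [sq_nonneg ‖val Ω u‖]) (norm_nonneg _) |>.2

theorem comp_ae (i : Fin d) (g : L2V Ω) : comp Ω i g =ᵐ[leb Ω] fun x => g x i :=
  ContinuousLinearMap.coeFn_compLpL _ _

theorem inner_eq_sum_comp (f g : L2V Ω) :
    inner ℝ f g = ∑ i, inner ℝ (comp Ω i f) (comp Ω i g) := by
  simp_rw [L2.inner_def]
  rw [← integral_finsetSum _ fun i _ => L2.integrable_inner _ _]
  refine integral_congr_ae ?_
  filter_upwards [ae_all_iff.2 fun i => comp_ae i f, ae_all_iff.2 fun i => comp_ae i g] with x h1 h2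
  simp only [PiLp.inner_apply]
  simp [h1, h2]

theorem partialD_apply (i : Fin d) (g : L2 Ω) (u : H10 Ω) :
    partialD i g u = -inner ℝ g (comp Ω i (grad Ω u)) := rfl

theorem dv_apply (ξ : L2V Ω) (u : H10 Ω) : dv ξ u = -inner ℝ ξ (grad Ω u) := by
  rw [inner_eq_sum_comp, dv, _root_.sum_apply, ← Finset.sum_neg_distrib]
  rfl

theorem curl_apply (η : L2V Ω) (i j : Fin d) (u : H10 Ω) :
    curl η i j u = inner ℝ (comp Ω j η) (comp Ω i (grad Ω u)) -
      inner ℝ (comp Ω i η) (comp Ω j (grad Ω u)) := by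
  rw [curl, sub_apply, partialD_apply, partialD_apply]
  ring

theorem norm_comp_le (i : Fin d) (g : L2V Ω) : ‖comp Ω i g‖ ≤ ‖g‖ := by
  refine Lp.norm_le_norm_of_ae_le ?_
  filter_upwards [comp_ae i g] with x hx
  rw [hx]
  exact PiLp.norm_apply_le _ _

theorem norm_curl_apply_le (η : L2V Ω) (i j : Fin d) (u : H10 Ω) :
    ‖curl η i j u‖ ≤ 2 * ‖η‖ * ‖u‖ := by
  rw [curl_apply]
  have (k l : Fin d) : ‖inner ℝ (comp Ω k η) (comp Ω l (grad Ω u))‖ ≤ ‖η‖ * ‖u‖ :=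
    (norm_inner_le_norm _ _).trans (mul_le_mul (norm_comp_le _ _)
      ((norm_comp_le _ _).trans (norm_grad_le u)) (norm_nonneg _) (norm_nonneg _))
  calc _ ≤ _ := norm_sub_le _ _
    _ ≤ _ := by linarith [this j i, this i j]

theorem dv_sub (ξ ξ' : L2V Ω) : dv (ξ - ξ') = dv ξ - dv ξ' := by
  ext u; simp [dv_apply, inner_sub_left]; ring

theorem curl_sub (η η' : L2V Ω) (i j : Fin d) : curl (η - η') i j = curl η i j - curl η' i j := by
  ext u
  simp only [curl_apply, sub_apply, map_sub, inner_sub_left]; ring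

end HConv

end

/-! ### Cutoffs, density of test functions, and Rellich's theorem. -/

noncomputable section

namespace HConv

open SchwartzMap FourierTransform LineDeriv Real

variable {d : ℕ} {Ω : Set (Vec d)} {φ ψ : Vec d → ℝ}

theorem isFiniteMeasure_leb (hb : Bornology.IsBounded Ω) : IsFiniteMeasure (leb Ω) :=
  ⟨by simpa using hb.measure_lt_top⟩

/-- A cutoff equal to 1 on an open neighbourhood of `K`, not just on `K`, so that multiplying by it
leaves derivatives unchanged near `K`. Two intermediate compact sets provide the room. -/
theorem exists_cutoff {K U : Set (Vec d)} (hK : IsCompact K) (hU : IsOpen U) (hKU : K ⊆ U) :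
    ∃ χ, IsTest U χ ∧ (∀ x, 0 ≤ χ x) ∧ (∀ x, χ x ≤ 1) ∧
      ∃ V, IsOpen V ∧ K ⊆ V ∧ ∀ x ∈ V, χ x = 1 := by
  obtain ⟨K1, hK1, h1, h2⟩ := exists_compact_between hK hU hKU
  obtain ⟨K2, hK2, h3, h4⟩ := exists_compact_between hK1 hU h2
  obtain ⟨f, hf0, hf1, hf⟩ := exists_contMDiffMap_zero_one_of_isClosed (n := ⊤)
    (modelWithCornersSelf ℝ (Vec d)) (s := (interior K2)ᶜ) (t := K1) isOpen_interior.isClosed_compl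
    hK1.isClosed (disjoint_left.2 fun x hx h => hx (h3 h))
  have hs : Function.support f ⊆ K2 := fun x hx => by
    by_contra h
    exact hx (hf0 fun h' => h (interior_subset h'))
  have ht : tsupport f ⊆ K2 := closure_minimal hs hK2.isClosed
  exact ⟨f, ⟨f.contMDiff.contDiff, hK2.of_isClosed_subset (isClosed_tsupport _) ht, ht.trans h4⟩,
    fun x => (hf x).1, fun x => (hf x).2, interior K1, isOpen_interior, h1,
    fun x hx => hf1 (interior_subset hx)⟩

theorem integral_mul_eq_zero_imp {g : Vec d → ℝ} (hΩ : IsOpen Ω) (hg : Integrable g (leb Ω))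
    (h : ∀ φ, IsTest Ω φ → ∫ x in Ω, φ x * g x = 0) : g =ᵐ[leb Ω] 0 := by
  have := hΩ.ae_eq_zero_of_integral_contDiff_smul_eq_zero (f := g) (μ := volume)
    (show IntegrableOn g Ω volume from hg).locallyIntegrableOn fun φ h1 h2 h3 => by
      have hφ : IsTest Ω φ := ⟨h1, h2, h3⟩
      rw [← setIntegral_eq_integral_of_forall_compl_eq_zero (s := Ω)
        (fun x hx => by simp [hφ.eq_zero hx])]
      exact h φ hφ
  exact (ae_restrict_iff' hΩ.measurableSet).2 this

/-- A function orthogonal to all test functions vanishes, by the fundamental lemma of the calculus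
of variations; boundedness of `Ω` makes `L²` functions integrable there. -/
theorem exists_test_near (hΩ : IsOpen Ω) (hb : Bornology.IsBounded Ω) (g : L2 Ω) {ε : ℝ}
    (hε : 0 < ε) : ∃ φ, IsTest Ω φ ∧ ‖g - val Ω (testH Ω φ)‖ < ε := by
  have := isFiniteMeasure_leb hb
  let T : Submodule ℝ (L2 Ω) :=
    { carrier := {x | ∃ φ, IsTest Ω φ ∧ x = val Ω (testH Ω φ)}
      add_mem' := by
        rintro _ _ ⟨φ, h, rfl⟩ ⟨ψ, h', rfl⟩
        exact ⟨_, h.add h', by rw [testH_add h h', map_add]⟩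
      zero_mem' := ⟨_, IsTest.zero.const_smul 0, by rw [testH_smul .zero, zero_smul, map_zero]⟩
      smul_mem' := by
        rintro c _ ⟨φ, h, rfl⟩
        exact ⟨_, h.const_smul c, by rw [testH_smul h, map_smul]⟩ }
  have hT : T.topologicalClosure = ⊤ := by
    rw [Submodule.topologicalClosure_eq_top_iff, Submodule.eq_bot_iff]
    intro f hf
    have := integral_mul_eq_zero_imp hΩ ((Lp.memLp f).integrable (by norm_num)) fun φ h => by
      have h1 := hf _ ⟨φ, h, rfl⟩
      rw [L2.inner_def] at h1
      rw [← h1]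
      refine integral_congr_ae ?_
      filter_upwards [val_testH h] with x hx
      simp [hx, mul_comm]
    exact Lp.ext (this.trans (Lp.coeFn_zero _ _ _).symm)
  have hg : g ∈ T.topologicalClosure := hT ▸ Submodule.mem_top
  obtain ⟨_, ⟨φ, h, rfl⟩, hd⟩ := Metric.mem_closure_iff.1 hg ε hε
  exact ⟨φ, h, by rwa [← dist_eq_norm]⟩

theorem inner_val_testH (h : IsTest Ω φ) (h' : IsTest Ω ψ) :
    inner ℝ (val Ω (testH Ω φ)) (val Ω (testH Ω ψ)) = ∫ x, φ x * ψ x := by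
  rw [L2.inner_def, ← setIntegral_eq_integral_of_forall_compl_eq_zero (s := Ω)
    (f := fun x => φ x * ψ x) (fun x hx => by simp [h.eq_zero hx])]
  refine integral_congr_ae ?_
  filter_upwards [val_testH h, val_testH h'] with x h1 h2
  simp [h1, h2, mul_comm]

open Classical in
/-- A test function as a complex valued Schwartz function. -/
def toS (φ : Vec d → ℝ) : 𝓢(Vec d, ℂ) :=
  if h : IsTest univ φ then
    HasCompactSupport.toSchwartzMap (f := fun x => (φ x : ℂ))
      (h.2.1.comp_left (g := ((↑) : ℝ → ℂ)) Complex.ofReal_zero)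
      (Complex.ofRealCLM.contDiff.comp h.1) else 0

theorem toS_apply (h : IsTest Ω φ) (x : Vec d) : toS φ x = (φ x : ℂ) := by
  rw [toS, dif_pos (h.mono (subset_univ _))]
  rfl

theorem fderiv_ofReal {x : Vec d} (h : DifferentiableAt ℝ φ x) (v : Vec d) :
    fderiv ℝ (fun x => (φ x : ℂ)) x v = (fderiv ℝ φ x v : ℂ) := by
  have := (Complex.ofRealCLM.hasFDerivAt (x := φ x)).comp x h.hasFDerivAt
  rw [show (fun x => (φ x : ℂ)) = Complex.ofRealCLM ∘ φ from rfl, this.fderiv]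
  rfl

theorem pd_toS (h : IsTest Ω φ) (i : Fin d) : pd i (toS φ) = toS (dd i φ) := by
  ext x
  rw [toS_apply (h.pderiv i), lineDerivOp_apply_eq_fderiv,
    show (toS φ : Vec d → ℂ) = fun x => (φ x : ℂ) from funext (toS_apply h)]
  exact fderiv_ofReal (h.differentiable x) _

theorem lSq_toS (h : IsTest Ω φ) : lSq (toS φ) = ∫ x, φ x ^ 2 := by
  rw [lSq]
  simp_rw [toS_apply h]
  simp

theorem integral_inner_toS (h : IsTest Ω φ) (g : 𝓢(Vec d, ℂ)) :
    ∫ x, φ x * (g x).re = (∫ x, inner ℂ (toS φ x) (g x)).re := by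
  have : Integrable fun x => inner ℂ (toS φ x) (g x) := by
    refine (L2.integrable_inner (𝕜 := ℂ) ((toS φ).toLp 2) (g.toLp 2)).congr ?_
    filter_upwards [(toS φ).coeFn_toLp 2, g.coeFn_toLp 2] with x h1 h2
    rw [h1, h2]
  rw [← RCLike.re_eq_complex_re, ← integral_re this]
  congr 1; ext x
  rw [toS_apply h, RCLike.re_eq_complex_re]
  simp [mul_comm]

theorem integral_gradient_sq (h : IsTest Ω φ) :
    ∫ x, ‖gradient φ x‖ ^ 2 = ∑ i, ∫ x, dd i φ x ^ 2 := by
  rw [← integral_finsetSum _ fun i _ => ((h.pderiv i).memLp volume).integrable_sq]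
  congr 1; ext x
  rw [EuclideanSpace.norm_sq_eq]
  simp [gradient_apply]

theorem norm_testH_sq (h : IsTest Ω φ) :
    ‖testH Ω φ‖ ^ 2 = (∫ x, φ x ^ 2) + ∑ i, ∫ x, dd i φ x ^ 2 := by
  rw [norm_sq_eq, h.norm_val_sq, h.norm_grad_sq, integral_gradient_sq h]

theorem abs_integral_mul_le (h : IsTest Ω φ) (h' : IsTest Ω ψ) :
    |∫ x, φ x * ψ x| ≤ √(negSq (toS φ)) * ‖testH Ω ψ‖ := by
  have h1 := norm_integral_inner_sq_le (toS φ) (toS ψ)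
  have h2 : lSq (toS ψ) + ∑ i, lSq (pd i (toS ψ)) = ‖testH Ω ψ‖ ^ 2 := by
    rw [norm_testH_sq h', lSq_toS h']
    congr 1
    exact Finset.sum_congr rfl fun i _ => by rw [pd_toS h', lSq_toS (h'.pderiv i)]
  rw [h2, Real.sqrt_sq (norm_nonneg _)] at h1
  have h3 := integral_inner_toS h (toS ψ)
  simp_rw [toS_apply h', Complex.ofReal_re] at h3
  rw [h3]
  simp_rw [toS_apply h'] at h1
  exact (Complex.abs_re_le_norm _).trans h1

theorem fourier_toS (h : IsTest Ω φ) (k : Vec d) : 𝓕 (toS φ) k =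
    ((∫ v in Ω, φ v * Real.cos (2 * π * -inner ℝ v k) : ℝ) : ℂ) +
    ((∫ v in Ω, φ v * Real.sin (2 * π * -inner ℝ v k) : ℝ) : ℂ) * Complex.I := by
  rw [setIntegral_eq_integral_of_forall_compl_eq_zero (fun x hx => by simp [h.eq_zero hx]),
    setIntegral_eq_integral_of_forall_compl_eq_zero (fun x hx => by simp [h.eq_zero hx]),
    fourier_coe, Real.fourier_eq, ← integral_complex_ofReal, ← integral_complex_ofReal,
    ← integral_mul_const, ← integral_add]
  · congr 1; ext v
    rw [toS_apply h, Circle.smul_def, Real.fourierChar_apply, Complex.exp_mul_I]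
    simp only [smul_eq_mul]
    push_cast
    ring
  · refine Integrable.ofReal (Continuous.integrable_of_hasCompactSupport ?_ h.2.1.mul_right)
    exact h.continuous.mul (by fun_prop)
  · refine (Integrable.ofReal (Continuous.integrable_of_hasCompactSupport ?_
      h.2.1.mul_right)).mul_const _
    exact h.continuous.mul (by fun_prop)

/-- Compactness of the embedding of `L²(Ω)` in `H⁻¹(ℝ^d)`. -/
theorem tendsto_negSq (hb : Bornology.IsBounded Ω) {γ : ℕ → Vec d → ℝ} (hγ : ∀ n, IsTest Ω (γ n))
    (hw : WeakConv (fun n => val Ω (testH Ω (γ n))) 0) :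
    Tendsto (fun n => negSq (toS (γ n))) atTop (𝓝 0) := by
  have := isFiniteMeasure_leb hb
  obtain ⟨C, hC⟩ := hw.bounded
  have hC0 : 0 ≤ C := (norm_nonneg _).trans (hC 0)
  have memc (f : ℝ → ℝ) (hf : Continuous f) (hf1 : ∀ t, ‖f t‖ ≤ 1) (k : Vec d) :
      MemLp (fun v : Vec d => f (2 * π * -inner ℝ v k)) 2 (leb Ω) :=
    MemLp.of_bound (by fun_prop) 1 (.of_forall fun v => hf1 _)
  have ine (f : ℝ → ℝ) (hf : Continuous f) (hf1 : ∀ t, ‖f t‖ ≤ 1) (k : Vec d) (n : ℕ) :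
      ∫ v in Ω, γ n v * f (2 * π * -inner ℝ v k) =
        inner ℝ (val Ω (testH Ω (γ n))) (memc f hf hf1 k).toLp := by
    rw [L2.inner_def]
    refine integral_congr_ae ?_
    filter_upwards [val_testH (hγ n), (memc f hf hf1 k).coeFn_toLp] with x h1 h2
    rw [h1, h2]
    simp [mul_comm]
  set M : ℝ := (measureUnivNNReal (leb Ω) : ℝ) ^ ((2 : ENNReal).toReal)⁻¹ * 1 with hM
  have hM0 : 0 ≤ M := by positivity
  have bd (f : ℝ → ℝ) (hf : Continuous f) (hf1 : ∀ t, ‖f t‖ ≤ 1) (k : Vec d) (n : ℕ) :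
      |∫ v in Ω, γ n v * f (2 * π * -inner ℝ v k)| ≤ C * M := by
    rw [ine f hf hf1]
    refine (abs_real_inner_le_norm _ _).trans (mul_le_mul (hC n) ?_ (norm_nonneg _) hC0)
    refine Lp.norm_le_of_ae_bound zero_le_one ?_
    filter_upwards [(memc f hf hf1 k).coeFn_toLp] with x h2
    rw [h2]
    exact hf1 _
  -- On the bounded set `Ω` the functions `cos` and `sin` of `2π⟨v,k⟩` lie in `L²(Ω)`, so weak
  -- convergence gives pointwise convergence of the Fourier transforms, with the uniform bound `Fb`.
  have tn (f : ℝ → ℝ) (hf : Continuous f) (hf1 : ∀ t, ‖f t‖ ≤ 1) (k : Vec d) :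
      Tendsto (fun n => ∫ v in Ω, γ n v * f (2 * π * -inner ℝ v k)) atTop (𝓝 0) := by
    simp_rw [ine f hf hf1]
    simpa using hw.inner_left (memc f hf hf1 k).toLp
  have hc1 : ∀ t, ‖Real.cos t‖ ≤ 1 := Real.abs_cos_le_one
  have hs1 : ∀ t, ‖Real.sin t‖ ≤ 1 := Real.abs_sin_le_one
  have Fb : ∀ n k, ‖𝓕 (toS (γ n)) k‖ ≤ 2 * (C * M) := fun n k => by
    rw [fourier_toS (hγ n)]
    refine (norm_add_le _ _).trans ?_
    rw [norm_mul, Complex.norm_I, mul_one, Complex.norm_real, Complex.norm_real]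
    have h1 := bd _ Real.continuous_cos hc1 k n
    have h2 := bd _ Real.continuous_sin hs1 k n
    simp only [Real.norm_eq_abs]
    linarith
  have Ft : ∀ k, Tendsto (fun n => ‖𝓕 (toS (γ n)) k‖ ^ 2) atTop (𝓝 0) := fun k => by
    have h1 := (Complex.continuous_ofReal.tendsto 0).comp (tn _ Real.continuous_cos hc1 k)
    have h2 := (Complex.continuous_ofReal.tendsto 0).comp (tn _ Real.continuous_sin hs1 k)
    have h3 := (h1.add (h2.mul_const Complex.I)).norm.pow 2
    simp only [Function.comp_def, Complex.ofReal_zero, zero_mul, add_zero, norm_zero] at h3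
    simp_rw [fun n => fourier_toS (hγ n) k]
    simpa using h3
  have hL : ∀ n, lSq (toS (γ n)) ≤ C ^ 2 := fun n => by
    rw [lSq_toS (hγ n), ← (hγ n).norm_val_sq]
    have := hC n
    gcongr
  -- Low and high frequencies are separated: outside the ball of radius `R` the weight is at most
  -- `(1 + R²)⁻¹`, and inside it dominated convergence applies.
  have key : ∀ R : ℝ, 0 ≤ R → ∀ n, negSq (toS (γ n)) ≤
      (∫ k in Metric.closedBall (0 : Vec d) R, ‖𝓕 (toS (γ n)) k‖ ^ 2) + (1 + R ^ 2)⁻¹ * C ^ 2 := by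
    intro R hR n
    have e : (∫ k in Metric.closedBall (0 : Vec d) R, ‖𝓕 (toS (γ n)) k‖ ^ 2) +
        (1 + R ^ 2)⁻¹ * lSq (toS (γ n)) = ∫ k, ((Metric.closedBall (0 : Vec d) R).indicator
          (fun k => ‖𝓕 (toS (γ n)) k‖ ^ 2) k + (1 + R ^ 2)⁻¹ * ‖𝓕 (toS (γ n)) k‖ ^ 2) := by
      rw [integral_add ((integrable_norm_sq _).indicator Metric.isClosed_closedBall.measurableSet)
        ((integrable_norm_sq _).const_mul _), integral_const_mul, lSq_eq,
        integral_indicator Metric.isClosed_closedBall.measurableSet]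
    have : negSq (toS (γ n)) ≤ (∫ k in Metric.closedBall (0 : Vec d) R, ‖𝓕 (toS (γ n)) k‖ ^ 2) +
        (1 + R ^ 2)⁻¹ * lSq (toS (γ n)) := by
      rw [e]
      refine integral_mono (integrable_wt_mul _)
        (((integrable_norm_sq _).indicator Metric.isClosed_closedBall.measurableSet).add
        ((integrable_norm_sq _).const_mul _)) fun k => ?_
      simp only
      by_cases hk : k ∈ Metric.closedBall (0 : Vec d) R
      · rw [indicator_of_mem hk]
        have := mul_le_of_le_one_left (sq_nonneg ‖𝓕 (toS (γ n)) k‖) (wt_le_one k)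
        have : 0 ≤ (1 + R ^ 2)⁻¹ * ‖𝓕 (toS (γ n)) k‖ ^ 2 := by positivity
        linarith
      · rw [indicator_of_notMem hk, zero_add]
        refine mul_le_mul_of_nonneg_right ?_ (sq_nonneg _)
        rw [wt]
        have h1 : R ≤ ‖k‖ := by
          simp only [Metric.mem_closedBall, dist_zero_right, not_le] at hk
          exact hk.le
        have h2 : ‖k‖ ≤ ‖(2 * π) • k‖ := by
          rw [norm_smul, Real.norm_of_nonneg (by positivity)]
          exact le_mul_of_one_le_left (norm_nonneg _) (by linarith [Real.pi_gt_three])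
        gcongr
        exact h1.trans h2
    refine this.trans ?_
    gcongr
    exact hL n
  rw [Metric.tendsto_atTop]
  intro ε hε
  obtain ⟨R, hR0, hR⟩ : ∃ R : ℝ, 0 ≤ R ∧ (1 + R ^ 2)⁻¹ * C ^ 2 < ε / 2 := by
    -- For this `R` one has `C² = Rε/2`, so the claim reduces to `R < 1 + R²`.
    refine ⟨2 * C ^ 2 / ε, by positivity, ?_⟩
    rw [inv_mul_lt_iff₀ (by positivity)]
    have h1 : 2 * C ^ 2 / ε * ε = 2 * C ^ 2 := by field_simp
    set R := 2 * C ^ 2 / ε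
    have hR : 0 ≤ R := by positivity
    nlinarith [sq_nonneg (R - 1)]
  have hdc : Tendsto (fun n => ∫ k in Metric.closedBall (0 : Vec d) R, ‖𝓕 (toS (γ n)) k‖ ^ 2)
      atTop (𝓝 0) := by
    have := tendsto_integral_of_dominated_convergence
      (μ := volume.restrict (Metric.closedBall (0 : Vec d) R))
      (F := fun n k => ‖𝓕 (toS (γ n)) k‖ ^ 2) (f := fun _ => 0) (fun _ => (2 * (C * M)) ^ 2)
      (fun n => ((𝓕 (toS (γ n))).continuous.norm.pow 2).aestronglyMeasurable)
      (integrableOn_const (isCompact_closedBall _ _).measure_ne_top)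
      (fun n => .of_forall fun k => by
        rw [Real.norm_of_nonneg (by positivity)]
        have := Fb n k
        gcongr)
      (.of_forall Ft)
    simpa using this
  obtain ⟨N, hN⟩ := Metric.tendsto_atTop.1 hdc (ε / 2) (by positivity)
  refine ⟨N, fun n hn => ?_⟩
  have h1 := hN n hn
  rw [Real.dist_eq, sub_zero] at h1 ⊢
  rw [abs_of_nonneg (negSq_nonneg _)]
  linarith [key R hR0 n, (le_abs_self _).trans_lt h1]

theorem tendsto_one_div_succ : Tendsto (fun n : ℕ => 1 / ((n : ℝ) + 1)) atTop (𝓝 0) :=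
  tendsto_one_div_add_atTop_nhds_zero_nat

theorem weakConv_of_tendsto_norm_sub {X : Type*} [NormedAddCommGroup X] [NormedSpace ℝ X]
    {x y : ℕ → X} {a : X} (h : WeakConv x a)
    (h' : Tendsto (fun n => ‖x n - y n‖) atTop (𝓝 0)) : WeakConv y a := by
  have := h.sub (tendsto_zero_iff_norm_tendsto_zero.2 h').weakConv
  simpa using this

/-- Rellich's theorem, in the form of a product of weakly convergent and bounded sequences. -/
theorem tendsto_inner_val (hΩ : IsOpen Ω) (hb : Bornology.IsBounded Ω) {g : ℕ → L2 Ω}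
    (hg : WeakConv g 0) {v : ℕ → H10 Ω} {C : ℝ} (hv : ∀ n, ‖v n‖ ≤ C) :
    Tendsto (fun n => inner ℝ (g n) (val Ω (v n))) atTop (𝓝 0) := by
  have hn : ∀ n : ℕ, (0 : ℝ) < 1 / ((n : ℝ) + 1) := fun n => by positivity
  choose γ hγ hγ' using fun n => exists_test_near hΩ hb (g n) (hn n)
  choose ν hν hν' using fun n => exists_testH_near (v n) (hn n)
  have t1 : Tendsto (fun n => ‖g n - val Ω (testH Ω (γ n))‖) atTop (𝓝 0) :=
    squeeze_zero (fun n => norm_nonneg _) (fun n => (hγ' n).le) tendsto_one_div_succ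
  have t2 : Tendsto (fun n => ‖v n - testH Ω (ν n)‖) atTop (𝓝 0) :=
    squeeze_zero (fun n => norm_nonneg _) (fun n => (hν' n).le) tendsto_one_div_succ
  have hw : WeakConv (fun n => val Ω (testH Ω (γ n))) 0 := weakConv_of_tendsto_norm_sub hg t1
  have hN := tendsto_negSq hb hγ hw
  obtain ⟨B, hB⟩ := hw.bounded
  have hν1 : ∀ n, ‖testH Ω (ν n)‖ ≤ C + 1 := fun n => by
    have h1 : (1 : ℝ) / ((n : ℝ) + 1) ≤ 1 := by
      rw [div_le_one (by positivity)]; linarith [(Nat.cast_nonneg n : (0 : ℝ) ≤ n)]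
    have h2 := norm_sub_norm_le (testH Ω (ν n)) (v n)
    rw [norm_sub_rev] at h2
    linarith [hv n, hν' n]
  -- Both factors are replaced by test functions with vanishing errors; the remaining pairing is at
  -- most the `H⁻¹` norm of `γ n`, which tends to zero, times the bounded `H¹` norm of `ν n`.
  have e : ∀ n, inner ℝ (g n) (val Ω (v n)) =
      inner ℝ (val Ω (v n)) (g n - val Ω (testH Ω (γ n))) +
      inner ℝ (val Ω (testH Ω (γ n))) (val Ω (v n - testH Ω (ν n))) +
      inner ℝ (val Ω (testH Ω (γ n))) (val Ω (testH Ω (ν n))) := fun n => by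
    rw [map_sub, inner_sub_right, inner_sub_right, real_inner_comm (g n),
      real_inner_comm (val Ω (testH Ω (γ n)))]
    ring
  have s1 := tendsto_inner_of_bounded_of_zero (fun n => (norm_val_le _).trans (hv n)) t1
  have s2 := tendsto_inner_of_bounded_of_zero (y := fun n => val Ω (v n - testH Ω (ν n))) hB
    (squeeze_zero (fun n => norm_nonneg _) (fun n => norm_val_le _) t2)
  have s3 : Tendsto (fun n => inner ℝ (val Ω (testH Ω (γ n))) (val Ω (testH Ω (ν n)))) atTop
      (𝓝 0) := by
    refine squeeze_zero_norm (a := fun n => √(negSq (toS (γ n))) * (C + 1)) (fun n => ?_) ?_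
    · rw [inner_val_testH (hγ n) (hν n)]
      exact (abs_integral_mul_le (hγ n) (hν n)).trans (by gcongr; exact hν1 n)
    · have := (Real.continuous_sqrt.tendsto 0).comp hN
      simpa using this.mul_const (C + 1)
  have s4 := (s1.add s2).add s3
  rw [add_zero, add_zero] at s4
  exact s4.congr fun n => (e n).symm

end HConv

end

/-! ### Localization, and compensated compactness of a divergence and a gradient. -/

noncomputable section

namespace HConv

open SchwartzMap FourierTransform LineDeriv Real

variable {d : ℕ} {Ω : Set (Vec d)} {φ ψ : Vec d → ℝ}

theorem dual_tendsto_iff {X : Type*} [NormedAddCommGroup X] [NormedSpace ℝ X]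
    {f : ℕ → StrongDual ℝ X} {g : StrongDual ℝ X} :
    Tendsto f atTop (𝓝 g) ↔ Tendsto (fun n => ‖f n - g‖) atTop (𝓝 0) :=
  tendsto_iff_norm_sub_tendsto_zero

/-- Smooth functions whose squared `L²` norm and those of the partial derivatives are at
most `B`. -/
structure SmoothH1 (q : Vec d → ℝ) (B : ℝ) : Prop where
  smooth : ContDiff ℝ ∞ q
  memLp : MemLp q 2 volume
  memLp_dd : ∀ j, MemLp (dd j q) 2 volume
  le : ∫ x, q x ^ 2 ≤ B
  dd_le : ∀ j, ∫ x, dd j q x ^ 2 ≤ B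

theorem dd_re (q : 𝓢(Vec d, ℂ)) (j : Fin d) (x : Vec d) :
    dd j (fun x => (q x).re) x = (pd j q x).re := by
  rw [lineDerivOp_apply_eq_fderiv, dd]
  have := (Complex.reCLM.hasFDerivAt (x := q x)).comp x (q.hasFDerivAt x)
  rw [show (fun x => (q x).re) = Complex.reCLM ∘ q from rfl, this.fderiv]
  rfl

theorem memLp_re (q : 𝓢(Vec d, ℂ)) : MemLp (fun x => (q x).re) 2 volume := (q.memLp 2).re

theorem re_sq_le (z : ℂ) : z.re ^ 2 ≤ ‖z‖ ^ 2 := by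
  rw [← sq_abs]
  have := Complex.abs_re_le_norm z
  gcongr

theorem integral_re_sq_le (q : 𝓢(Vec d, ℂ)) : ∫ x, (q x).re ^ 2 ≤ lSq q :=
  integral_mono (memLp_re q).integrable_sq (integrable_norm_sq q) fun _ => re_sq_le _

theorem SmoothH1.of_schwartz {q : 𝓢(Vec d, ℂ)} {B : ℝ} (h : lSq q ≤ B)
    (h' : ∀ j, lSq (pd j q) ≤ B) : SmoothH1 (fun x => (q x).re) B where
  smooth := Complex.reCLM.contDiff.comp (q.smooth ⊤)
  memLp := memLp_re q
  memLp_dd j := by simpa only [funext (dd_re q j)] using memLp_re (pd j q)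
  le := (integral_re_sq_le q).trans h
  dd_le j := by simpa only [funext (dd_re q j)] using (integral_re_sq_le (pd j q)).trans (h' j)

theorem IsTest.smoothH1 (h : IsTest Ω φ) : SmoothH1 φ (‖testH Ω φ‖ ^ 2) where
  smooth := h.1
  memLp := h.memLp _
  memLp_dd j := (h.pderiv j).memLp _
  le := by
    rw [norm_testH_sq h]
    have : 0 ≤ ∑ i, ∫ x, dd i φ x ^ 2 :=
      Finset.sum_nonneg fun i _ => integral_nonneg fun _ => sq_nonneg _
    linarith
  dd_le j := by
    rw [norm_testH_sq h]
    have h1 : ∫ x, dd j φ x ^ 2 ≤ ∑ i, ∫ x, dd i φ x ^ 2 :=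
      Finset.single_le_sum (f := fun i => ∫ x, dd i φ x ^ 2)
        (fun i _ => integral_nonneg fun _ => sq_nonneg _) (Finset.mem_univ j)
    have h2 : 0 ≤ ∫ x, φ x ^ 2 := integral_nonneg fun _ => sq_nonneg _
    linarith

/-- The real part of the complex potential works: the fields are real and taking real parts does not
increase `L²` norms. -/
theorem exists_potential_real {t : Fin d → Vec d → ℝ} (ht : ∀ i, IsTest Ω (t i)) :
    ∃ q : Vec d → ℝ, SmoothH1 q (∑ i, ∫ x, t i x ^ 2) ∧ ∀ j, ∫ x, (t j x - dd j q x) ^ 2 ≤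
      negSq (toS (t j)) + ∑ i, negSq (pd i (toS (t j)) - pd j (toS (t i))) := by
  obtain ⟨q, h1, h2, h3⟩ := exists_potential fun i => toS (t i)
  simp_rw [lSq_toS (ht _)] at h1 h2
  refine ⟨_, .of_schwartz h1 h2, fun j => le_trans (le_of_eq ?_) ((integral_re_sq_le _).trans (h3 j))⟩
  congr 1; ext x
  rw [_root_.sub_apply, Complex.sub_re, toS_apply (ht j), dd_re]
  rfl

theorem exists_dual_real {c : Vec d → ℝ} (hc : IsTest Ω c) :
    ∃ ρ : Vec d → ℝ, SmoothH1 ρ (negSq (toS c)) ∧ ∫ x, c x * ρ x = negSq (toS c) := by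
  obtain ⟨z, h1, h2, h3⟩ := exists_dual (toS c)
  exact ⟨_, .of_schwartz h2 h3, by rw [integral_inner_toS hc, h1, Complex.ofReal_re]⟩

/-- A fixed cutoff maps `H¹` functions on the whole space boundedly into `H¹₀(Ω)`. The constant
comes from `(φ ∂ᵢq + q ∂ᵢφ)² ≤ 2φ²(∂ᵢq)² + 2q²(∂ᵢφ)²`. -/
theorem exists_norm_testH_mul_le (h : IsTest Ω φ) : ∃ C, 0 ≤ C ∧ ∀ q B, SmoothH1 q B →
    ‖testH Ω (fun x => φ x * q x)‖ ^ 2 ≤ C * B := by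
  obtain ⟨a, ha⟩ := h.bounded
  choose b hb using fun i => (h.pderiv i).bounded
  refine ⟨a ^ 2 + ∑ i, (2 * a ^ 2 + 2 * b i ^ 2), by positivity, fun q B hq => ?_⟩
  have hs : ∀ {f : Vec d → ℝ} {m : ℝ} (x : Vec d), ‖f x‖ ≤ m → f x ^ 2 ≤ m ^ 2 := fun x hx => by
    rw [← sq_abs]; gcongr; exact hx
  rw [norm_testH_sq (h.mul_right hq.smooth), add_mul, Finset.sum_mul]
  have iq := hq.memLp.integrable_sq
  gcongr with i
  · calc _ ≤ ∫ x, a ^ 2 * q x ^ 2 := by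
          refine integral_mono ((h.mul_right hq.smooth).memLp volume).integrable_sq
            (iq.const_mul _) fun x => ?_
          rw [mul_pow]
          exact mul_le_mul_of_nonneg_right (hs x (ha x)) (sq_nonneg _)
      _ ≤ _ := by rw [integral_const_mul]; gcongr; exact hq.le
  · have id := (hq.memLp_dd i).integrable_sq
    calc _ ≤ ∫ x, (2 * a ^ 2 * dd i q x ^ 2 + 2 * b i ^ 2 * q x ^ 2) := by
          refine integral_mono (((h.mul_right hq.smooth).pderiv i).memLp volume).integrable_sq
            ((id.const_mul _).add (iq.const_mul _)) fun x => ?_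
          simp only
          rw [dd_mul (h.differentiable x) (hq.smooth.differentiable (by simp) x)]
          have h1 := mul_le_mul_of_nonneg_right (hs x (ha x)) (sq_nonneg (dd i q x))
          have h2 := mul_le_mul_of_nonneg_right (hs x (hb i x)) (sq_nonneg (q x))
          nlinarith [sq_nonneg (φ x * dd i q x - q x * dd i φ x)]
      _ ≤ _ := by
          rw [integral_add (id.const_mul _) (iq.const_mul _), integral_const_mul,
            integral_const_mul, add_mul]
          gcongr
          · exact hq.dd_le i
          · exact hq.le

/-- Multiplication of a vector field by a bounded function. -/
def mulV (Ω : Set (Vec d)) (ψ : Vec d → ℝ) : L2V Ω →L[ℝ] L2V Ω :=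
  fieldMul (leb Ω) fun x => ψ x • ContinuousLinearMap.id ℝ (Vec d)

/-- Multiplication of a function by a bounded function. -/
def mulS (Ω : Set (Vec d)) (ψ : Vec d → ℝ) : L2 Ω →L[ℝ] L2 Ω :=
  fieldMul (leb Ω) fun x => ψ x • ContinuousLinearMap.id ℝ ℝ

/-- Pointwise product of a vector field with a bounded vector field. -/
def dotL (Ω : Set (Vec d)) (e : Vec d → Vec d) : L2V Ω →L[ℝ] L2 Ω :=
  fieldMul (leb Ω) fun x => innerSL ℝ (e x)

theorem IsTest.aebdd_smul (h : IsTest Ω φ) (E : Type*) [NormedAddCommGroup E] [NormedSpace ℝ E] :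
    AEBdd (leb Ω) fun x => φ x • ContinuousLinearMap.id ℝ E := by
  obtain ⟨C, hC⟩ := h.bounded
  refine ⟨(h.continuous.smul continuous_const).aestronglyMeasurable, C, .of_forall fun x => ?_⟩
  rw [norm_smul]
  have h1 : 0 ≤ ‖φ x‖ := norm_nonneg _
  calc _ ≤ ‖φ x‖ * 1 := by gcongr; exact ContinuousLinearMap.norm_id_le
    _ ≤ C := by rw [mul_one]; exact hC x

theorem IsTest.mulV_ae (h : IsTest Ω φ) (σ : L2V Ω) : mulV Ω φ σ =ᵐ[leb Ω] fun x => φ x • σ x :=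
  fieldMul_ae (h.aebdd_smul _) σ

theorem IsTest.mulS_ae (h : IsTest Ω φ) (g : L2 Ω) : mulS Ω φ g =ᵐ[leb Ω] fun x => φ x * g x :=
  fieldMul_ae (h.aebdd_smul _) g

theorem IsTest.dotL_ae (h : IsTest Ω φ) (σ : L2V Ω) :
    dotL Ω (gradient φ) σ =ᵐ[leb Ω] fun x => inner ℝ (gradient φ x) (σ x) := by
  refine fieldMul_ae ⟨?_, ?_⟩ σ
  · exact ((innerSL ℝ).continuous.comp h.continuous_gradient).aestronglyMeasurable
  · obtain ⟨C, hC⟩ := h.gradient_compact.exists_bound_of_continuous h.continuous_gradient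
    exact ⟨C, .of_forall fun x => by rw [innerSL_apply_norm]; exact hC x⟩

theorem gradient_mul (h : IsTest Ω φ) (h' : Differentiable ℝ ψ) (x : Vec d) :
    gradient (fun x => φ x * ψ x) x = φ x • gradient ψ x + ψ x • gradient φ x := by
  ext i
  rw [gradient_apply, dd_mul (h.differentiable x) (h' x)]
  simp [gradient_apply]

/-- Since `∇(φu) = φ∇u + u∇φ`, the sum inside the absolute value is `-⟨div σ, φu⟩`. The gradient
pairing is thus a divergence term plus a term without derivatives of `u`, which Rellich's theorem
handles. -/
theorem abs_inner_mulV_grad_le (h : IsTest Ω φ) : ∃ C, ∀ (σ : L2V Ω) (u : H10 Ω),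
    |inner ℝ (mulV Ω φ σ) (grad Ω u) + inner ℝ (dotL Ω (gradient φ) σ) (val Ω u)| ≤
      ‖dv σ‖ * (C * ‖u‖) := by
  obtain ⟨C, hC0, hC⟩ := exists_norm_testH_mul_le h
  refine ⟨√C, fun σ => H10_induction (isClosed_le (by fun_prop) (by fun_prop)) fun ν hν => ?_⟩
  have e : inner ℝ (mulV Ω φ σ) (grad Ω (testH Ω ν)) +
      inner ℝ (dotL Ω (gradient φ) σ) (val Ω (testH Ω ν)) =
      -(dv σ (testH Ω fun x => φ x * ν x)) := by
    rw [dv_apply, neg_neg, L2.inner_def, L2.inner_def, L2.inner_def,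
      ← integral_add (L2.integrable_inner _ _) (L2.integrable_inner _ _)]
    refine integral_congr_ae ?_
    filter_upwards [h.mulV_ae σ, h.dotL_ae σ, grad_testH hν, val_testH hν,
      grad_testH (h.mul_right hν.1)] with x h1 h2 h3 h4 h5
    rw [h1, h2, h3, h4, h5, gradient_mul h hν.differentiable]
    simp only [inner_add_right, inner_smul_left, inner_smul_right, RCLike.inner_apply,
      real_inner_comm (σ x)]
    simp
  rw [e, abs_neg]
  refine ((dv σ).le_opNorm _).trans ?_
  refine mul_le_mul_of_nonneg_left ?_ (dv σ).opNorm_nonneg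
  refine abs_le_of_sq_le_sq' ?_ (by positivity) |>.2
  rw [mul_pow, Real.sq_sqrt hC0]
  exact hC _ _ hν.smoothH1

/-- Compensated compactness of a divergence and a gradient, for a zero limit of the field. -/
theorem tendsto_inner_mulV_grad_zero (hΩ : IsOpen Ω) (hb : Bornology.IsBounded Ω) {σ : ℕ → L2V Ω}
    (hσ : WeakConv σ 0) (hd : Tendsto (fun n => ‖dv (σ n)‖) atTop (𝓝 0)) {v : ℕ → H10 Ω} {B : ℝ}
    (hv : ∀ n, ‖v n‖ ≤ B) (h : IsTest Ω φ) :
    Tendsto (fun n => inner ℝ (mulV Ω φ (σ n)) (grad Ω (v n))) atTop (𝓝 0) := by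
  obtain ⟨C, hC⟩ := abs_inner_mulV_grad_le h
  have hσ' : WeakConv (fun n => dotL Ω (gradient φ) (σ n)) 0 := by
    simpa using hσ.map (dotL Ω (gradient φ))
  have t1 := tendsto_inner_val hΩ hb hσ' hv
  have t2 : Tendsto (fun n => inner ℝ (mulV Ω φ (σ n)) (grad Ω (v n)) +
      inner ℝ (dotL Ω (gradient φ) (σ n)) (val Ω (v n))) atTop (𝓝 0) := by
    refine squeeze_zero_norm (a := fun n => ‖dv (σ n)‖ * (|C| * B)) (fun n => ?_) ?_
    · refine (hC (σ n) (v n)).trans ?_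
      refine mul_le_mul_of_nonneg_left ?_ (dv (σ n)).opNorm_nonneg
      gcongr
      · exact le_abs_self _
      · exact hv n
    · have := hd.mul_const (|C| * B)
      rwa [zero_mul] at this
  simpa using t2.sub t1

theorem IsTest.inner_mulV_comm (h : IsTest Ω φ) (f g : L2V Ω) :
    inner ℝ (mulV Ω φ f) g = inner ℝ f (mulV Ω φ g) := by
  simp_rw [L2.inner_def]
  refine integral_congr_ae ?_
  filter_upwards [h.mulV_ae f, h.mulV_ae g] with x h1 h2
  rw [h1, h2, inner_smul_left, inner_smul_right]
  rfl

/-- Compensated compactness of a divergence and a gradient. -/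
theorem tendsto_inner_mulV_grad (hΩ : IsOpen Ω) (hb : Bornology.IsBounded Ω) {σ : ℕ → L2V Ω}
    {σ₀ : L2V Ω} (hσ : WeakConv σ σ₀) (hd : Tendsto (fun n => dv (σ n)) atTop (𝓝 (dv σ₀)))
    {v : ℕ → H10 Ω} {v₀ : H10 Ω} (hv : WeakConv v v₀) (h : IsTest Ω φ) :
    Tendsto (fun n => inner ℝ (mulV Ω φ (σ n)) (grad Ω (v n))) atTop
      (𝓝 (inner ℝ (mulV Ω φ σ₀) (grad Ω v₀))) := by
  obtain ⟨B, hB⟩ := hv.bounded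
  have hd' : Tendsto (fun n => ‖dv (σ n - σ₀)‖) atTop (𝓝 0) := by
    simp_rw [dv_sub]
    exact dual_tendsto_iff.1 hd
  have t1 := tendsto_inner_mulV_grad_zero hΩ hb hσ.sub_const hd' hB h
  have t2 := (hv.map (grad Ω)).inner_right (mulV Ω φ σ₀)
  simpa [inner_sub_left] using t1.add t2

open Classical in
/-- A square integrable function as an element of `L²(Ω)`. -/
def toL (Ω : Set (Vec d)) (f : Vec d → ℝ) : L2 Ω :=
  if h : MemLp f 2 (leb Ω) then h.toLp else 0

theorem toL_ae {f : Vec d → ℝ} (h : MemLp f 2 volume) : toL Ω f =ᵐ[leb Ω] f := by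
  rw [toL, dif_pos (h.restrict Ω)]
  exact (h.restrict Ω).coeFn_toLp

theorem norm_toL_sq_le {f : Vec d → ℝ} (h : MemLp f 2 volume) :
    ‖toL Ω f‖ ^ 2 ≤ ∫ x, f x ^ 2 := by
  rw [norm_sq_toLp]
  calc _ = ∫ x in Ω, f x ^ 2 := by
        refine integral_congr_ae ?_
        filter_upwards [toL_ae h] with x hx
        rw [hx, Real.norm_eq_abs, sq_abs]
    _ ≤ _ := setIntegral_le_integral h.integrable_sq (.of_forall fun _ => sq_nonneg _)

theorem SmoothH1.norm_toL_dd_le {q : Vec d → ℝ} {B : ℝ} (h : SmoothH1 q B) (j : Fin d) :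
    ‖toL Ω (dd j q)‖ ≤ √B :=
  Real.le_sqrt_of_sq_le ((norm_toL_sq_le (h.memLp_dd j)).trans (h.dd_le j))

theorem negSq_sub_le (f g : 𝓢(Vec d, ℂ)) : negSq (f - g) ≤ 2 * negSq f + 2 * negSq g := by
  simp_rw [negSq]
  rw [← integral_const_mul, ← integral_const_mul, ← integral_add ((integrable_wt_mul _).const_mul _)
    ((integrable_wt_mul _).const_mul _)]
  refine integral_mono (integrable_wt_mul _) (((integrable_wt_mul _).const_mul _).add
    ((integrable_wt_mul _).const_mul _)) fun k => ?_
  have e : 𝓕 (f - g) k = 𝓕 f k - 𝓕 g k := by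
    rw [← fourierCLM_apply (R := ℂ), map_sub]; rfl
  simp only [e]
  have h1 : ‖𝓕 f k - 𝓕 g k‖ ^ 2 ≤ 2 * ‖𝓕 f k‖ ^ 2 + 2 * ‖𝓕 g k‖ ^ 2 := by
    have : ‖𝓕 f k - 𝓕 g k‖ ^ 2 ≤ (‖𝓕 f k‖ + ‖𝓕 g k‖) ^ 2 := by gcongr; exact norm_sub_le _ _
    nlinarith [sq_nonneg (‖𝓕 f k‖ - ‖𝓕 g k‖)]
  nlinarith [mul_le_mul_of_nonneg_left h1 (wt_pos k).le]

theorem comp_grad_testH (h : IsTest Ω φ) (i : Fin d) :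
    comp Ω i (grad Ω (testH Ω φ)) =ᵐ[leb Ω] dd i φ := by
  filter_upwards [comp_ae i (grad Ω (testH Ω φ)), grad_testH h] with x h1 h2
  rw [h1, h2, gradient_apply]

theorem coe_incl {D : Set (Vec d)} (h : D ⊆ Ω) (u : H10 D) : (incl h u : Ambient d) = u :=
  ContinuousLinearMap.coe_codRestrict_apply _ _ _ _

theorem incl_testH {D : Set (Vec d)} (hD : D ⊆ Ω) (h : IsTest D φ) :
    incl hD (testH D φ) = testH Ω φ := by
  ext1
  rw [coe_incl, testH_coe (h.mono hD), testH_coe h]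

theorem exists_inner {K : Set (Vec d)} (hK : IsCompact K) (hΩ : IsOpen Ω) (h : K ⊆ Ω) :
    ∃ D : Inner Ω, K ⊆ D.1 := by
  obtain ⟨K', hK', h1, h2⟩ := exists_compact_between hK hΩ h
  have h3 : closure (interior K') ⊆ K' := closure_minimal interior_subset hK'.isClosed
  exact ⟨⟨interior K', isOpen_interior, hK'.of_isClosed_subset isClosed_closure h3, h3.trans h2⟩, h1⟩

/-- `curl` of a field against a localized smooth function. -/
theorem curl_testH_mul (h : IsTest Ω φ) {χ ρ : Vec d → ℝ} {B : ℝ} (hχ : IsTest Ω χ)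
    (hχφ : ∀ x ∈ tsupport φ, χ x = 1) (hρ : SmoothH1 ρ B) (η : L2V Ω) (i j : Fin d) :
    curl η i j (testH Ω fun x => φ x * ρ x) =
      inner ℝ (comp Ω j (mulV Ω φ η)) (toL Ω (dd i ρ)) -
      inner ℝ (comp Ω i (mulV Ω φ η)) (toL Ω (dd j ρ)) +
      inner ℝ (mulS Ω (dd i φ) (comp Ω j η) - mulS Ω (dd j φ) (comp Ω i η))
        (val Ω (testH Ω fun x => χ x * ρ x)) := by
  have key (k l : Fin d) : inner ℝ (comp Ω l η) (comp Ω k (grad Ω (testH Ω fun x => φ x * ρ x))) =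
      inner ℝ (comp Ω l (mulV Ω φ η)) (toL Ω (dd k ρ)) +
      inner ℝ (mulS Ω (dd k φ) (comp Ω l η)) (val Ω (testH Ω fun x => χ x * ρ x)) := by
    simp_rw [L2.inner_def]
    rw [← integral_add (L2.integrable_inner _ _) (L2.integrable_inner _ _)]
    refine integral_congr_ae ?_
    filter_upwards [comp_ae l η, comp_ae l (mulV Ω φ η), h.mulV_ae η, toL_ae (hρ.memLp_dd k),
      comp_grad_testH (h.mul_right hρ.smooth) k, (h.pderiv k).mulS_ae (comp Ω l η),
      val_testH (hχ.mul_right hρ.smooth)] with x h1 h2 h3 h4 h5 h6 h7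
    rw [h2, h3, h4, h5, h6, h7, h1,
      dd_mul (h.differentiable x) (hρ.smooth.differentiable (by simp) x)]
    -- `∂ₖφ` is supported where `χ = 1`; inserting `χ` replaces `ρ`, which need not vanish outside
    -- `Ω`, by the element `χρ` of `H¹₀(Ω)`.
    have : dd k φ x * χ x = dd k φ x := by
      by_cases hx : x ∈ tsupport φ
      · rw [hχφ x hx, mul_one]
      · rw [show dd k φ x = 0 from image_eq_zero_of_notMem_tsupport fun h' =>
          hx (tsupport_fderiv_apply_subset ℝ _ h'), zero_mul]
    simp only [RCLike.inner_apply, conj_trivial, PiLp.smul_apply, smul_eq_mul]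
    linear_combination (-ρ x * η x l) * this
  rw [curl_apply, key, key, inner_sub_left]
  ring

theorem integral_eq_inner_toL {f : Vec d → ℝ} (h : IsTest Ω φ) (hf : MemLp f 2 volume) :
    ∫ x, φ x * f x = inner ℝ (val Ω (testH Ω φ)) (toL Ω f) := by
  rw [L2.inner_def, ← setIntegral_eq_integral_of_forall_compl_eq_zero (s := Ω)
    (f := fun x => φ x * f x) (fun x hx => by simp [h.eq_zero hx])]
  refine integral_congr_ae ?_
  filter_upwards [val_testH h, toL_ae hf] with x h1 h2
  rw [h1, h2, RCLike.inner_apply, conj_trivial, mul_comm]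

end HConv

end

/-! ### The div-curl lemma. -/

noncomputable section

namespace HConv

open Real

variable {d : ℕ} {Ω : Set (Vec d)} {φ ψ : Vec d → ℝ}

theorem gradient_mul_of_eq_one {V : Set (Vec d)} (hV : IsOpen V) (hφ : ∀ x ∈ V, φ x = 1)
    {x : Vec d} (hx : x ∈ V) (i : Fin d) : dd i (fun x => φ x * ψ x) x = dd i ψ x := by
  have : (fun x => φ x * ψ x) =ᶠ[𝓝 x] ψ := by
    filter_upwards [hV.mem_nhds hx] with y hy
    rw [hφ y hy, one_mul]
  rw [dd, this.fderiv_eq, dd]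

set_option maxHeartbeats 1000000 in
/-- Fields converging weakly to zero whose curls converge locally strongly are locally close to
gradients of bounded sequences. -/
theorem exists_potential_of_curl (hΩ : IsOpen Ω) (hb : Bornology.IsBounded Ω) {η : ℕ → L2V Ω}
    (hη : WeakConv η 0) (hc : ∀ (D : Inner Ω) (i j : Fin d),
      Tendsto (fun n => ‖(toLoc (curl (η n) i j)).1 D‖) atTop (𝓝 0)) (hψ : IsTest Ω ψ) :
    ∃ (p : ℕ → H10 Ω) (B : ℝ), (∀ n, ‖p n‖ ≤ B) ∧ ∃ r : ℕ → Fin d → L2 Ω,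
      (∀ j, Tendsto (fun n => ‖r n j‖) atTop (𝓝 0)) ∧
      ∀ n j, ∀ᵐ x ∂(leb Ω), x ∈ tsupport ψ → η n x j - grad Ω (p n) x j = r n j x := by
  -- Nested localizations: `χ = 1` near the support of `ψ`, `χ' = 1` near the support of `χ`, and
  -- `D` contains the support of `χ`, so that the local convergence of curls on `D` can be tested
  -- against functions `χρ`.
  obtain ⟨χ, hχ, -, -, V, hV, hψV, hχ1⟩ := exists_cutoff hψ.2.1 hΩ hψ.2.2
  obtain ⟨χ', hχ', -, -, V', -, hV', hχ'1⟩ := exists_cutoff hχ.2.1 hΩ hχ.2.2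
  obtain ⟨D, hD⟩ := exists_inner hχ.2.1 hΩ hχ.2.2
  have hχD : IsTest D.1 χ := ⟨hχ.1, hχ.2.1, hD⟩
  have hDΩ : D.1 ⊆ Ω := subset_closure.trans D.2.2.2
  have hpos : ∀ n : ℕ, (0 : ℝ) < 1 / ((n : ℝ) + 1) := fun n => by positivity
  set y : ℕ → Fin d → L2 Ω := fun n j => comp Ω j (mulV Ω χ (η n)) with hy
  have wy (j : Fin d) : WeakConv (fun n => y n j) 0 :=
    (hη.map_zero (mulV Ω χ)).map_zero (comp Ω j)
  choose t ht ht' using fun n j => exists_test_near hΩ hb (y n j) (hpos n)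
  have ty (j : Fin d) : Tendsto (fun n => ‖y n j - val Ω (testH Ω (t n j))‖) atTop (𝓝 0) :=
    squeeze_zero (fun n => norm_nonneg _) (fun n => (ht' n j).le) tendsto_one_div_succ
  have wt (j : Fin d) : WeakConv (fun n => val Ω (testH Ω (t n j))) 0 :=
    weakConv_of_tendsto_norm_sub (wy j) (ty j)
  have nt (j : Fin d) := tendsto_negSq hb (fun n => ht n j) (wt j)
  choose b hbd using fun j => (wt j).bounded
  have hb0 (j : Fin d) : 0 ≤ b j := (norm_nonneg _).trans (hbd j 0)
  have tsq (n : ℕ) (j : Fin d) : ∫ x, t n j x ^ 2 ≤ b j ^ 2 := by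
    rw [← (ht n j).norm_val_sq]
    have := hbd j n
    gcongr
  -- the curl of the smooth approximations
  have nc (i j : Fin d) : Tendsto (fun n => negSq (pd i (toS (t n j)) - pd j (toS (t n i)))) atTop
      (𝓝 0) := by
    set c : ℕ → Vec d → ℝ := fun n => dd i (t n j) + (-1 : ℝ) • dd j (t n i) with hcdef
    have hct (n : ℕ) : IsTest Ω (c n) := ((ht n j).pderiv i).add (((ht n i).pderiv j).const_smul _)
    have ec (n : ℕ) : pd i (toS (t n j)) - pd j (toS (t n i)) = toS (c n) := by
      ext x
      rw [_root_.sub_apply, pd_toS (ht n j), pd_toS (ht n i), toS_apply (hct n),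
        toS_apply ((ht n j).pderiv i), toS_apply ((ht n i).pderiv j)]
      simp [hcdef, sub_eq_add_neg]
    simp_rw [ec]
    set M : ℝ := 2 * b j ^ 2 + 2 * b i ^ 2
    have hM (n : ℕ) : negSq (toS (c n)) ≤ M := by
      rw [← ec]
      refine (negSq_sub_le _ _).trans ?_
      have h1 := (negSq_lineDeriv_le (toS (t n j)) i).trans
        ((lSq_toS (ht n j)).le.trans (tsq n j))
      have h2 := (negSq_lineDeriv_le (toS (t n i)) j).trans
        ((lSq_toS (ht n i)).le.trans (tsq n i))
      simp only [M]
      linarith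
    have hM0 : 0 ≤ M := by positivity
    -- `negSq (c n)` is the pairing of `c n` with its dual function `ρ n`, and `M` bounds `ρ n` in
    -- `H¹` uniformly.
    choose ρ hρ hρc using fun n => exists_dual_real (hct n)
    obtain ⟨C, hC0, hC⟩ := exists_norm_testH_mul_le hχD
    obtain ⟨C', hC'0, hC'⟩ := exists_norm_testH_mul_le hχ'
    have hρM (n : ℕ) : SmoothH1 (ρ n) M := ⟨(hρ n).smooth, (hρ n).memLp, (hρ n).memLp_dd,
      (hρ n).le.trans (hM n), fun j => (hρ n).dd_le j |>.trans (hM n)⟩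
    have bR (n : ℕ) (k : Fin d) : ‖toL Ω (dd k (ρ n))‖ ≤ √M := (hρM n).norm_toL_dd_le k
    have bχ (n : ℕ) : ‖testH D.1 fun x => χ x * ρ n x‖ ≤ √(C * M) :=
      Real.le_sqrt_of_sq_le (hC _ _ (hρM n))
    have bχ' (n : ℕ) : ‖testH Ω fun x => χ' x * ρ n x‖ ≤ √(C' * M) :=
      Real.le_sqrt_of_sq_le (hC' _ _ (hρM n))
    set g : ℕ → L2 Ω := fun n => mulS Ω (dd i χ) (comp Ω j (η n)) - mulS Ω (dd j χ) (comp Ω i (η n))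
    have hg : WeakConv g 0 :=
      ((hη.map_zero (comp Ω j)).map_zero (mulS Ω (dd i χ))).sub_zero
        ((hη.map_zero (comp Ω i)).map_zero (mulS Ω (dd j χ)))
    -- Integration by parts moves the derivatives of `t` onto `ρ`. Replacing `t` by `y = χη` costs
    -- the first two terms; the curl of `χη` against `ρ` is that of `η` against `χρ`, up to the
    -- product `g` of `η` with derivatives of `χ`, which is weakly null.
    have e (n : ℕ) : negSq (toS (c n)) =
        inner ℝ (toL Ω (dd i (ρ n))) (y n j - val Ω (testH Ω (t n j))) -
        inner ℝ (toL Ω (dd j (ρ n))) (y n i - val Ω (testH Ω (t n i))) -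
        (toLoc (curl (η n) i j)).1 D (testH D.1 fun x => χ x * ρ n x) +
        inner ℝ (g n) (val Ω (testH Ω fun x => χ' x * ρ n x)) := by
      have e1 : (toLoc (curl (η n) i j)).1 D (testH D.1 fun x => χ x * ρ n x) =
          curl (η n) i j (testH Ω fun x => χ x * ρ n x) := by
        rw [← incl_testH hDΩ (hχD.mul_right (hρ n).smooth)]
        rfl
      have e2 := curl_testH_mul hχ hχ' (fun x hx => hχ'1 x (hV' hx)) (hρ n) (η n) i j
      have e3 (k l : Fin d) : ∫ x, dd k (t n l) x * ρ n x =
          -inner ℝ (val Ω (testH Ω (t n l))) (toL Ω (dd k (ρ n))) := by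
        rw [← integral_eq_inner_toL (ht n l) ((hρ n).memLp_dd k)]
        have := (ht n l).integral_mul_dd (hρ n).smooth k
        simp_rw [mul_comm (t n l _)]
        rw [← this]
        simp_rw [mul_comm]
      have e4 : ∫ x, c n x * ρ n x = (∫ x, dd i (t n j) x * ρ n x) -
          ∫ x, dd j (t n i) x * ρ n x := by
        rw [← integral_sub]
        · congr 1; ext x; simp [hcdef]; ring
        · exact ((ht n j).pderiv i |>.mul_right (hρ n).smooth).continuous.integrable_of_hasCompactSupport
            ((ht n j).pderiv i |>.mul_right (hρ n).smooth).2.1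
        · exact ((ht n i).pderiv j |>.mul_right (hρ n).smooth).continuous.integrable_of_hasCompactSupport
            ((ht n i).pderiv j |>.mul_right (hρ n).smooth).2.1
      rw [← hρc n, e4, e3, e3, e1, e2, inner_sub_right, inner_sub_right,
        real_inner_comm (toL Ω (dd i (ρ n))), real_inner_comm (toL Ω (dd j (ρ n))),
        real_inner_comm (toL Ω (dd i (ρ n))), real_inner_comm (toL Ω (dd j (ρ n)))]
      simp only [hy, g]
      ring
    have s1 := tendsto_inner_of_bounded_of_zero (fun n => bR n i) (ty j)
    have s2 := tendsto_inner_of_bounded_of_zero (fun n => bR n j) (ty i)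
    have s3 : Tendsto (fun n => (toLoc (curl (η n) i j)).1 D (testH D.1 fun x => χ x * ρ n x)) atTop
        (𝓝 0) := by
      refine squeeze_zero_norm (a := fun n => ‖(toLoc (curl (η n) i j)).1 D‖ * √(C * M))
        (fun n => ?_) ?_
      · refine ((toLoc (curl (η n) i j)).1 D).le_opNorm _ |>.trans ?_
        exact mul_le_mul_of_nonneg_left (bχ n) (ContinuousLinearMap.opNorm_nonneg _)
      · have := (hc D i j).mul_const (√(C * M))
        rwa [zero_mul] at this
    have s4 := tendsto_inner_val hΩ hb hg bχ'
    have s5 := ((s1.sub s2).sub s3).add s4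
    rw [sub_zero, sub_zero, add_zero] at s5
    exact s5.congr fun n => (e n).symm
  choose q hq hqt using fun n => exists_potential_real (ht n)
  obtain ⟨C, hC0, hC⟩ := exists_norm_testH_mul_le hχ
  have hqB (n : ℕ) : SmoothH1 (q n) (∑ j, b j ^ 2) := by
    have : ∑ j, ∫ x, t n j x ^ 2 ≤ ∑ j, b j ^ 2 := Finset.sum_le_sum fun j _ => tsq n j
    exact ⟨(hq n).smooth, (hq n).memLp, (hq n).memLp_dd, (hq n).le.trans this,
      fun j => ((hq n).dd_le j).trans this⟩
  -- The remainder adds the smoothing error `y - t` and the Helmholtz error `t - ∇q`. On the support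
  -- of `ψ` the cutoff is invisible: there `y = η` and `∇(χq) = ∇q`.
  refine ⟨fun n => testH Ω fun x => χ x * q n x, √(C * ∑ j, b j ^ 2),
    fun n => Real.le_sqrt_of_sq_le (hC _ _ (hqB n)),
    fun n j => (y n j - val Ω (testH Ω (t n j))) + (toL Ω (fun x => t n j x - dd j (q n) x)),
    fun j => ?_, fun n j => ?_⟩
  · have s1 : Tendsto (fun n => negSq (toS (t n j)) +
        ∑ i, negSq (pd i (toS (t n j)) - pd j (toS (t n i)))) atTop (𝓝 0) := by
      simpa using (nt j).add (tendsto_finsetSum Finset.univ fun i _ => nc i j)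
    have s2 : Tendsto (fun n => ‖toL Ω (fun x => t n j x - dd j (q n) x)‖) atTop (𝓝 0) := by
      refine squeeze_zero (fun n => norm_nonneg _) (fun n => Real.le_sqrt_of_sq_le
        ((norm_toL_sq_le (((ht n j).memLp _).sub ((hq n).memLp_dd j))).trans (hqt n j))) ?_
      have s3 := (Real.continuous_sqrt.tendsto 0).comp s1
      rw [Real.sqrt_zero] at s3
      exact s3
    refine squeeze_zero (fun n => norm_nonneg _) (fun n => norm_add_le _ _) ?_
    simpa using (ty j).add s2
  · have hm : MemLp (fun x => t n j x - dd j (q n) x) 2 volume :=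
      ((ht n j).memLp _).sub ((hq n).memLp_dd j)
    filter_upwards [Lp.coeFn_add (y n j - val Ω (testH Ω (t n j)))
      (toL Ω (fun x => t n j x - dd j (q n) x)), Lp.coeFn_sub (y n j) (val Ω (testH Ω (t n j))),
      val_testH (ht n j), toL_ae (Ω := Ω) hm, comp_ae j (mulV Ω χ (η n)), hχ.mulV_ae (η n),
      grad_testH (hχ.mul_right (hq n).smooth)] with x h1 h2 h3 h4 h5 h6 h7 hx
    rw [h1, Pi.add_apply, h2, Pi.sub_apply, h3, h4, h5, h6, h7, PiLp.smul_apply, hχ1 x (hψV hx),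
      one_smul, gradient_apply, gradient_mul_of_eq_one hV hχ1 (hψV hx)]
    ring

/-- The div-curl lemma, for zero limits. -/
theorem tendsto_div_curl_zero (hΩ : IsOpen Ω) (hb : Bornology.IsBounded Ω) {σ η : ℕ → L2V Ω}
    (hσ : WeakConv σ 0) (hd : Tendsto (fun n => ‖dv (σ n)‖) atTop (𝓝 0))
    (hη : WeakConv η 0) (hc : ∀ (D : Inner Ω) (i j : Fin d),
      Tendsto (fun n => ‖(toLoc (curl (η n) i j)).1 D‖) atTop (𝓝 0)) (hψ : IsTest Ω ψ) :
    Tendsto (fun n => inner ℝ (mulV Ω ψ (σ n)) (η n)) atTop (𝓝 0) := by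
  -- On the support of `ψ`, `η n` is a bounded gradient plus a strongly null remainder: the first is
  -- paired by compensated compactness, the second by boundedness of `ψ σ n`.
  obtain ⟨p, B, hp, r, hr, hpr⟩ := exists_potential_of_curl hΩ hb hη hc hψ
  have t1 := tendsto_inner_mulV_grad_zero hΩ hb hσ hd hp hψ
  have hσ' (j : Fin d) : WeakConv (fun n => comp Ω j (mulV Ω ψ (σ n))) 0 :=
    (hσ.map_zero (mulV Ω ψ)).map_zero (comp Ω j)
  choose C hC using fun j => (hσ' j).bounded
  have t2 := tendsto_finsetSum Finset.univ fun j _ =>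
    tendsto_inner_of_bounded_of_zero (hC j) (hr j)
  have t3 := t1.add t2
  rw [Finset.sum_const_zero, add_zero] at t3
  refine t3.congr fun n => ?_
  rw [← eq_sub_iff_add_eq', ← inner_sub_right, inner_eq_sum_comp]
  refine Finset.sum_congr rfl fun j _ => ?_
  rw [L2.inner_def, L2.inner_def]
  refine integral_congr_ae ?_
  filter_upwards [hpr n j, comp_ae j (mulV Ω ψ (σ n)), hψ.mulV_ae (σ n),
    comp_ae j (η n - grad Ω (p n)), Lp.coeFn_sub (η n) (grad Ω (p n))] with x h1 h2 h3 h4 h5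
  rw [h2, h3, h4, h5]
  by_cases hx : x ∈ tsupport ψ
  · rw [← h1 hx]; rfl
  · rw [image_eq_zero_of_notMem_tsupport hx]
    simp

/-- The div-curl lemma. -/
theorem tendsto_div_curl (hΩ : IsOpen Ω) (hb : Bornology.IsBounded Ω) {σ η : ℕ → L2V Ω}
    {σ₀ η₀ : L2V Ω} (hσ : WeakConv σ σ₀) (hd : Tendsto (fun n => dv (σ n)) atTop (𝓝 (dv σ₀)))
    (hη : WeakConv η η₀) (hc : ∀ (D : Inner Ω) (i j : Fin d),
      Tendsto (fun n => ‖(toLoc (curl (η n - η₀) i j)).1 D‖) atTop (𝓝 0)) (hψ : IsTest Ω ψ) :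
    Tendsto (fun n => inner ℝ (mulV Ω ψ (σ n)) (η n)) atTop
      (𝓝 (inner ℝ (mulV Ω ψ σ₀) η₀)) := by
  have hd' : Tendsto (fun n => ‖dv (σ n - σ₀)‖) atTop (𝓝 0) := by
    simp_rw [dv_sub]
    exact dual_tendsto_iff.1 hd
  have t1 := tendsto_div_curl_zero hΩ hb hσ.sub_const hd' hη.sub_const hc hψ
  have t2 := hη.inner_right (mulV Ω ψ σ₀)
  have t3 := (hσ.map (mulV Ω ψ)).inner_left η₀
  have t4 := (t1.add t2).add (t3.sub_const (inner ℝ (mulV Ω ψ σ₀) η₀))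
  rw [zero_add, sub_self, add_zero] at t4
  refine t4.congr fun n => ?_
  rw [map_sub, inner_sub_left, inner_sub_right, inner_sub_right]
  ring

end HConv

end

/-! ### Lax-Milgram, Poincaré's inequality, matrix fields, and oscillating solutions with a
prescribed weak limit. -/

noncomputable section

namespace HConv

section Abstract

variable {H G : Type*} [NormedAddCommGroup H] [InnerProductSpace ℝ H] [CompleteSpace H]
  [NormedAddCommGroup G] [InnerProductSpace ℝ G]

/-- If the solutions of a sequence of uniformly elliptic equations converge weakly for every right
hand side, then every vector is the weak limit of a sequence of solutions. -/
theorem exists_solutions_tendsto (D : H →L[ℝ] G) (T : ℕ → G →L[ℝ] G) {K α β : ℝ} (hα : 0 < α)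
    (hβ : 0 < β) (hK : 0 < K) (hD : ∀ u, ‖u‖ ^ 2 ≤ K * ‖D u‖ ^ 2) (hD' : ∀ u, ‖D u‖ ≤ ‖u‖)
    (h1 : ∀ n g, α * ‖g‖ ^ 2 ≤ inner ℝ (T n g) g)
    (h2 : ∀ n g, β⁻¹ * ‖T n g‖ ^ 2 ≤ inner ℝ (T n g) g)
    (h : ∀ (r : H) (u : ℕ → H), (∀ n v, inner ℝ (T n (D (u n))) (D v) = inner ℝ r v) →
      ∃ us, WeakConv u us) (v : H) :
    ∃ (r : H) (u : ℕ → H), (∀ n w, inner ℝ (T n (D (u n))) (D w) = inner ℝ r w) ∧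
      WeakConv u v := by
  let B (n : ℕ) : H →L[ℝ] H →L[ℝ] ℝ := (innerSL ℝ).bilinearComp ((T n).comp D) D
  have hBd (n : ℕ) (u w : H) : B n u w = inner ℝ (T n (D u)) (D w) := rfl
  have hBc (n : ℕ) (u : H) : α / K * ‖u‖ ^ 2 ≤ B n u u := by
    rw [hBd]
    refine le_trans ?_ (h1 n (D u))
    rw [div_mul_eq_mul_div, div_le_iff₀ hK]
    nlinarith [hD u]
  have hB (n : ℕ) : IsCoercive (B n) :=
    ⟨α / K, by positivity, fun u => by rw [mul_assoc, ← sq]; exact hBc n u⟩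
  let S (n : ℕ) (r : H) : H := (hB n).continuousLinearEquivOfBilin.symm r
  have hS (n : ℕ) (r w : H) : inner ℝ (T n (D (S n r))) (D w) = inner ℝ r w := by
    rw [← hBd, ← (hB n).continuousLinearEquivOfBilin_apply]
    simp [S]
  -- The weak limits of the solutions define a bounded linear operator `L`. It is coercive, hence
  -- onto by a second use of Lax-Milgram, and a preimage of `v` is the required right-hand side.
  choose L hL using fun r => h r (fun n => S n r) fun n w => hS n r w
  have hSb (n : ℕ) (r : H) : ‖S n r‖ ≤ K / α * ‖r‖ := by
    have e1 := hBc n (S n r)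
    rw [hBd, hS] at e1
    have e2 := e1.trans (real_inner_le_norm _ _)
    rcases (norm_nonneg (S n r)).eq_or_lt with h0 | h0
    · rw [← h0]; positivity
    · rw [sq, ← mul_assoc, mul_le_mul_iff_left₀ h0] at e2
      rw [div_mul_eq_mul_div, div_le_iff₀ hK] at e2
      rw [div_mul_eq_mul_div, le_div_iff₀ hα]
      linarith
  have hadd (r r' : H) : L (r + r') = L r + L r' := by
    refine (hL (r + r')).unique (((hL r).add (hL r')).congr_fun fun n => ?_)
    simp [S]
  have hsmul (c : ℝ) (r : H) : L (c • r) = c • L r := by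
    refine (hL (c • r)).unique (((hL r).map (c • ContinuousLinearMap.id ℝ H)).congr_fun fun n => ?_)
    simp [S]
  have hLb (r : H) : ‖L r‖ ≤ K / α * ‖r‖ := by
    have e1 : inner ℝ (L r) (L r) ≤ K / α * ‖r‖ * ‖L r‖ :=
      le_of_tendsto ((hL r).inner_left (L r)) (.of_forall fun n =>
        (real_inner_le_norm _ _).trans (by gcongr; exact hSb n r))
    rw [real_inner_self_eq_norm_sq, sq] at e1
    rcases (norm_nonneg (L r)).eq_or_lt with h0 | h0
    · rw [← h0]; positivity
    · exact (mul_le_mul_iff_left₀ h0).1 e1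
  let M : H →L[ℝ] H := LinearMap.mkContinuous ⟨⟨L, hadd⟩, hsmul⟩ (K / α) hLb
  have hM (r : H) : M r = L r := rfl
  -- The energy `⟨S n r, r⟩` is at least `β⁻¹` times the squared norm of the flux, and the flux has
  -- norm at least `‖r‖`, because its pairing with `D r` equals `‖r‖²` and `‖D r‖ ≤ ‖r‖`. This bound
  -- passes to weak limits, being linear in `S n r`.
  have hMc (r : H) : β⁻¹ * ‖r‖ ^ 2 ≤ inner ℝ (M r) r := by
    refine ge_of_tendsto ((hL r).inner_left r) (.of_forall fun n => ?_)
    have e1 := h2 n (D (S n r))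
    rw [hS, real_inner_comm] at e1
    refine le_trans ?_ e1
    have e2 : ‖r‖ ≤ ‖T n (D (S n r))‖ := by
      have e3 := hS n r r
      rw [real_inner_self_eq_norm_sq] at e3
      have e4 := (real_inner_le_norm (T n (D (S n r))) (D r)).trans
        (mul_le_mul_of_nonneg_left (hD' r) (norm_nonneg _))
      rw [e3, sq] at e4
      rcases (norm_nonneg r).eq_or_lt with h0 | h0
      · rw [← h0]; positivity
      · exact (mul_le_mul_iff_left₀ h0).1 e4
    gcongr
  let b : H →L[ℝ] H →L[ℝ] ℝ := (innerSL ℝ).comp M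
  have hb : IsCoercive b := ⟨β⁻¹, by positivity, fun u => by
    rw [mul_assoc, ← sq]; exact hMc u⟩
  refine ⟨hb.continuousLinearEquivOfBilin.symm v, fun n => S n _, fun n w => hS n _ w, ?_⟩
  have e : L (hb.continuousLinearEquivOfBilin.symm v) = v := by
    refine ext_inner_right ℝ fun w => ?_
    have := hb.continuousLinearEquivOfBilin_apply (hb.continuousLinearEquivOfBilin.symm v) w
    rw [ContinuousLinearEquiv.apply_symm_apply] at this
    rw [this]
    rfl
  have := hL (hb.continuousLinearEquivOfBilin.symm v)
  rwa [e] at this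

end Abstract

variable {d : ℕ} {Ω : Set (Vec d)} {φ ψ : Vec d → ℝ}

instance : CompleteSpace (H10 Ω) := by unfold H10; infer_instance

/-- Poincaré's inequality. -/
theorem exists_poincare (hd : 0 < d) (hb : Bornology.IsBounded Ω) :
    ∃ K : ℝ, 0 < K ∧ ∀ u : H10 Ω, ‖u‖ ^ 2 ≤ K * ‖grad Ω u‖ ^ 2 := by
  obtain ⟨R, hR⟩ := hb.exists_norm_le
  let i : Fin d := ⟨0, hd⟩
  refine ⟨1 + 4 * R ^ 2, by positivity, H10_induction (isClosed_le (by fun_prop) (by fun_prop))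
    fun φ h => ?_⟩
  have hx : ContDiff ℝ ∞ fun x : Vec d => x i := by fun_prop
  have hdx : ∀ x, dd i (fun x : Vec d => x i) x = 1 := fun x => by
    have : (fun x : Vec d => x i) = (EuclideanSpace.proj i : Vec d →L[ℝ] ℝ) := rfl
    rw [dd, this, ContinuousLinearMap.fderiv]
    simp
  -- As `∂ᵢxᵢ = 1`, integration by parts gives `∫φ² = -2∫xᵢ φ ∂ᵢφ`. With `|xᵢ| ≤ R` on `Ω`, half of
  -- `∫φ²` is absorbed, so `∫φ² ≤ 4R² ∫(∂ᵢφ)²`, whence the constant `1 + 4R²`.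
  have e1 := h.integral_mul_dd (h.mul_left hx).1 i
  have e2 : ∀ x, dd i (fun x => x i * φ x) x = x i * dd i φ x + φ x := fun x => by
    rw [dd_mul (hx.differentiable (by simp) x) (h.differentiable x), hdx, mul_one]
  simp_rw [e2] at e1
  have i1 : Integrable fun x : Vec d => x i * φ x * dd i φ x :=
    ((h.pderiv i).mul_left (h.mul_left hx).1).continuous.integrable_of_hasCompactSupport
      ((h.pderiv i).mul_left (h.mul_left hx).1).2.1
  have i2 := (h.memLp volume).integrable_sq
  have i3 := ((h.pderiv i).memLp volume).integrable_sq
  have e3 : ∫ x, φ x ^ 2 = ∫ x, -2 * (x i * φ x * dd i φ x) := by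
    have : ∫ x, (x i * dd i φ x + φ x) * φ x = (∫ x, x i * φ x * dd i φ x) + ∫ x, φ x ^ 2 := by
      rw [← integral_add i1 i2]
      congr 1; ext x; ring
    rw [this] at e1
    rw [integral_const_mul]
    linarith
  have e4 : ∫ x, -2 * (x i * φ x * dd i φ x) ≤ ∫ x, (1 / 2 * φ x ^ 2 + 2 * R ^ 2 * dd i φ x ^ 2) := by
    refine integral_mono (i1.const_mul _) ((i2.const_mul _).add (i3.const_mul _)) fun x => ?_
    simp only
    by_cases hxΩ : x ∈ Ω
    · have h1 : (x i) ^ 2 ≤ R ^ 2 := by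
        rw [← sq_abs]
        have : |x i| ≤ R := (PiLp.norm_apply_le x i).trans (hR x hxΩ)
        gcongr
      nlinarith [sq_nonneg (φ x + 2 * (x i * dd i φ x)),
        mul_le_mul_of_nonneg_right h1 (sq_nonneg (dd i φ x))]
    · rw [h.eq_zero hxΩ]
      have : 0 ≤ 2 * R ^ 2 * dd i φ x ^ 2 := by positivity
      simpa using this
  rw [← e3, integral_add (i2.const_mul _) (i3.const_mul _), integral_const_mul, integral_const_mul] at e4
  have e5 : ∫ x, dd i φ x ^ 2 ≤ ‖grad Ω (testH Ω φ)‖ ^ 2 := by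
    rw [h.norm_grad_sq, integral_gradient_sq h]
    exact Finset.single_le_sum (f := fun i => ∫ x, dd i φ x ^ 2)
        (fun i _ => integral_nonneg fun _ => sq_nonneg _) (Finset.mem_univ i)
  rw [norm_sq_eq, h.norm_val_sq]
  nlinarith [mul_le_mul_of_nonneg_left e5 (sq_nonneg R)]

/-- A matrix as an operator. -/
def actL (M : Matrix (Fin d) (Fin d) ℝ) : Vec d →L[ℝ] Vec d := Matrix.toEuclideanCLM (𝕜 := ℝ) M

theorem act_mul (M N : Matrix (Fin d) (Fin d) ℝ) (v : Vec d) : act (M * N) v = act M (act N v) := by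
  simp [act, Matrix.mulVec_mulVec]

theorem act_one (v : Vec d) : act 1 v = v := by simp [act]

theorem inner_act_comm {M : Matrix (Fin d) (Fin d) ℝ} (h : M.IsSymm) (v w : Vec d) :
    inner ℝ (act M v) w = inner ℝ v (act M w) := by
  simp only [act, EuclideanSpace.inner_eq_star_dotProduct, star_trivial]
  rw [Matrix.dotProduct_mulVec, ← Matrix.mulVec_transpose, h.eq, dotProduct_comm]

theorem act_inv_cancel {M : Matrix (Fin d) (Fin d) ℝ} (h : IsUnit M) (v : Vec d) :
    act M⁻¹ (act M v) = v := by
  rw [← act_mul, Matrix.nonsing_inv_mul _ ((Matrix.isUnit_iff_isUnit_det M).1 h), act_one]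

theorem act_cancel_inv {M : Matrix (Fin d) (Fin d) ℝ} (h : IsUnit M) (v : Vec d) :
    act M (act M⁻¹ v) = v := by
  rw [← act_mul, Matrix.mul_nonsing_inv _ ((Matrix.isUnit_iff_isUnit_det M).1 h), act_one]

theorem norm_le_of_inner {a b : Vec d} {c : ℝ} (hc : 0 < c) (h : c * ‖a‖ ^ 2 ≤ inner ℝ a b) :
    ‖a‖ ≤ c⁻¹ * ‖b‖ := by
  have h1 := h.trans (real_inner_le_norm _ _)
  rcases (norm_nonneg a).eq_or_lt with h0 | h0
  · rw [← h0]; positivity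
  · rw [mul_comm ‖a‖, sq, ← mul_assoc, mul_le_mul_iff_left₀ h0] at h1
    rwa [← div_eq_inv_mul, le_div_iff₀ hc, mul_comm]

/-- The matrices of the class `M(α, β)`. -/
def Elliptic (α β : ℝ) (M : Matrix (Fin d) (Fin d) ℝ) : Prop :=
  IsUnit M ∧ ∀ η : Vec d, α * ‖η‖ ^ 2 ≤ inner ℝ (act M η) η ∧
    β⁻¹ * ‖act M η‖ ^ 2 ≤ inner ℝ (act M η) η

theorem Elliptic.norm_act_le {α β : ℝ} (hβ : 0 < β) {M : Matrix (Fin d) (Fin d) ℝ}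
    (h : Elliptic α β M) (η : Vec d) : ‖act M η‖ ≤ β * ‖η‖ := by
  simpa using norm_le_of_inner (by positivity) (h.2 η).2

theorem Elliptic.norm_act_inv_le {α β : ℝ} (hα : 0 < α) {M : Matrix (Fin d) (Fin d) ℝ}
    (h : Elliptic α β M) (η : Vec d) : ‖act M⁻¹ η‖ ≤ α⁻¹ * ‖η‖ := by
  have := (h.2 (act M⁻¹ η)).1
  rw [act_cancel_inv h.1, real_inner_comm] at this
  exact norm_le_of_inner hα this

/-- Substituting `A η` for `η` turns the bound on the inverse into a bound of the flux by the
energy. This form survives weak limits: the left side is lower semicontinuous and the right side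
converges by compensated compactness. -/
theorem MClass.elliptic {α β : ℝ} {A : Vec d → Matrix (Fin d) (Fin d) ℝ} (h : MClass α β Ω A) :
    ∀ᵐ x ∂(leb Ω), Elliptic α β (A x) := by
  filter_upwards [h.2] with x ⟨h1, h2⟩
  refine ⟨h1, fun η => ⟨(h2 η).1, ?_⟩⟩
  have := (h2 (act (A x) η)).2
  rwa [act_inv_cancel h1, real_inner_comm] at this

/-- Reduces measurability of the operator-valued field to that of the entries. -/
theorem actL_eq_sum (M : Matrix (Fin d) (Fin d) ℝ) :
    actL M = ∑ i, ∑ j, M i j • actL (Matrix.single i j 1) := by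
  conv_lhs => rw [Matrix.matrix_eq_sum_single M]
  simp only [actL, map_sum]
  refine Finset.sum_congr rfl fun i _ => Finset.sum_congr rfl fun j _ => ?_
  rw [← map_smul, Matrix.smul_single, smul_eq_mul, mul_one]

theorem MeasurableField.actL {A : Vec d → Matrix (Fin d) (Fin d) ℝ} (h : MeasurableField Ω A) :
    AEStronglyMeasurable (fun x => actL (A x)) (leb Ω) := by
  simp_rw [fun x => actL_eq_sum (A x)]
  refine Finset.aestronglyMeasurable_fun_sum _ fun i _ =>
    Finset.aestronglyMeasurable_fun_sum _ fun j _ => ?_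
  exact (h i j).aestronglyMeasurable.smul aestronglyMeasurable_const

theorem MeasurableField.det {A : Vec d → Matrix (Fin d) (Fin d) ℝ} (h : MeasurableField Ω A) :
    AEMeasurable (fun x => (A x).det) (leb Ω) := by
  simp_rw [Matrix.det_apply]
  refine Finset.aemeasurable_fun_sum _ fun s _ => ?_
  exact (Finset.aemeasurable_fun_prod _ fun i _ => h _ _).const_smul _

theorem MeasurableField.inv {A : Vec d → Matrix (Fin d) (Fin d) ℝ} (h : MeasurableField Ω A) :
    MeasurableField Ω fun x => (A x)⁻¹ := by
  intro i j
  simp only [Matrix.inv_def, Matrix.smul_apply, smul_eq_mul, Ring.inverse_eq_inv']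
  refine h.det.inv.mul ?_
  simp_rw [Matrix.adjugate_apply]
  refine MeasurableField.det fun k l => ?_
  by_cases hk : k = j
  · subst hk
    simp
  · simpa [Matrix.updateRow_ne hk] using h k l

/-- Pointwise application of a bounded field of matrices. -/
def matL (Ω : Set (Vec d)) (A : Vec d → Matrix (Fin d) (Fin d) ℝ) : L2V Ω →L[ℝ] L2V Ω :=
  fieldMul (leb Ω) fun x => actL (A x)

theorem matL_ae {A : Vec d → Matrix (Fin d) (Fin d) ℝ} (h : MeasurableField Ω A) {C : ℝ}
    (hC0 : 0 ≤ C) (hC : ∀ᵐ x ∂(leb Ω), ∀ η, ‖act (A x) η‖ ≤ C * ‖η‖) (g : L2V Ω) :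
    matL Ω A g =ᵐ[leb Ω] fun x => act (A x) (g x) := by
  refine fieldMul_ae ⟨h.actL, C, ?_⟩ g
  filter_upwards [hC] with x hx
  exact ContinuousLinearMap.opNorm_le_bound _ hC0 hx

theorem matL_ae_of_elliptic {α β : ℝ} (hβ : 0 < β) {A : Vec d → Matrix (Fin d) (Fin d) ℝ}
    (h : MeasurableField Ω A) (hA : ∀ᵐ x ∂(leb Ω), Elliptic α β (A x)) (g : L2V Ω) :
    matL Ω A g =ᵐ[leb Ω] fun x => act (A x) (g x) :=
  matL_ae h hβ.le (by filter_upwards [hA] with x hx using hx.norm_act_le hβ) g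

theorem matL_inv_ae_of_elliptic {α β : ℝ} (hα : 0 < α) {A : Vec d → Matrix (Fin d) (Fin d) ℝ}
    (h : MeasurableField Ω A) (hA : ∀ᵐ x ∂(leb Ω), Elliptic α β (A x)) (g : L2V Ω) :
    matL Ω (fun x => (A x)⁻¹) g =ᵐ[leb Ω] fun x => act (A x)⁻¹ (g x) :=
  matL_ae (C := α⁻¹) h.inv (by positivity)
    (by filter_upwards [hA] with x hx using hx.norm_act_inv_le hα) g

theorem const_mul_norm_sq_le_inner (c : ℝ) {f g h : L2V Ω}
    (hle : ∀ᵐ x ∂(leb Ω), c * ‖f x‖ ^ 2 ≤ inner ℝ (g x) (h x)) : c * ‖f‖ ^ 2 ≤ inner ℝ g h := by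
  rw [norm_sq_toLp, L2.inner_def, ← integral_const_mul]
  refine integral_mono_ae ?_ (L2.integrable_inner _ _) hle
  have := L2.integrable_inner (𝕜 := ℝ) f f
  simp_rw [real_inner_self_eq_norm_sq] at this
  exact this.const_mul c

set_option maxHeartbeats 2000000 in
/-- Every element of `H¹₀(Ω)` is the weak limit of solutions of the oscillating equations. -/
theorem exists_oscillating (hd : 0 < d) (hb : Bornology.IsBounded Ω) {α β : ℝ} (hα : 0 < α)
    (hβ : 0 < β) {A : ℕ → Vec d → Matrix (Fin d) (Fin d) ℝ} (hA : ∀ n, MClass α β Ω (A n))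
    {As : Vec d → Matrix (Fin d) (Fin d) ℝ} (hconv : HConverges Ω A As) (v : H10 Ω) :
    ∃ (u : ℕ → H10 Ω) (τs : L2V Ω), WeakConv u v ∧ IsFlux As v τs ∧
      WeakConv (fun n => matL Ω (A n) (grad Ω (u n))) τs ∧
      ∀ n, dv (matL Ω (A n) (grad Ω (u n))) = dv τs := by
  obtain ⟨K, hK, hKb⟩ := exists_poincare hd hb
  have hae (n : ℕ) (g : L2V Ω) := matL_ae_of_elliptic hβ (hA n).1 (hA n).elliptic g
  have key (r : H10 Ω) (u : ℕ → H10 Ω)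
      (hu : ∀ n w, inner ℝ (matL Ω (A n) (grad Ω (u n))) (grad Ω w) = inner ℝ r w) :
      ∃ (us : H10 Ω) (τs : L2V Ω), IsFlux As us τs ∧ dv τs = -(innerSL ℝ r) ∧ WeakConv u us ∧
        WeakConv (fun n => matL Ω (A n) (grad Ω (u n))) τs := by
    refine hconv (-(innerSL ℝ r)) u _ (fun n => hae n _) fun n => ?_
    refine ContinuousLinearMap.ext fun w => ?_
    rw [dv_apply, hu]
    rfl
  obtain ⟨r, u, hu, huv⟩ := exists_solutions_tendsto (grad Ω) (fun n => matL Ω (A n)) hα hβ hK hKb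
    norm_grad_le (fun n g => const_mul_norm_sq_le_inner α (by
      filter_upwards [hae n g, (hA n).elliptic] with x h1 h2
      rw [h1]; exact (h2.2 _).1))
    (fun n g => const_mul_norm_sq_le_inner β⁻¹ (by
      filter_upwards [hae n g, (hA n).elliptic] with x h1 h2
      rw [h1]; exact (h2.2 _).2))
    (fun r u hu => by
      obtain ⟨us, τs, -, -, h, -⟩ := key r u hu
      exact ⟨us, h⟩) v
  obtain ⟨us, τs, h1, h2, h3, h4⟩ := key r u hu
  -- The solutions were built to converge to `v`, so the limit supplied by `H`-convergence is `v`
  -- and the limit flux is `As ∇v`.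
  obtain rfl : us = v := h3.unique huv
  refine ⟨u, τs, h3, h1, h4, fun n => ?_⟩
  rw [h2]
  refine ContinuousLinearMap.ext fun w => ?_
  rw [dv_apply, hu]
  rfl

end HConv

end

/-! ### Comparison of measures through nonnegative test functions. -/

noncomputable section

namespace HConv

variable {d : ℕ} {Ω : Set (Vec d)} {φ ψ : Vec d → ℝ}

theorem IsTest.integrable (h : IsTest Ω φ) (μ : Measure (Vec d)) [IsFiniteMeasureOnCompacts μ] :
    Integrable φ μ :=
  h.continuous.integrable_of_hasCompactSupport h.2.1

/-- Inner regularity of `q` gives a compact `K ⊆ E`, outer regularity of `p` an open `U ⊇ K`, each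
losing `ε/2`; a cutoff between `K` and `U ∩ Ω` compares them. -/
theorem measure_le_of_integral_test_le (hΩ : IsOpen Ω) {p q : Measure (Vec d)} [IsFiniteMeasure p]
    [IsFiniteMeasure q] (h : ∀ ψ, IsTest Ω ψ → 0 ≤ ψ → ∫ x, ψ x ∂q ≤ ∫ x, ψ x ∂p) {E : Set (Vec d)}
    (hE : MeasurableSet E) (hEΩ : E ⊆ Ω) : q E ≤ p E := by
  refine ENNReal.le_of_forall_pos_le_add fun ε hε _ => ?_
  have hε' : (ε : ENNReal) / 2 ≠ 0 := by simpa using hε.ne'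
  obtain ⟨K, hKE, hK, hqK⟩ := hE.exists_isCompact_lt_add (μ := q) (measure_ne_top q E) hε'
  obtain ⟨U, hKU, hU, hpU⟩ := K.exists_isOpen_lt_add (μ := p) (measure_ne_top p K) hε'
  obtain ⟨χ, hχ, h0, h1, V, hV, hKV, hχV⟩ := exists_cutoff hK (hU.inter hΩ)
    (subset_inter hKU (hKE.trans hEΩ))
  have e1 : q.real K ≤ ∫ x, χ x ∂q := by
    rw [← integral_indicator_one hK.measurableSet]
    refine integral_mono ((integrable_const 1).indicator hK.measurableSet) (hχ.integrable q)
      (indicator_le' (fun x hx => (hχV x (hKV hx)).ge) fun x _ => h0 x)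
  have e2 : ∫ x, χ x ∂p ≤ p.real U := by
    rw [← integral_indicator_one hU.measurableSet]
    refine integral_mono (hχ.integrable p) ((integrable_const 1).indicator hU.measurableSet)
      (le_indicator (fun x _ => h1 x) fun x hx => (hχ.eq_zero fun h => hx h.1).le)
  have e3 : q K ≤ p U := by
    rw [← ENNReal.toReal_le_toReal (measure_ne_top q K) (measure_ne_top p U)]
    exact e1.trans ((h χ (hχ.mono inter_subset_right) h0).trans e2)
  calc q E ≤ q K + ε / 2 := hqK.le
    _ ≤ p U + ε / 2 := by gcongr
    _ ≤ p K + ε / 2 + ε / 2 := by gcongr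
    _ ≤ p E + ε / 2 + ε / 2 := by gcongr
    _ = p E + ε := by rw [add_assoc, ENNReal.add_halves]

/-- Moving the negative Jordan parts to the opposite sides reduces the claim to positive measures.
-/
theorem signedMeasure_le_of_integral_test_le (hΩ : IsOpen Ω) {μ ν : SignedMeasure (Vec d)}
    (h : ∀ ψ, IsTest Ω ψ → 0 ≤ ψ → ∫ᵛ x, ψ x ∂<•μ ≤ ∫ᵛ x, ψ x ∂<•ν) {E : Set (Vec d)}
    (hE : MeasurableSet E) (hEΩ : E ⊆ Ω) : μ E ≤ ν E := by
  have key (μ : SignedMeasure (Vec d)) : ∃ p q : Measure (Vec d), ∃ _ : IsFiniteMeasure p,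
      ∃ _ : IsFiniteMeasure q, μ = p.toSignedMeasure - q.toSignedMeasure :=
    ⟨_, _, inferInstance, inferInstance, μ.toSignedMeasure_toJordanDecomposition.symm⟩
  have hi {p q : Measure (Vec d)} [IsFiniteMeasure p] [IsFiniteMeasure q] {ψ : Vec d → ℝ}
      (hψ : IsTest Ω ψ) : ∫ᵛ x, ψ x ∂<•(p.toSignedMeasure - q.toSignedMeasure) =
        ∫ x, ψ x ∂p - ∫ x, ψ x ∂q := by
    rw [VectorMeasure.integral_sub_vectorMeasure, VectorMeasure.integral_toSignedMeasure,
      VectorMeasure.integral_toSignedMeasure]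
    · rw [VectorMeasure.Integrable, Measure.variation_toSignedMeasure]; exact hψ.integrable p
    · rw [VectorMeasure.Integrable, Measure.variation_toSignedMeasure]; exact hψ.integrable q
  obtain ⟨p, q, _, _, rfl⟩ := key μ
  obtain ⟨p', q', _, _, rfl⟩ := key ν
  have e := measure_le_of_integral_test_le hΩ (p := p' + q) (q := p + q') (fun ψ hψ h0 => by
    rw [integral_add_measure (hψ.integrable _) (hψ.integrable _),
      integral_add_measure (hψ.integrable _) (hψ.integrable _)]
    have := h ψ hψ h0
    rw [hi hψ, hi hψ] at this
    linarith) hE hEΩ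
  have e' := ENNReal.toReal_mono (measure_ne_top _ _) e
  rw [Measure.add_apply, Measure.add_apply, ENNReal.toReal_add (measure_ne_top _ _)
    (measure_ne_top _ _), ENNReal.toReal_add (measure_ne_top _ _) (measure_ne_top _ _)] at e'
  rw [Measure.toSignedMeasure_sub_apply hE, Measure.toSignedMeasure_sub_apply hE]
  simp only [Measure.real]
  linarith

theorem integral_withDensityᵥ {μ : Measure (Vec d)} {g f : Vec d → ℝ} (hg : Integrable g μ)
    (hf : Measurable f) (hfg : Integrable (fun x => f x * g x) μ) :
    ∫ᵛ x, f x ∂<•(μ.withDensityᵥ g) = ∫ x, f x * g x ∂μ := by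
  have h1 := isFiniteMeasure_withDensity_ofReal hg.2
  have h2 := isFiniteMeasure_withDensity_ofReal hg.neg.2
  have m1 : AEMeasurable (fun x => (g x).toNNReal) μ := hg.1.aemeasurable.real_toNNReal
  have m2 : AEMeasurable (fun x => (-g x).toNNReal) μ := hg.1.aemeasurable.neg.real_toNNReal
  have i1 : Integrable (fun x => (g x).toNNReal • f x) μ := by
    refine hfg.mono (m1.aestronglyMeasurable.smul hf.aestronglyMeasurable) (.of_forall fun x => ?_)
    rw [NNReal.smul_def, norm_smul, norm_mul, mul_comm]
    gcongr
    rw [Real.norm_of_nonneg NNReal.zero_le_coe, Real.coe_toNNReal']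
    exact max_le (le_abs_self _) (abs_nonneg _)
  have i2 : Integrable (fun x => (-g x).toNNReal • f x) μ := by
    refine hfg.mono (m2.aestronglyMeasurable.smul hf.aestronglyMeasurable) (.of_forall fun x => ?_)
    rw [NNReal.smul_def, norm_smul, norm_mul, mul_comm]
    gcongr
    rw [Real.norm_of_nonneg NNReal.zero_le_coe, Real.coe_toNNReal']
    exact max_le (neg_le_abs _) (abs_nonneg _)
  have j1 : Integrable f (μ.withDensity fun x => ENNReal.ofReal (g x)) :=
    (integrable_withDensity_iff_integrable_smul₀ m1).2 i1
  have j2 : Integrable f (μ.withDensity fun x => ENNReal.ofReal (-g x)) :=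
    (integrable_withDensity_iff_integrable_smul₀ m2).2 i2
  rw [withDensityᵥ_eq_withDensity_pos_part_sub_withDensity_neg_part hg,
    VectorMeasure.integral_sub_vectorMeasure, VectorMeasure.integral_toSignedMeasure,
    VectorMeasure.integral_toSignedMeasure]
  · have e1 : ∫ x, f x ∂(μ.withDensity fun x => ENNReal.ofReal (g x)) = _ :=
      integral_withDensity_eq_integral_smul₀ m1 f
    have e2 : ∫ x, f x ∂(μ.withDensity fun x => ENNReal.ofReal (-g x)) = _ :=
      integral_withDensity_eq_integral_smul₀ m2 f
    rw [e1, e2, ← integral_sub i1 i2]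
    refine integral_congr_ae (.of_forall fun x => ?_)
    simp only [NNReal.smul_def, Real.coe_toNNReal', smul_eq_mul]
    rw [← sub_mul, mul_comm (f x)]
    congr 1
    rcases le_total 0 (g x) with h | h <;> simp [h]
  · rw [VectorMeasure.Integrable, Measure.variation_toSignedMeasure]; exact j1
  · rw [VectorMeasure.Integrable, Measure.variation_toSignedMeasure]; exact j2

theorem IsTest.integrable_mul (h : IsTest Ω φ) {g : Vec d → ℝ} (hg : Integrable g (leb Ω)) :
    Integrable (fun x => φ x * g x) (leb Ω) := by
  obtain ⟨C, hC⟩ := h.bounded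
  exact hg.bdd_mul h.continuous.aestronglyMeasurable (.of_forall hC)

theorem ae_nonneg_of_integral_test_nonneg (hΩ : IsOpen Ω) {g : Vec d → ℝ}
    (hg : Integrable g (leb Ω)) (h : ∀ ψ, IsTest Ω ψ → 0 ≤ ψ → 0 ≤ ∫ x in Ω, ψ x * g x) :
    ∀ᵐ x ∂(leb Ω), 0 ≤ g x := by
  refine ae_nonneg_of_forall_setIntegral_nonneg hg fun s hs _ => ?_
  have := signedMeasure_le_of_integral_test_le (μ := 0) (ν := (leb Ω).withDensityᵥ g) hΩ
    (fun ψ hψ h0 => by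
      rw [integral_withDensityᵥ hg hψ.continuous.measurable (hψ.integrable_mul hg),
        VectorMeasure.integral_zero_vectorMeasure]
      exact h ψ hψ h0) (hs.inter hΩ.measurableSet) inter_subset_right
  rw [withDensityᵥ_apply hg (hs.inter hΩ.measurableSet), Measure.restrict_restrict
    (hs.inter hΩ.measurableSet), inter_assoc, inter_self] at this
  rw [Measure.restrict_restrict hs]
  exact this

end HConv

end

/-! ### Ellipticity and symmetry of the `H`-limit. -/

noncomputable section

namespace HConv

variable {d : ℕ} {Ω : Set (Vec d)} {φ ψ χ : Vec d → ℝ} {α β : ℝ}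
  {A : ℕ → Vec d → Matrix (Fin d) (Fin d) ℝ} {As : Vec d → Matrix (Fin d) (Fin d) ℝ}

theorem IsTest.inner_mulV_eq (h : IsTest Ω ψ) (f g : L2V Ω) :
    inner ℝ (mulV Ω ψ f) g = ∫ x in Ω, ψ x * inner ℝ (f x) (g x) := by
  rw [L2.inner_def]
  refine integral_congr_ae ?_
  filter_upwards [h.mulV_ae f] with x h1
  rw [h1, real_inner_smul_left]

theorem IsTest.inner_mulV_le (h : IsTest Ω ψ) (h0 : 0 ≤ ψ) {c : ℝ} {f g f' g' : L2V Ω}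
    (hle : ∀ᵐ x ∂(leb Ω), c * (inner ℝ (f x) (g x) : ℝ) ≤ inner ℝ (f' x) (g' x)) :
    c * inner ℝ (mulV Ω ψ f) g ≤ inner ℝ (mulV Ω ψ f') g' := by
  rw [h.inner_mulV_eq, h.inner_mulV_eq, ← integral_const_mul]
  refine integral_mono_ae ((h.integrable_mul (L2.integrable_inner _ _)).const_mul c)
    (h.integrable_mul (L2.integrable_inner _ _)) ?_
  filter_upwards [hle] with x hx
  rw [mul_left_comm]
  exact mul_le_mul_of_nonneg_left hx (h0 x)

theorem IsTest.inner_mulV_congr (h : IsTest Ω ψ) {f g f' g' : L2V Ω}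
    (hle : ∀ᵐ x ∂(leb Ω), (inner ℝ (f x) (g x) : ℝ) = inner ℝ (f' x) (g' x)) :
    inner ℝ (mulV Ω ψ f) g = inner ℝ (mulV Ω ψ f') g' := by
  rw [h.inner_mulV_eq, h.inner_mulV_eq]
  refine integral_congr_ae ?_
  filter_upwards [hle] with x hx
  rw [hx]

theorem IsTest.inner_mulV_self_nonneg (h : IsTest Ω ψ) (h0 : 0 ≤ ψ) (f : L2V Ω) :
    0 ≤ inner ℝ (mulV Ω ψ f) f := by
  rw [h.inner_mulV_eq]
  exact integral_nonneg fun x => mul_nonneg (h0 x) real_inner_self_nonneg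

theorem IsTest.inner_mulV_swap (h : IsTest Ω ψ) (f g : L2V Ω) :
    inner ℝ (mulV Ω ψ f) g = inner ℝ (mulV Ω ψ g) f := by
  rw [h.inner_mulV_comm, real_inner_comm]

/-- Weighted lower semicontinuity of the norm. -/
theorem IsTest.const_mul_inner_le_of_weakConv (h : IsTest Ω ψ) (h0 : 0 ≤ ψ) {c : ℝ} (hc : 0 ≤ c)
    {g : ℕ → L2V Ω} {g₀ : L2V Ω} (hg : WeakConv g g₀) {s : ℕ → ℝ} {s₀ : ℝ}
    (hs : Tendsto s atTop (𝓝 s₀)) (hle : ∀ n, c * inner ℝ (mulV Ω ψ (g n)) (g n) ≤ s n) :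
    c * inner ℝ (mulV Ω ψ g₀) g₀ ≤ s₀ := by
  -- Convexity: the weighted square of `g n - g₀` is nonnegative, so the weighted square of `g n`
  -- dominates an affine function of `g n` that is continuous for weak convergence.
  have t : Tendsto (fun n => c * (2 * inner ℝ (mulV Ω ψ g₀) (g n) - inner ℝ (mulV Ω ψ g₀) g₀)) atTop
      (𝓝 (c * (2 * inner ℝ (mulV Ω ψ g₀) g₀ - inner ℝ (mulV Ω ψ g₀) g₀))) :=
    (((hg.inner_right (mulV Ω ψ g₀)).const_mul 2).sub_const _).const_mul c
  have := le_of_tendsto_of_tendsto' t hs fun n => (mul_le_mul_of_nonneg_left (by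
    have := h.inner_mulV_self_nonneg h0 (g n - g₀)
    rw [map_sub, inner_sub_left, inner_sub_right, inner_sub_right, h.inner_mulV_swap (g n) g₀] at this
    linarith) hc).trans (hle n)
  linarith

/-- `u` is a sequence of solutions of the oscillating equations, with a fixed right hand side,
converging weakly to `v`; `τ` is the weak limit of the fluxes. -/
structure IsOscillating (A : ℕ → Vec d → Matrix (Fin d) (Fin d) ℝ)
    (As : Vec d → Matrix (Fin d) (Fin d) ℝ) (v : H10 Ω) (u : ℕ → H10 Ω) (τ : L2V Ω) : Prop where
  weak : WeakConv u v
  flux : IsFlux As v τ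
  conv : WeakConv (fun n => matL Ω (A n) (grad Ω (u n))) τ
  div (n : ℕ) : dv (matL Ω (A n) (grad Ω (u n))) = dv τ

theorem IsOscillating.tendsto_dv {v : H10 Ω} {u : ℕ → H10 Ω} {τ : L2V Ω}
    (h : IsOscillating A As v u τ) :
    Tendsto (fun n => dv (matL Ω (A n) (grad Ω (u n)))) atTop (𝓝 (dv τ)) :=
  tendsto_const_nhds.congr fun n => (h.div n).symm

theorem IsOscillating.tendsto_inner (hΩ : IsOpen Ω) (hb : Bornology.IsBounded Ω)
    {v : H10 Ω} {u : ℕ → H10 Ω} {τ : L2V Ω} (h : IsOscillating A As v u τ)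
    {w : ℕ → H10 Ω} {w₀ : H10 Ω} (hw : WeakConv w w₀) (hψ : IsTest Ω ψ) :
    Tendsto (fun n => inner ℝ (mulV Ω ψ (matL Ω (A n) (grad Ω (u n)))) (grad Ω (w n))) atTop
      (𝓝 (inner ℝ (mulV Ω ψ τ) (grad Ω w₀))) :=
  tendsto_inner_mulV_grad hΩ hb h.conv h.tendsto_dv hw hψ

theorem inner_mulV_matL_swap {M : Vec d → Matrix (Fin d) (Fin d) ℝ} (hψ : IsTest Ω ψ)
    (hM : ∀ g : L2V Ω, matL Ω M g =ᵐ[leb Ω] fun x => act (M x) (g x))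
    (hs : ∀ᵐ x ∂(leb Ω), (M x).IsSymm) (f g : L2V Ω) :
    inner ℝ (mulV Ω ψ (matL Ω M f)) g = inner ℝ (mulV Ω ψ (matL Ω M g)) f := by
  refine hψ.inner_mulV_congr ?_
  filter_upwards [hM f, hM g, hs] with x h1 h2 h3
  rw [h1, h2, inner_act_comm h3, real_inner_comm]

theorem ae_eq_of_inner_mulV_eq (hΩ : IsOpen Ω) {f g f' g' : L2V Ω}
    (h : ∀ ψ, IsTest Ω ψ → (inner ℝ (mulV Ω ψ f) g : ℝ) = inner ℝ (mulV Ω ψ f') g') :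
    ∀ᵐ x ∂(leb Ω), (inner ℝ (f x) (g x) : ℝ) = inner ℝ (f' x) (g' x) := by
  have i1 := L2.integrable_inner (𝕜 := ℝ) f g
  have i2 := L2.integrable_inner (𝕜 := ℝ) f' g'
  have := integral_mul_eq_zero_imp hΩ (i1.sub i2) fun ψ hψ => by
    have := h ψ hψ
    rw [hψ.inner_mulV_eq, hψ.inner_mulV_eq] at this
    rw [← sub_eq_zero, ← integral_sub (hψ.integrable_mul i1) (hψ.integrable_mul i2)] at this
    simpa [mul_sub] using this
  filter_upwards [this] with x hx
  simpa [sub_eq_zero] using hx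

theorem ae_le_of_inner_mulV_le (hΩ : IsOpen Ω) {c : ℝ} {f g f' g' : L2V Ω}
    (h : ∀ ψ, IsTest Ω ψ → 0 ≤ ψ → c * (inner ℝ (mulV Ω ψ f) g : ℝ) ≤ inner ℝ (mulV Ω ψ f') g') :
    ∀ᵐ x ∂(leb Ω), c * (inner ℝ (f x) (g x) : ℝ) ≤ inner ℝ (f' x) (g' x) := by
  have i1 := (L2.integrable_inner (𝕜 := ℝ) f g).const_mul c
  have i2 := L2.integrable_inner (𝕜 := ℝ) f' g'
  have := ae_nonneg_of_integral_test_nonneg hΩ (i2.sub i1) fun ψ hψ h0 => by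
    have := h ψ hψ h0
    rw [hψ.inner_mulV_eq, hψ.inner_mulV_eq, ← integral_const_mul] at this
    rw [← sub_nonneg, ← integral_sub (hψ.integrable_mul i2)
      ((hψ.integrable_mul (L2.integrable_inner _ _)).const_mul c)] at this
    simpa [mul_sub, mul_left_comm] using this
  filter_upwards [this] with x hx
  simpa using hx

/-- A sequence of symmetric fields of the class `M(α, β; Ω)`, with its `H`-limit. -/
structure IsSymmHLimit (Ω : Set (Vec d)) (α β : ℝ) (A : ℕ → Vec d → Matrix (Fin d) (Fin d) ℝ)
    (As : Vec d → Matrix (Fin d) (Fin d) ℝ) : Prop where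
  dim : 0 < d
  isOpen : IsOpen Ω
  bdd : Bornology.IsBounded Ω
  hα : 0 < α
  hβ : 0 < β
  mem (n : ℕ) : MClass α β Ω (A n)
  symm (n : ℕ) : ∀ᵐ x ∂(leb Ω), (A n x).IsSymm
  meas : MeasurableField Ω As
  conv : HConverges Ω A As

namespace IsSymmHLimit

theorem exists_isOscillating (S : IsSymmHLimit Ω α β A As) (v : H10 Ω) :
    ∃ u τ, IsOscillating A As v u τ := by
  obtain ⟨u, τ, h1, h2, h3, h4⟩ := exists_oscillating S.dim S.bdd S.hα S.hβ S.mem S.conv v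
  exact ⟨u, τ, h1, h2, h3, h4⟩

theorem matL_ae (S : IsSymmHLimit Ω α β A As) (n : ℕ) (g : L2V Ω) :
    matL Ω (A n) g =ᵐ[leb Ω] fun x => act (A n x) (g x) :=
  matL_ae_of_elliptic S.hβ (S.mem n).1 (S.mem n).elliptic g

/-- Both ellipticity bounds hold for `u n` after integration against any `ψ ≥ 0`. The energies
converge by compensated compactness and the squares are weakly lower semicontinuous, so the bounds
pass to the limit and then localize. -/
theorem ae_le (S : IsSymmHLimit Ω α β A As) {v : H10 Ω} {u : ℕ → H10 Ω} {τ : L2V Ω}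
    (h : IsOscillating A As v u τ) :
    ∀ᵐ x ∂(leb Ω), α * ‖grad Ω v x‖ ^ 2 ≤ inner ℝ (τ x) (grad Ω v x) ∧
      β⁻¹ * ‖τ x‖ ^ 2 ≤ inner ℝ (τ x) (grad Ω v x) := by
  have e1 : ∀ᵐ x ∂(leb Ω), α * (inner ℝ (grad Ω v x) (grad Ω v x) : ℝ) ≤
      inner ℝ (τ x) (grad Ω v x) :=
    ae_le_of_inner_mulV_le S.isOpen fun ψ hψ h0 => hψ.const_mul_inner_le_of_weakConv h0 S.hα.le
      (h.weak.map (grad Ω)) (h.tendsto_inner S.isOpen S.bdd h.weak hψ) fun n =>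
        hψ.inner_mulV_le h0 (by
          filter_upwards [S.matL_ae n (grad Ω (u n)), (S.mem n).elliptic] with x h1 h2
          rw [h1, real_inner_self_eq_norm_sq]
          exact (h2.2 _).1)
  have e2 : ∀ᵐ x ∂(leb Ω), β⁻¹ * (inner ℝ (τ x) (τ x) : ℝ) ≤ inner ℝ (τ x) (grad Ω v x) :=
    ae_le_of_inner_mulV_le S.isOpen fun ψ hψ h0 => hψ.const_mul_inner_le_of_weakConv h0
      (inv_nonneg.2 S.hβ.le) h.conv (h.tendsto_inner S.isOpen S.bdd h.weak hψ) fun n =>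
        hψ.inner_mulV_le h0 (by
          filter_upwards [S.matL_ae n (grad Ω (u n)), (S.mem n).elliptic] with x h1 h2
          rw [h1, real_inner_self_eq_norm_sq]
          exact (h2.2 _).2)
  filter_upwards [e1, e2] with x h1 h2
  rw [real_inner_self_eq_norm_sq] at h1 h2
  exact ⟨h1, h2⟩

/-- By symmetry of `A n` the flux of `u n` against `∇u' n` equals the flux of `u' n` against `∇u n`;
compensated compactness gives the limit of each. -/
theorem ae_symm (S : IsSymmHLimit Ω α β A As) {v v' : H10 Ω} {u u' : ℕ → H10 Ω} {τ τ' : L2V Ω}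
    (h : IsOscillating A As v u τ) (h' : IsOscillating A As v' u' τ') :
    ∀ᵐ x ∂(leb Ω), (inner ℝ (τ x) (grad Ω v' x) : ℝ) = inner ℝ (τ' x) (grad Ω v x) := by
  refine ae_eq_of_inner_mulV_eq S.isOpen fun ψ hψ => ?_
  refine tendsto_nhds_unique (h.tendsto_inner S.isOpen S.bdd h'.weak hψ)
    ((h'.tendsto_inner S.isOpen S.bdd h.weak hψ).congr fun n => ?_)
  exact inner_mulV_matL_swap hψ (S.matL_ae n) (S.symm n) _ _

end IsSymmHLimit

/-- A localized linear function. -/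
def linH (Ω : Set (Vec d)) (χ : Vec d → ℝ) (l : Vec d) : H10 Ω :=
  testH Ω fun x => χ x * inner ℝ l x

theorem grad_linH {V : Set (Vec d)} (hχ : IsTest Ω χ) (hV : IsOpen V) (h : ∀ x ∈ V, χ x = 1)
    (l : Vec d) : ∀ᵐ x ∂(leb Ω), x ∈ V → grad Ω (linH Ω χ l) x = l := by
  have hl : ContDiff ℝ ∞ fun x : Vec d => (inner ℝ l x : ℝ) := (innerSL ℝ l).contDiff
  filter_upwards [grad_testH (hχ.mul_right hl)] with x hx hxV
  have e (i : Fin d) : dd i (fun x : Vec d => (inner ℝ l x : ℝ)) x = l i := by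
    have : (fun x : Vec d => (inner ℝ l x : ℝ)) = innerSL ℝ l := rfl
    rw [dd, this, ContinuousLinearMap.fderiv]
    simp [stdb, EuclideanSpace.inner_single_right]
  rw [linH, hx]
  ext i
  rw [gradient_apply, gradient_mul_of_eq_one hV h hxV]
  exact e i

theorem ae_of_locally (hΩ : IsOpen Ω) {P : Vec d → Prop}
    (h : ∀ x ∈ Ω, ∃ V ∈ 𝓝 x, ∀ᵐ y ∂(leb Ω), y ∈ V → P y) : ∀ᵐ y ∂(leb Ω), P y := by
  rw [ae_restrict_iff' hΩ.measurableSet]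
  refine measure_null_of_locally_null _ fun x hx => ?_
  simp only [mem_compl_iff, mem_ofPred_eq, Classical.not_imp] at hx
  obtain ⟨V, hV, hP⟩ := h x hx.1
  rw [ae_restrict_iff' hΩ.measurableSet] at hP
  refine ⟨V ∩ {x | x ∈ Ω → P x}ᶜ, inter_mem (mem_nhdsWithin_of_mem_nhds hV) self_mem_nhdsWithin,
    measure_mono_null ?_ hP⟩
  rintro y ⟨h1, h2⟩ h3
  exact h2 fun h4 => h3 h4 h1

namespace IsSymmHLimit

/-- The limit of symmetric fields is symmetric, with the same ellipticity constants. -/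
theorem elliptic_symm (S : IsSymmHLimit Ω α β A As) :
    ∀ᵐ x ∂(leb Ω), Elliptic α β (As x) ∧ (As x).IsSymm := by
  refine ae_of_locally S.isOpen fun x hx => ?_
  obtain ⟨χ, hχ, -, -, V, hV, hxV, h1⟩ := exists_cutoff isCompact_singleton S.isOpen
    (singleton_subset_iff.2 hx)
  refine ⟨V, hV.mem_nhds (hxV rfl), ?_⟩
  -- Solutions converging to localized linear functions probe `As` in the direction `l` near `x`.
  -- Countably many dense directions share one null set, and continuity in the direction gives the
  -- rest.
  choose u τ hu using fun l => S.exists_isOscillating (linH Ω χ l)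
  let l (k : ℕ) : Vec d := TopologicalSpace.denseSeq (Vec d) k
  have a1 := ae_all_iff.2 fun k : ℕ => S.ae_le (hu (l k))
  have a2 := ae_all_iff.2 fun k : ℕ => grad_linH hχ hV h1 (l k)
  have a3 : ∀ᵐ x ∂(leb Ω), ∀ k : ℕ, τ (l k) x = act (As x) (grad Ω (linH Ω χ (l k)) x) :=
    ae_all_iff.2 fun k : ℕ => (hu (l k)).flux
  have a4 := ae_all_iff.2 fun i : ℕ => ae_all_iff.2 fun j : ℕ => S.ae_symm (hu (l i)) (hu (l j))
  filter_upwards [a1, a2, a3, a4] with y h1 h2 h3 h4 hy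
  have hd : DenseRange l := TopologicalSpace.denseRange_denseSeq (Vec d)
  have hc : Continuous fun η => act (As y) η := (actL (As y)).continuous
  have hell (η : Vec d) : α * ‖η‖ ^ 2 ≤ inner ℝ (act (As y) η) η ∧
      β⁻¹ * ‖act (As y) η‖ ^ 2 ≤ inner ℝ (act (As y) η) η := by
    constructor
    · refine hd.induction_on η (isClosed_le (by fun_prop) (by fun_prop)) fun k => ?_
      have := (h1 k).1
      rwa [h3 k, h2 k hy] at this
    · refine hd.induction_on η (isClosed_le (by fun_prop) (by fun_prop)) fun k => ?_
      have := (h1 k).2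
      rwa [h3 k, h2 k hy] at this
  have hsym (η η' : Vec d) : (inner ℝ (act (As y) η) η' : ℝ) = inner ℝ (act (As y) η') η := by
    refine hd.induction_on η (isClosed_eq (by fun_prop) (by fun_prop)) fun i => ?_
    refine hd.induction_on η' (isClosed_eq (by fun_prop) (by fun_prop)) fun j => ?_
    have := h4 i j
    rwa [h3 i, h3 j, h2 i hy, h2 j hy] at this
  refine ⟨⟨?_, hell⟩, ?_⟩
  · rw [← Matrix.mulVec_injective_iff_isUnit, ← Matrix.coe_mulVecLin, ← LinearMap.ker_eq_bot,
      LinearMap.ker_eq_bot']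
    intro m hm
    have h0 : act (As y) (WithLp.toLp 2 m) = 0 := by
      rw [act]; exact congrArg (WithLp.toLp 2) hm
    have := (hell (WithLp.toLp 2 m)).1
    rw [h0, inner_zero_left] at this
    have h5 : ‖(WithLp.toLp 2 m : Vec d)‖ = 0 := by
      by_contra h6
      have : 0 < α * ‖(WithLp.toLp 2 m : Vec d)‖ ^ 2 := mul_pos S.hα (by positivity)
      linarith
    exact (WithLp.toLp_eq_zero 2).1 (norm_eq_zero.1 h5)
  · ext i j
    have := hsym (EuclideanSpace.single i 1) (EuclideanSpace.single j 1)
    simpa [act, EuclideanSpace.inner_single_right] using this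

end IsSymmHLimit

end HConv

end

/-! ### Correctors. -/

noncomputable section

namespace HConv

variable {d : ℕ} {Ω : Set (Vec d)} {φ ψ χ : Vec d → ℝ} {α β : ℝ}
  {A : ℕ → Vec d → Matrix (Fin d) (Fin d) ℝ} {As : Vec d → Matrix (Fin d) (Fin d) ℝ}

theorem dd_comm (h : ContDiff ℝ ∞ φ) (i j : Fin d) (x : Vec d) : dd i (dd j φ) x = dd j (dd i φ) x := by
  have h1 : DifferentiableAt ℝ (fderiv ℝ φ) x :=
    (h.fderiv_right (m := ∞) le_rfl).differentiable (by simp) x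
  have e (k l : Fin d) : dd k (dd l φ) x = fderiv ℝ (fderiv ℝ φ) x (stdb k) (stdb l) := by
    change fderiv ℝ (fun y => fderiv ℝ φ y (stdb l)) x (stdb k) = _
    rw [fderiv_clm_apply h1 (differentiableAt_const _)]
    simp
  rw [e, e]
  exact (h.contDiffAt.isSymmSndFDerivAt (by
    rw [minSmoothness_of_isRCLikeNormedField]; exact WithTop.coe_le_coe.2 le_top)) _ _

/-- After integration by parts the second derivatives of `a` cancel by symmetry and only derivatives
of `φ` remain. With one derivative fewer on `a`, Rellich's theorem makes such curls strongly
convergent. -/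
theorem curl_mulV_grad_testH {a b : Vec d → ℝ} (h : IsTest Ω φ) (ha : IsTest Ω a) (hb : IsTest Ω b)
    (i j : Fin d) :
    curl (mulV Ω φ (grad Ω (testH Ω a))) i j (testH Ω b) =
      inner ℝ (mulS Ω (dd j φ) (comp Ω i (grad Ω (testH Ω a))) -
        mulS Ω (dd i φ) (comp Ω j (grad Ω (testH Ω a)))) (val Ω (testH Ω b)) := by
  have key (k l : Fin d) : inner ℝ (comp Ω k (mulV Ω φ (grad Ω (testH Ω a))))
      (comp Ω l (grad Ω (testH Ω b))) =
      -(∫ x, φ x * dd l (dd k a) x * b x) - ∫ x, dd l φ x * dd k a x * b x := by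
    have e1 : inner ℝ (comp Ω k (mulV Ω φ (grad Ω (testH Ω a)))) (comp Ω l (grad Ω (testH Ω b))) =
        ∫ x, φ x * dd k a x * dd l b x := by
      rw [L2.inner_def]
      refine Eq.trans (integral_congr_ae ?_) (setIntegral_eq_integral_of_forall_compl_eq_zero
        (s := Ω) fun x hx => by rw [(hb.pderiv l).eq_zero hx, mul_zero])
      filter_upwards [comp_ae k (mulV Ω φ (grad Ω (testH Ω a))), comp_ae l (grad Ω (testH Ω b)),
        h.mulV_ae (grad Ω (testH Ω a)), grad_testH ha, grad_testH hb] with x h1 h2 h3 h4 h5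
      rw [h1, h2, h3, h4, h5]
      simp [gradient_apply, mul_comm]
    have i1 : Integrable fun x => φ x * dd l (dd k a) x * b x :=
      (hb.mul_left (h.mul_left ((ha.pderiv k).pderiv l).1).1 |>.integrable volume).congr
        (.of_forall fun x => by simp only; ring)
    have i2 : Integrable fun x => dd l φ x * dd k a x * b x :=
      (hb.mul_left ((h.pderiv l).mul_left (ha.pderiv k).1).1 |>.integrable volume).congr
        (.of_forall fun x => by simp only; ring)
    rw [e1, hb.integral_mul_dd (h.mul_right (ha.pderiv k).1).1 l, ← neg_add', ← integral_add i1 i2]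
    congr 2
    ext x
    rw [dd_mul (h.differentiable x) ((ha.pderiv k).differentiable x)]
    ring
  have key' (k l : Fin d) : inner ℝ (mulS Ω (dd l φ) (comp Ω k (grad Ω (testH Ω a))))
      (val Ω (testH Ω b)) = ∫ x, dd l φ x * dd k a x * b x := by
    rw [L2.inner_def]
    refine Eq.trans (integral_congr_ae ?_) (setIntegral_eq_integral_of_forall_compl_eq_zero
      (s := Ω) fun x hx => by rw [hb.eq_zero hx, mul_zero])
    filter_upwards [(h.pderiv l).mulS_ae (comp Ω k (grad Ω (testH Ω a))),
      comp_ae k (grad Ω (testH Ω a)), grad_testH ha, val_testH hb] with x h1 h2 h3 h4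
    rw [h1, h2, h3, h4]
    simp [gradient_apply, mul_comm]
  rw [curl_apply, key, key, inner_sub_left, key', key']
  simp_rw [dd_comm ha.1 i j]
  ring

theorem IsTest.continuous_curl_mulV_grad (i j : Fin d) (w : H10 Ω) :
    Continuous fun z : H10 Ω => curl (mulV Ω φ (grad Ω z)) i j w := by
  simp_rw [curl_apply]
  fun_prop

/-- The curl of a localized gradient involves no second order derivative. -/
theorem IsTest.curl_mulV_grad (h : IsTest Ω φ) (z w : H10 Ω) (i j : Fin d) :
    curl (mulV Ω φ (grad Ω z)) i j w =
      inner ℝ (mulS Ω (dd j φ) (comp Ω i (grad Ω z)) - mulS Ω (dd i φ) (comp Ω j (grad Ω z)))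
        (val Ω w) := by
  refine H10_induction (P := fun w => curl (mulV Ω φ (grad Ω z)) i j w =
      inner ℝ (mulS Ω (dd j φ) (comp Ω i (grad Ω z)) - mulS Ω (dd i φ) (comp Ω j (grad Ω z)))
        (val Ω w)) (isClosed_eq ?_ (by fun_prop)) (fun b hb => ?_) w
  · exact ContinuousLinearMap.continuous _
  refine H10_induction (P := fun z => curl (mulV Ω φ (grad Ω z)) i j (testH Ω b) =
      inner ℝ (mulS Ω (dd j φ) (comp Ω i (grad Ω z)) - mulS Ω (dd i φ) (comp Ω j (grad Ω z)))
        (val Ω (testH Ω b))) (isClosed_eq ?_ (by fun_prop)) (fun a ha => ?_) z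
  · exact IsTest.continuous_curl_mulV_grad i j _
  · exact curl_mulV_grad_testH h ha hb i j

/-- Apply the hypothesis to vectors of the unit ball that attain the norms up to `1/(n+1)`. -/
theorem tendsto_opNorm_zero {X : Type*} [NormedAddCommGroup X] [NormedSpace ℝ X]
    {T : ℕ → StrongDual ℝ X}
    (h : ∀ v : ℕ → X, (∀ n, ‖v n‖ ≤ 1) → Tendsto (fun n => T n (v n)) atTop (𝓝 0)) :
    Tendsto (fun n => ‖T n‖) atTop (𝓝 0) := by
  have hr (n : ℕ) : ‖T n‖ - 1 / ((n : ℝ) + 1) < ‖T n‖ := by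
    have : (0 : ℝ) < 1 / ((n : ℝ) + 1) := by positivity
    linarith
  choose v hv hv' using fun n => (T n).exists_lt_apply_of_lt_opNorm (hr n)
  have t := (h v fun n => (hv n).le).norm.add tendsto_one_div_succ
  rw [norm_zero, add_zero] at t
  exact squeeze_zero (fun n => (T n).opNorm_nonneg) (fun n => by linarith [hv' n]) t

theorem tendsto_opNorm_sum_zero {X ι : Type*} [NormedAddCommGroup X] [NormedSpace ℝ X] [Fintype ι]
    {T : ι → ℕ → StrongDual ℝ X} (h : ∀ k, Tendsto (fun n => ‖T k n‖) atTop (𝓝 0)) :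
    Tendsto (fun n => ‖∑ k, T k n‖) atTop (𝓝 0) := by
  have t : Tendsto (fun n => ∑ k, ‖T k n‖) atTop (𝓝 (∑ _k : ι, 0)) :=
    tendsto_finsetSum _ fun k _ => h k
  rw [Finset.sum_const_zero] at t
  exact squeeze_zero (fun n => norm_nonneg _) (fun n => norm_sum_le _ _) t

/-- The curls of localized gradients converge strongly. -/
theorem IsTest.tendsto_curl_mulV_grad (hΩ : IsOpen Ω) (hb : Bornology.IsBounded Ω) (h : IsTest Ω φ)
    {z : ℕ → H10 Ω} (hz : WeakConv z 0) (i j : Fin d) :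
    Tendsto (fun n => ‖curl (mulV Ω φ (grad Ω (z n))) i j‖) atTop (𝓝 0) := by
  refine tendsto_opNorm_zero fun v hv => ?_
  simp_rw [h.curl_mulV_grad]
  refine tendsto_inner_val hΩ hb ?_ hv
  exact (hz.map_zero ((mulS Ω (dd j φ)).comp ((comp Ω i).comp (grad Ω)))).sub_zero
    (hz.map_zero ((mulS Ω (dd i φ)).comp ((comp Ω j).comp (grad Ω))))

theorem mulV_matL {M : Vec d → Matrix (Fin d) (Fin d) ℝ} (hφ : IsTest Ω φ)
    (hM : ∀ g : L2V Ω, matL Ω M g =ᵐ[leb Ω] fun x => act (M x) (g x)) (g : L2V Ω) :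
    matL Ω M (mulV Ω φ g) = mulV Ω φ (matL Ω M g) := by
  refine Lp.ext ?_
  filter_upwards [hM g, hM (mulV Ω φ g), hφ.mulV_ae g, hφ.mulV_ae (matL Ω M g)] with x h1 h2 h3 h4
  rw [h2, h4, h3, h1]
  exact (actL (M x)).map_smul _ _

theorem IsTest.inner_mulV_mulV (hψ : IsTest Ω ψ) (hφ : IsTest Ω φ) (f g : L2V Ω) :
    inner ℝ (mulV Ω ψ (mulV Ω φ f)) g = inner ℝ (mulV Ω (fun x => ψ x * φ x) g) f := by
  rw [hψ.inner_mulV_eq, (hψ.mul_right hφ.1).inner_mulV_eq]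
  refine integral_congr_ae ?_
  filter_upwards [hφ.mulV_ae f] with x h1
  rw [h1, real_inner_smul_left, real_inner_comm]
  ring

theorem IsTest.inner_mulV_mulV_mulV (hψ : IsTest Ω ψ) (hφ : IsTest Ω φ) (hχ : IsTest Ω χ)
    (f g : L2V Ω) : inner ℝ (mulV Ω ψ (mulV Ω φ f)) (mulV Ω χ g) =
      inner ℝ (mulV Ω (fun x => ψ x * φ x * χ x) g) f := by
  rw [hψ.inner_mulV_mulV hφ, (hψ.mul_right hφ.1).inner_mulV_mulV hχ,
    ((hψ.mul_right hφ.1).mul_right hχ.1).inner_mulV_swap]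

/-- A sequence of fields `P n`, converging weakly to `P₀`, which behave like gradients with
convergent fluxes. -/
structure IsCorrector (A : ℕ → Vec d → Matrix (Fin d) (Fin d) ℝ)
    (As : Vec d → Matrix (Fin d) (Fin d) ℝ) (P : ℕ → L2V Ω) (P₀ : L2V Ω) : Prop where
  tendsto_inner {σ : ℕ → L2V Ω} {σ₀ : L2V Ω} (hσ : WeakConv σ σ₀)
    (hd : Tendsto (fun n => dv (σ n)) atTop (𝓝 (dv σ₀))) {ψ : Vec d → ℝ} (hψ : IsTest Ω ψ) :
    Tendsto (fun n => (inner ℝ (mulV Ω ψ (P n)) (σ n) : ℝ)) atTop (𝓝 (inner ℝ (mulV Ω ψ P₀) σ₀))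
  tendsto_energy {ψ : Vec d → ℝ} (hψ : IsTest Ω ψ) :
    Tendsto (fun n => (inner ℝ (mulV Ω ψ (P n)) (matL Ω (A n) (P n)) : ℝ)) atTop
      (𝓝 (inner ℝ (mulV Ω ψ P₀) (matL Ω As P₀)))
  tendsto_curl (i j : Fin d) : Tendsto (fun n => ‖curl (P n - P₀) i j‖) atTop (𝓝 0)

theorem curl_add (η η' : L2V Ω) (i j : Fin d) : curl (η + η') i j = curl η i j + curl η' i j := by
  ext u
  simp only [curl_apply, add_apply, map_add, inner_add_left]; ring

theorem curl_zero (i j : Fin d) : curl (0 : L2V Ω) i j = 0 := by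
  ext u
  simp only [curl_apply, zero_apply, map_zero, inner_zero_left, sub_zero]

theorem curl_sum {ι : Type*} (s : Finset ι) (η : ι → L2V Ω) (i j : Fin d) :
    curl (∑ k ∈ s, η k) i j = ∑ k ∈ s, curl (η k) i j := by
  classical
  induction s using Finset.induction_on with
  | empty => simp only [Finset.sum_empty, curl_zero]
  | insert a s ha ih => rw [Finset.sum_insert ha, Finset.sum_insert ha, curl_add, ih]

namespace IsSymmHLimit

theorem matL_limit_ae (S : IsSymmHLimit Ω α β A As) (g : L2V Ω) :
    matL Ω As g =ᵐ[leb Ω] fun x => act (As x) (g x) :=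
  matL_ae_of_elliptic S.hβ S.meas (S.elliptic_symm.mono fun _ h => h.1) g

/-- Each property reduces to single terms: the energy is a double sum pairing the flux of `u l` with
the gradient of `u k`, with weight `ψ f k f l`, and compensated compactness treats every pair. -/
theorem isCorrector (S : IsSymmHLimit Ω α β A As) {ι : Type*} [Fintype ι] {f : ι → Vec d → ℝ}
    (hf : ∀ k, IsTest Ω (f k)) {v : ι → H10 Ω} {u : ι → ℕ → H10 Ω} {τ : ι → L2V Ω}
    (hu : ∀ k, IsOscillating A As (v k) (u k) (τ k)) :
    IsCorrector A As (fun n => ∑ k, mulV Ω (f k) (grad Ω (u k n)))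
      (∑ k, mulV Ω (f k) (grad Ω (v k))) where
  tendsto_inner hσ hd ψ hψ := by
    simp_rw [map_sum, sum_inner]
    refine tendsto_finsetSum _ fun k _ => ?_
    simp_rw [hψ.inner_mulV_mulV (hf k)]
    exact tendsto_inner_mulV_grad S.isOpen S.bdd hσ hd (hu k).weak (hψ.mul_right (hf k).1)
  tendsto_energy hψ := by
    simp_rw [map_sum, sum_inner, inner_sum]
    refine tendsto_finsetSum _ fun k _ => tendsto_finsetSum _ fun l _ => ?_
    simp_rw [mulV_matL (hf l) (S.matL_ae _), mulV_matL (hf l) S.matL_limit_ae,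
      hψ.inner_mulV_mulV_mulV (hf k) (hf l)]
    have e : matL Ω As (grad Ω (v l)) = τ l := by
      refine Lp.ext ?_
      filter_upwards [S.matL_limit_ae (grad Ω (v l)), (hu l).flux] with x h1 h2
      rw [h1, h2]
    rw [e]
    exact (hu l).tendsto_inner S.isOpen S.bdd (hu k).weak ((hψ.mul_right (hf k).1).mul_right (hf l).1)
  tendsto_curl i j := by
    have e (n : ℕ) : (∑ k, mulV Ω (f k) (grad Ω (u k n))) - ∑ k, mulV Ω (f k) (grad Ω (v k)) =
        ∑ k, mulV Ω (f k) (grad Ω (u k n - v k)) := by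
      simp_rw [map_sub, Finset.sum_sub_distrib]
    simp_rw [e, curl_sum]
    exact tendsto_opNorm_sum_zero fun k =>
      (hf k).tendsto_curl_mulV_grad S.isOpen S.bdd (hu k).weak.sub_const i j

theorem exists_isCorrector (S : IsSymmHLimit Ω α β A As) (W : L2V Ω) {ε : ℝ} (hε : 0 < ε) :
    ∃ (P : ℕ → L2V Ω) (P₀ : L2V Ω), IsCorrector A As P P₀ ∧ ‖W - P₀‖ < ε := by
  -- The componentwise errors add in squares, and `d (ε/(d+1))² < ε²`.
  have hδ : 0 < ε / (d + 1) := by positivity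
  choose f hf hf' using fun k => exists_test_near S.isOpen S.bdd (comp Ω k W) hδ
  obtain ⟨χ, hχ, -, -, V, hV, hKV, h1⟩ := exists_cutoff (K := ⋃ k, tsupport (f k))
    (isCompact_iUnion fun k => (hf k).2.1) S.isOpen (iUnion_subset fun k => (hf k).2.2)
  -- As `χ = 1` near the supports of all `f k`, the gradient of the localized `xₖ` is the basis
  -- vector there, so the weak limit of the corrector is the field with components `f k`.
  choose u τ hu using fun k => S.exists_isOscillating (linH Ω χ (stdb k))
  refine ⟨_, _, S.isCorrector hf hu, ?_⟩
  set P₀ := ∑ k, mulV Ω (f k) (grad Ω (linH Ω χ (stdb k))) with hP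
  have e (k : Fin d) : comp Ω k P₀ = val Ω (testH Ω (f k)) := by
    refine Lp.ext ?_
    have e1 : P₀ =ᵐ[leb Ω] fun x => ∑ l, mulV Ω (f l) (grad Ω (linH Ω χ (stdb l))) x :=
      (Lp.coeFn_finsetSum _ _).trans (.of_forall fun x => by simp)
    filter_upwards [comp_ae k P₀, e1, val_testH (hf k),
      ae_all_iff.2 fun l => (hf l).mulV_ae (grad Ω (linH Ω χ (stdb l))),
      ae_all_iff.2 fun l => grad_linH hχ hV h1 (stdb l)] with x h2 h3 h4 h5 h6
    rw [h2, h3, h4]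
    have e2 (l : Fin d) : f l x • grad Ω (linH Ω χ (stdb l)) x = f l x • stdb l := by
      by_cases hx : x ∈ tsupport (f l)
      · rw [h6 l (hKV (mem_iUnion_of_mem l hx))]
      · rw [image_eq_zero_of_notMem_tsupport hx, zero_smul, zero_smul]
    simp_rw [h5, e2]
    simp [stdb, Finset.sum_apply, Pi.single_apply]
  refine lt_of_pow_lt_pow_left₀ 2 hε.le ?_
  rw [← real_inner_self_eq_norm_sq, inner_eq_sum_comp]
  calc ∑ k, inner ℝ (comp Ω k (W - P₀)) (comp Ω k (W - P₀)) ≤ ∑ _k : Fin d, (ε / (d + 1)) ^ 2 := by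
        refine Finset.sum_le_sum fun k _ => ?_
        rw [real_inner_self_eq_norm_sq, map_sub, e]
        gcongr
        exact (hf' k).le
    _ < ε ^ 2 := by
        rw [Finset.sum_const, Finset.card_univ, Fintype.card_fin, nsmul_eq_mul, div_pow,
          mul_div_assoc', div_lt_iff₀ (by positivity)]
        have : 0 < ε ^ 2 := by positivity
        nlinarith [Nat.cast_nonneg (α := ℝ) d, mul_nonneg this.le (Nat.cast_nonneg (α := ℝ) d), mul_nonneg this.le (sq_nonneg (d : ℝ))]

end IsSymmHLimit

end HConv

end

/-! ### Weak compactness and convergence of curls in `H⁻¹_loc(Ω)`. -/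

noncomputable section

namespace HConv

section Abstract

/-- Sequential Banach-Alaoglu, transported from the dual by Riesz representation. -/
theorem exists_subseq_weakConv {H : Type*} [NormedAddCommGroup H] [InnerProductSpace ℝ H]
    [CompleteSpace H] [TopologicalSpace.SeparableSpace H] {x : ℕ → H} {C : ℝ}
    (hx : ∀ n, ‖x n‖ ≤ C) : ∃ (k : ℕ → ℕ) (a : H), StrictMono k ∧ WeakConv (fun n => x (k n)) a := by
  obtain ⟨a, -, k, hk, h⟩ := WeakDual.isSeqCompact_closedBall ℝ H (0 : StrongDual ℝ H) C
    (x := fun n => StrongDual.toWeakDual (innerSL ℝ (x n))) fun n => by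
      simpa using hx n
  refine ⟨k, (InnerProductSpace.toDual ℝ H).symm (WeakDual.toStrongDual a), hk, fun ℓ => ?_⟩
  have := ((WeakDual.eval_continuous ((InnerProductSpace.toDual ℝ H).symm ℓ)).tendsto a).comp h
  have e (y : H) : ℓ y = inner ℝ y ((InnerProductSpace.toDual ℝ H).symm ℓ) := by
    rw [real_inner_comm, InnerProductSpace.toDual_symm_apply]
  simp_rw [e]
  rw [InnerProductSpace.toDual_symm_apply]
  exact this

/-- In a compact set of functionals, pointwise convergence implies convergence. -/
theorem tendsto_of_isCompact_of_apply {X : Type*} [NormedAddCommGroup X] [NormedSpace ℝ X]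
    {K : Set (StrongDual ℝ X)} (hK : IsCompact K) {T : ℕ → StrongDual ℝ X} {T₀ : StrongDual ℝ X}
    (hT : ∀ n, T n ∈ K) (h : ∀ x, Tendsto (fun n => T n x) atTop (𝓝 (T₀ x))) :
    Tendsto (fun n => ‖T n - T₀‖) atTop (𝓝 0) := by
  refine dual_tendsto_iff.1 (tendsto_of_subseq_tendsto fun k hk => ?_)
  obtain ⟨S, -, m, hm, hS⟩ := hK.tendsto_subseq fun n => hT (k n)
  refine ⟨m, ?_⟩
  have : S = T₀ := ContinuousLinearMap.ext fun x => tendsto_nhds_unique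
    (((ContinuousLinearMap.apply ℝ ℝ x).continuous.tendsto S).comp hS)
    ((h x).comp (hk.comp hm.tendsto_atTop))
  rwa [this] at hS

/-- For the passage to the limit first in the sequence index, then in the corrector index. -/
theorem tendsto_zero_of_double {x : ℕ → ℝ} (hx : ∀ n, 0 ≤ x n) {b : ℕ → ℝ}
    (hb : Tendsto b atTop (𝓝 0))
    (h : ∀ k, ∃ a : ℕ → ℝ, (∀ n, x n ≤ a n) ∧ Tendsto a atTop (𝓝 (b k))) :
    Tendsto x atTop (𝓝 0) := by
  refine tendsto_order.2 ⟨fun c hc => .of_forall fun n => hc.trans_le (hx n), fun c hc => ?_⟩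
  obtain ⟨k, hk⟩ := (hb.eventually_lt_const hc).exists
  obtain ⟨a, ha, hab⟩ := h k
  filter_upwards [hab.eventually_lt_const hk] with n hn using (ha n).trans_lt hn

end Abstract

variable {d : ℕ} {Ω : Set (Vec d)} {φ ψ χ : Vec d → ℝ} {α β : ℝ}
  {A : ℕ → Vec d → Matrix (Fin d) (Fin d) ℝ} {As : Vec d → Matrix (Fin d) (Fin d) ℝ}

theorem signedMeasure_le_of_restrict_eq (hΩ : IsOpen Ω) {μ ν : SignedMeasure (Vec d)}
    (hμ : μ.restrict Ω = μ) (hν : ν.restrict Ω = ν)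
    (h : ∀ ψ, IsTest Ω ψ → 0 ≤ ψ → ∫ᵛ x, ψ x ∂<•μ ≤ ∫ᵛ x, ψ x ∂<•ν) : μ ≤ ν := by
  refine VectorMeasure.le_iff.2 fun E hE => ?_
  rw [← hμ, ← hν, VectorMeasure.restrict_apply _ hΩ.measurableSet hE,
    VectorMeasure.restrict_apply _ hΩ.measurableSet hE]
  exact signedMeasure_le_of_integral_test_le hΩ h (hE.inter hΩ.measurableSet) inter_subset_right

theorem withDensityᵥ_leb_restrict (hΩ : IsOpen Ω) {g : Vec d → ℝ} (hg : Integrable g (leb Ω)) :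
    ((leb Ω).withDensityᵥ g).restrict Ω = (leb Ω).withDensityᵥ g := by
  refine VectorMeasure.ext fun E hE => ?_
  rw [VectorMeasure.restrict_apply _ hΩ.measurableSet hE,
    withDensityᵥ_apply hg (hE.inter hΩ.measurableSet), withDensityᵥ_apply hg hE,
    Measure.restrict_restrict (hE.inter hΩ.measurableSet), Measure.restrict_restrict hE, inter_assoc,
    inter_self]

theorem norm_incl {D : Set (Vec d)} (h : D ⊆ Ω) (u : H10 D) : ‖incl h u‖ = ‖u‖ := by
  rw [Submodule.coe_norm, coe_incl, ← Submodule.coe_norm]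

theorem opNorm_comp_le_of_norm_eq {X Y : Type*} [NormedAddCommGroup X] [NormedSpace ℝ X]
    [NormedAddCommGroup Y] [NormedSpace ℝ Y] (T : StrongDual ℝ Y) {L : X →L[ℝ] Y}
    (hL : ∀ u, ‖L u‖ = ‖u‖) : ‖T.comp L‖ ≤ ‖T‖ := by
  refine ContinuousLinearMap.opNorm_le_bound _ T.opNorm_nonneg fun u => ?_
  rw [← hL u]
  exact T.le_opNorm _
theorem toLoc_sub (T T' : HNeg Ω) (D : Inner Ω) :
    (toLoc (T - T')).1 D = (toLoc T).1 D - (toLoc T').1 D :=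
  ContinuousLinearMap.sub_comp T T' _
theorem toLoc_curl_sub (η η' : L2V Ω) (i j : Fin d) (D : Inner Ω) :
    (toLoc (curl (η - η') i j)).1 D = (toLoc (curl η i j)).1 D - (toLoc (curl η' i j)).1 D := by
  rw [curl_sub, toLoc_sub]
theorem curl_incl_eq {D : Inner Ω} (hψ : IsTest Ω ψ) (h1 : ∀ x ∈ D.1, ψ x = 1) (η : L2V Ω)
    (i j : Fin d) (u : H10 D.1) :
    curl η i j (incl (subset_closure.trans D.2.2.2) u) =
      curl (mulV Ω ψ η) i j (incl (subset_closure.trans D.2.2.2) u) := by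
  refine H10_induction (P := fun u => curl η i j (incl (subset_closure.trans D.2.2.2) u) =
      curl (mulV Ω ψ η) i j (incl (subset_closure.trans D.2.2.2) u)) (isClosed_eq ?_ ?_)
    (fun b hb => ?_) u
  · exact ((curl η i j).continuous.comp (incl _).continuous)
  · exact ((curl (mulV Ω ψ η) i j).continuous.comp (incl _).continuous)
  have hbΩ := hb.mono (subset_closure.trans D.2.2.2)
  have key (k l : Fin d) : (inner ℝ (comp Ω k η) (comp Ω l (grad Ω (testH Ω b))) : ℝ) =
      inner ℝ (comp Ω k (mulV Ω ψ η)) (comp Ω l (grad Ω (testH Ω b))) := by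
    simp_rw [L2.inner_def]
    refine integral_congr_ae ?_
    filter_upwards [comp_ae k η, comp_ae k (mulV Ω ψ η), comp_ae l (grad Ω (testH Ω b)),
      hψ.mulV_ae η, grad_testH hbΩ] with x h2 h3 h4 h5 h6
    rw [h2, h3, h4, h5, h6]
    by_cases hx : x ∈ D.1
    · rw [h1 x hx, one_smul]
    · rw [hb.gradient_eq_zero hx]
      simp
  rw [incl_testH _ hb, curl_apply, curl_apply, key, key]

theorem opNorm_comp_le_of_apply_le {X Y : Type*} [NormedAddCommGroup X] [NormedSpace ℝ X]
    [NormedAddCommGroup Y] [NormedSpace ℝ Y] {T : StrongDual ℝ Y} {L : X →L[ℝ] Y}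
    (hL : ∀ u, ‖L u‖ = ‖u‖) {C : ℝ} (hC : 0 ≤ C) (h : ∀ u, ‖T (L u)‖ ≤ C * ‖L u‖) :
    ‖T.comp L‖ ≤ C := by
  refine ContinuousLinearMap.opNorm_le_bound _ hC fun u => ?_
  rw [← hL u]
  exact h u

/-- On `D` the curl sees only `ψη`, since `ψ = 1` there, and a first derivative of an `L²` field is
bounded in `H⁻¹`; the factor 2 counts the two terms of the curl. -/
theorem norm_toLoc_curl_le {D : Inner Ω} (hψ : IsTest Ω ψ) (h1 : ∀ x ∈ D.1, ψ x = 1) (η : L2V Ω)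
    (i j : Fin d) : ‖(toLoc (curl η i j)).1 D‖ ≤ 2 * ‖mulV Ω ψ η‖ := 
  opNorm_comp_le_of_apply_le (norm_incl _) (by positivity) fun u => by
    rw [curl_incl_eq hψ h1]
    exact norm_curl_apply_le _ i j _

theorem norm_toLoc_le (D : Inner Ω) (T : HNeg Ω) : ‖(toLoc T).1 D‖ ≤ ‖T‖ :=
  opNorm_comp_le_of_norm_eq T (norm_incl _)

theorem toLoc_add (T T' : HNeg Ω) (D : Inner Ω) :
    (toLoc (T + T')).1 D = (toLoc T).1 D + (toLoc T').1 D :=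
  ContinuousLinearMap.add_comp T T' _

theorem toLoc_curl_add (η η' : L2V Ω) (i j : Fin d) (D : Inner Ω) :
    (toLoc (curl (η + η') i j)).1 D = (toLoc (curl η i j)).1 D + (toLoc (curl η' i j)).1 D := by
  rw [curl_add, toLoc_add]

theorem opNorm_add_sub_le {X : Type*} [NormedAddCommGroup X] [NormedSpace ℝ X]
    (S T U : StrongDual ℝ X) : ‖S + T - U‖ ≤ ‖S‖ + ‖T‖ + ‖U‖ :=
  (norm_sub_le _ _).trans (add_le_add_left (norm_add_le _ _) _)

theorem IsTest.norm_mulV_sq_le (hψ : IsTest Ω ψ) (h0 : 0 ≤ ψ) (h1 : ψ ≤ 1) (η : L2V Ω) :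
    ‖mulV Ω ψ η‖ ^ 2 ≤ inner ℝ (mulV Ω ψ η) η := by
  rw [← real_inner_self_eq_norm_sq, L2.inner_def, L2.inner_def]
  refine integral_mono_ae (L2.integrable_inner _ _) (L2.integrable_inner _ _) ?_
  filter_upwards [hψ.mulV_ae η] with x hx
  simp only [hx, inner_smul_left, inner_smul_right]
  have e0 : 0 ≤ ψ x := h0 x
  have e1 : ψ x ≤ 1 := h1 x
  have e2 : (0 : ℝ) ≤ inner ℝ (η x) (η x) := real_inner_self_nonneg
  simp only [conj_trivial]
  exact mul_le_mul_of_nonneg_left (mul_le_of_le_one_left e2 e1) e0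

/-- `curl (η n) → curl η₀` in `H⁻¹_loc(Ω)`. -/
def CurlConvLoc (η : ℕ → L2V Ω) (η₀ : L2V Ω) : Prop :=
  ∀ (D : Inner Ω) (i j : Fin d),
    Tendsto (fun n => ‖(toLoc (curl (η n - η₀) i j)).1 D‖) atTop (𝓝 0)

theorem CurlConvLoc.isCompact {η : ℕ → L2V Ω} {η₀ : L2V Ω} (h : CurlConvLoc η η₀) :
    ∃ K : Set (Fin d → Fin d → HNegLoc Ω), IsCompact K ∧
      ∀ n, (fun i j => toLoc (curl (η n) i j)) ∈ K := by
  have t : Tendsto (fun n => (fun i j => toLoc (curl (η n) i j) : Fin d → Fin d → HNegLoc Ω)) atTop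
      (𝓝 fun i j => toLoc (curl η₀ i j)) := by
    refine tendsto_pi_nhds.2 fun i => tendsto_pi_nhds.2 fun j => tendsto_subtype_rng.2
      (tendsto_pi_nhds.2 fun D => dual_tendsto_iff.2 ?_)
    refine (h D i j).congr fun n => ?_
    rw [toLoc_curl_sub]
  exact ⟨_, t.isCompact_insert_range, fun n => mem_insert_of_mem _ (mem_range_self n)⟩

/-- Weak convergence of the fields gives convergence of the curls against each fixed element;
compactness upgrades this to norm convergence on every `D`. -/
theorem curlConvLoc_of_isCompact {η : ℕ → L2V Ω} {η₀ : L2V Ω} (hη : WeakConv η η₀)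
    {K : Set (Fin d → Fin d → HNegLoc Ω)} (hK : IsCompact K)
    (h : ∀ n, (fun i j => toLoc (curl (η n) i j)) ∈ K) : CurlConvLoc η η₀ := by
  intro D i j
  let p : (Fin d → Fin d → HNegLoc Ω) → HNeg D.1 := fun T => (T i j).1 D
  have hp : Continuous p := (continuous_apply D).comp
    (continuous_subtype_val.comp ((continuous_apply j).comp (continuous_apply i)))
  have t := tendsto_of_isCompact_of_apply (hK.image hp) (T := fun n => (toLoc (curl (η n) i j)).1 D)
    (T₀ := (toLoc (curl η₀ i j)).1 D) (fun n => ⟨_, h n, rfl⟩) fun u => by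
      change Tendsto (fun n => curl (η n) i j (incl _ u)) _ (𝓝 (curl η₀ i j (incl _ u)))
      simp_rw [curl_apply]
      exact ((hη.map (comp Ω j)).inner_left _).sub ((hη.map (comp Ω i)).inner_left _)
  refine t.congr fun n => ?_
  rw [toLoc_curl_sub]

end HConv

end

/-! ### The energy defect: lower bound and case of equality. -/

noncomputable section

namespace HConv

variable {d : ℕ} {Ω : Set (Vec d)} {φ ψ χ : Vec d → ℝ} {α β : ℝ}
  {A : ℕ → Vec d → Matrix (Fin d) (Fin d) ℝ} {As : Vec d → Matrix (Fin d) (Fin d) ℝ}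

instance : TopologicalSpace.SeparableSpace (L2V Ω) := by
  have : Fact ((2 : ENNReal) ≠ ⊤) := ⟨by simp⟩
  have := Lp.SecondCountableTopology (μ := leb Ω) (E := Vec d) (p := 2)
  infer_instance

theorem matL_matL_inv {M : Vec d → Matrix (Fin d) (Fin d) ℝ}
    (hM : ∀ g : L2V Ω, matL Ω M g =ᵐ[leb Ω] fun x => act (M x) (g x))
    (hM' : ∀ g : L2V Ω, matL Ω (fun x => (M x)⁻¹) g =ᵐ[leb Ω] fun x => act (M x)⁻¹ (g x))
    (hu : ∀ᵐ x ∂(leb Ω), IsUnit (M x)) (g : L2V Ω) :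
    matL Ω M (matL Ω (fun x => (M x)⁻¹) g) = g := by
  refine Lp.ext ?_
  filter_upwards [hM (matL Ω (fun x => (M x)⁻¹) g), hM' g, hu] with x h1 h2 h3
  rw [h1, h2, act_cancel_inv h3]

theorem matL_inv_matL {M : Vec d → Matrix (Fin d) (Fin d) ℝ}
    (hM : ∀ g : L2V Ω, matL Ω M g =ᵐ[leb Ω] fun x => act (M x) (g x))
    (hM' : ∀ g : L2V Ω, matL Ω (fun x => (M x)⁻¹) g =ᵐ[leb Ω] fun x => act (M x)⁻¹ (g x))
    (hu : ∀ᵐ x ∂(leb Ω), IsUnit (M x)) (g : L2V Ω) :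
    matL Ω (fun x => (M x)⁻¹) (matL Ω M g) = g := by
  refine Lp.ext ?_
  filter_upwards [hM' (matL Ω M g), hM g, hu] with x h1 h2 h3
  rw [h1, h2, act_inv_cancel h3]

/-- Expansion of the energy of `w - p` for a symmetric field. -/
theorem inner_mulV_matL_sub {M : Vec d → Matrix (Fin d) (Fin d) ℝ} (hψ : IsTest Ω ψ)
    (hM : ∀ g : L2V Ω, matL Ω M g =ᵐ[leb Ω] fun x => act (M x) (g x))
    (hs : ∀ᵐ x ∂(leb Ω), (M x).IsSymm) (w p : L2V Ω) :
    inner ℝ (mulV Ω ψ (w - p)) (matL Ω M (w - p)) = inner ℝ (mulV Ω ψ w) (matL Ω M w) -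
      2 * inner ℝ (mulV Ω ψ p) (matL Ω M w) + inner ℝ (mulV Ω ψ p) (matL Ω M p) := by
  have e : (inner ℝ (mulV Ω ψ w) (matL Ω M p) : ℝ) = inner ℝ (mulV Ω ψ p) (matL Ω M w) := by
    rw [hψ.inner_mulV_swap, inner_mulV_matL_swap hψ hM hs, hψ.inner_mulV_swap]
  simp only [map_sub, inner_sub_left, inner_sub_right, e]
  ring

namespace IsSymmHLimit

theorem matL_inv_ae (S : IsSymmHLimit Ω α β A As) (n : ℕ) (g : L2V Ω) :
    matL Ω (fun x => (A n x)⁻¹) g =ᵐ[leb Ω] fun x => act (A n x)⁻¹ (g x) :=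
  matL_inv_ae_of_elliptic S.hα (S.mem n).1 (S.mem n).elliptic g

theorem matL_limit_inv_ae (S : IsSymmHLimit Ω α β A As) (g : L2V Ω) :
    matL Ω (fun x => (As x)⁻¹) g =ᵐ[leb Ω] fun x => act (As x)⁻¹ (g x) :=
  matL_inv_ae_of_elliptic S.hα S.meas (S.elliptic_symm.mono fun _ h => h.1) g

theorem matL_cancel (S : IsSymmHLimit Ω α β A As) (n : ℕ) (g : L2V Ω) :
    matL Ω (A n) (matL Ω (fun x => (A n x)⁻¹) g) = g :=
  matL_matL_inv (S.matL_ae n) (S.matL_inv_ae n) ((S.mem n).elliptic.mono fun _ h => h.1) g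

theorem matL_limit_cancel (S : IsSymmHLimit Ω α β A As) (g : L2V Ω) :
    matL Ω As (matL Ω (fun x => (As x)⁻¹) g) = g :=
  matL_matL_inv S.matL_limit_ae S.matL_limit_inv_ae (S.elliptic_symm.mono fun _ h => h.1.1) g

theorem matL_limit_inv_cancel (S : IsSymmHLimit Ω α β A As) (g : L2V Ω) :
    matL Ω (fun x => (As x)⁻¹) (matL Ω As g) = g :=
  matL_inv_matL S.matL_limit_ae S.matL_limit_inv_ae (S.elliptic_symm.mono fun _ h => h.1.1) g

theorem const_mul_le_energy (S : IsSymmHLimit Ω α β A As) (hψ : IsTest Ω ψ) (h0 : 0 ≤ ψ) (n : ℕ)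
    (g : L2V Ω) : α * inner ℝ (mulV Ω ψ g) g ≤ inner ℝ (mulV Ω ψ g) (matL Ω (A n) g) :=
  hψ.inner_mulV_le h0 (by
    filter_upwards [S.matL_ae n g, (S.mem n).elliptic] with x h1 h2
    rw [h1, real_inner_self_eq_norm_sq, real_inner_comm]
    exact (h2.2 _).1)

variable {ξ : ℕ → L2V Ω} {ξ₀ : L2V Ω} {z : ℝ}

/-- The three terms of the expanded energy tend to `z - 2 P₀·ξ₀ + As P₀·P₀`. Completing the square
around `W = As⁻¹ ξ₀`, by symmetry of `As`, separates the defect `z - W·ξ₀` from the error of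
approximating `W`. -/
theorem tendsto_energy_sub (S : IsSymmHLimit Ω α β A As) (hξ : WeakConv ξ ξ₀)
    (hdiv : Tendsto (fun n => dv (ξ n)) atTop (𝓝 (dv ξ₀))) (hψ : IsTest Ω ψ)
    (hz : Tendsto (fun n => (inner ℝ (mulV Ω ψ (matL Ω (fun x => (A n x)⁻¹) (ξ n))) (ξ n) : ℝ)) atTop
      (𝓝 z)) {P : ℕ → L2V Ω} {P₀ : L2V Ω} (hP : IsCorrector A As P P₀) :
    Tendsto (fun n => (inner ℝ (mulV Ω ψ (matL Ω (fun x => (A n x)⁻¹) (ξ n) - P n))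
      (matL Ω (A n) (matL Ω (fun x => (A n x)⁻¹) (ξ n) - P n)) : ℝ)) atTop
      (𝓝 (z - inner ℝ (mulV Ω ψ (matL Ω (fun x => (As x)⁻¹) ξ₀)) ξ₀ +
        inner ℝ (mulV Ω ψ (matL Ω (fun x => (As x)⁻¹) ξ₀ - P₀))
          (matL Ω As (matL Ω (fun x => (As x)⁻¹) ξ₀ - P₀)))) := by
  rw [inner_mulV_matL_sub hψ S.matL_limit_ae (S.elliptic_symm.mono fun _ h => h.2),
    S.matL_limit_cancel]
  have e (n : ℕ) := inner_mulV_matL_sub hψ (S.matL_ae n) (S.symm n)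
    (matL Ω (fun x => (A n x)⁻¹) (ξ n)) (P n)
  simp_rw [e, S.matL_cancel]
  have t := (hz.sub ((hP.tendsto_inner hξ hdiv hψ).const_mul 2)).add (hP.tendsto_energy hψ)
  refine t.trans_eq (congrArg 𝓝 ?_)
  ring

theorem exists_seq_isCorrector (S : IsSymmHLimit Ω α β A As) (W : L2V Ω) :
    ∃ (P : ℕ → ℕ → L2V Ω) (P₀ : ℕ → L2V Ω), (∀ k, IsCorrector A As (P k) (P₀ k)) ∧
      Tendsto (fun k => W - P₀ k) atTop (𝓝 0) := by
  have hn : ∀ n : ℕ, (0 : ℝ) < 1 / ((n : ℝ) + 1) := fun n => by positivity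
  choose P P₀ h h' using fun k => S.exists_isCorrector W (hn k)
  exact ⟨P, P₀, h, squeeze_zero_norm (fun k => (h' k).le) tendsto_one_div_succ⟩

/-- The lower bound for the limit of the energies. -/
theorem le_of_tendsto_energy (S : IsSymmHLimit Ω α β A As) (hξ : WeakConv ξ ξ₀)
    (hdiv : Tendsto (fun n => dv (ξ n)) atTop (𝓝 (dv ξ₀))) (hψ : IsTest Ω ψ) (h0 : 0 ≤ ψ)
    (hz : Tendsto (fun n => (inner ℝ (mulV Ω ψ (matL Ω (fun x => (A n x)⁻¹) (ξ n))) (ξ n) : ℝ)) atTop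
      (𝓝 z)) : inner ℝ (mulV Ω ψ (matL Ω (fun x => (As x)⁻¹) ξ₀)) ξ₀ ≤ z := by
  obtain ⟨P, P₀, hP, hP₀⟩ := S.exists_seq_isCorrector (matL Ω (fun x => (As x)⁻¹) ξ₀)
  have hc : Continuous fun g : L2V Ω => (inner ℝ (mulV Ω ψ g) (matL Ω As g) : ℝ) := by fun_prop
  have t := ((hc.tendsto 0).comp hP₀).const_add
    (z - inner ℝ (mulV Ω ψ (matL Ω (fun x => (As x)⁻¹) ξ₀)) ξ₀)
  -- The energies of the differences are nonnegative, so the defect plus the error term of `P₀ k` is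
  -- nonnegative for each `k`; the error vanishes as `k` grows.
  have := ge_of_tendsto' t fun k => ge_of_tendsto'
    (S.tendsto_energy_sub hξ hdiv hψ hz (hP k)) fun n =>
      (mul_nonneg S.hα.le (hψ.inner_mulV_self_nonneg h0 _)).trans (S.const_mul_le_energy hψ h0 n _)
  rw [map_zero, inner_zero_left] at this
  linarith

/-- If there is no energy defect, the curls converge locally strongly. -/
theorem curlConvLoc (S : IsSymmHLimit Ω α β A As) (hξ : WeakConv ξ ξ₀)
    (hdiv : Tendsto (fun n => dv (ξ n)) atTop (𝓝 (dv ξ₀)))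
    (hz : ∀ ψ, IsTest Ω ψ →
      Tendsto (fun n => (inner ℝ (mulV Ω ψ (matL Ω (fun x => (A n x)⁻¹) (ξ n))) (ξ n) : ℝ)) atTop
        (𝓝 (inner ℝ (mulV Ω ψ (matL Ω (fun x => (As x)⁻¹) ξ₀)) ξ₀))) :
    CurlConvLoc (fun n => matL Ω (fun x => (A n x)⁻¹) (ξ n)) (matL Ω (fun x => (As x)⁻¹) ξ₀) := by
  intro D i j
  obtain ⟨ψ, hψ, h0, h1, V, -, hDV, hψV⟩ := exists_cutoff D.2.2.1 S.isOpen D.2.2.2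
  have hψ1 : ∀ x ∈ D.1, ψ x = 1 := fun x hx => hψV x (hDV (subset_closure hx))
  obtain ⟨P, P₀, hP, hP₀⟩ := S.exists_seq_isCorrector (matL Ω (fun x => (As x)⁻¹) ξ₀)
  set W := matL Ω (fun x => (As x)⁻¹) ξ₀
  set w := fun n => matL Ω (fun x => (A n x)⁻¹) (ξ n)
  have hc : Continuous fun g : L2V Ω =>
      2 * √(α⁻¹ * inner ℝ (mulV Ω ψ g) (matL Ω As g)) + 2 * ‖mulV Ω ψ g‖ := by fun_prop
  have hb := (hc.tendsto 0).comp hP₀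
  simp only [map_zero, inner_zero_left, mul_zero, Real.sqrt_zero, norm_zero, add_zero] at hb
  refine tendsto_zero_of_double (fun n => ContinuousLinearMap.opNorm_nonneg _) hb fun k => ?_
  refine ⟨fun n => 2 * √(α⁻¹ * inner ℝ (mulV Ω ψ (w n - P k n)) (matL Ω (A n) (w n - P k n))) +
    ‖curl (P k n - P₀ k) i j‖ + 2 * ‖mulV Ω ψ (W - P₀ k)‖, fun n => ?_, ?_⟩
  -- The first difference is controlled in local `L²` by its energy, whose limit involves only `W -
  -- P₀ k` because the defect is zero; the second has strongly null curl; the third is small in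
  -- `L²`.
  · have e : w n - W = (w n - P k n) + (P k n - P₀ k) - (W - P₀ k) := by abel
    rw [e, toLoc_curl_sub, toLoc_curl_add]
    have e1 := norm_toLoc_curl_le hψ hψ1 (w n - P k n) i j
    have e2 := norm_toLoc_curl_le hψ hψ1 (W - P₀ k) i j
    have e3 := norm_toLoc_le D (curl (P k n - P₀ k) i j)
    have e4 : ‖mulV Ω ψ (w n - P k n)‖ ≤
        √(α⁻¹ * inner ℝ (mulV Ω ψ (w n - P k n)) (matL Ω (A n) (w n - P k n))) := by
      refine Real.le_sqrt_of_sq_le ((hψ.norm_mulV_sq_le h0 h1 _).trans ?_)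
      rw [inv_mul_eq_div, le_div_iff₀' S.hα]
      exact S.const_mul_le_energy hψ h0 n _
    exact (opNorm_add_sub_le _ _ _).trans (by linarith)
  · have t := S.tendsto_energy_sub hξ hdiv hψ (hz ψ hψ) (hP k)
    rw [sub_self, zero_add] at t
    have := ((((t.const_mul α⁻¹).sqrt).const_mul 2).add ((hP k).tendsto_curl i j)).add_const
      (2 * ‖mulV Ω ψ (W - P₀ k)‖)
    rwa [add_zero] at this

theorem matL_inv_bounded (S : IsSymmHLimit Ω α β A As) (hξ : WeakConv ξ ξ₀) :
    ∃ C, ∀ n, ‖matL Ω (fun x => (A n x)⁻¹) (ξ n)‖ ≤ C := by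
  obtain ⟨C, hC⟩ := hξ.bounded
  refine ⟨α⁻¹ * C, fun n => (Lp.norm_le_mul_norm_of_ae_le_mul (c := α⁻¹) ?_).trans
    (mul_le_mul_of_nonneg_left (hC n) (inv_nonneg.2 S.hα.le))⟩
  filter_upwards [S.matL_inv_ae n (ξ n), (S.mem n).elliptic] with x h1 h2
  rw [h1]
  exact h2.norm_act_inv_le S.hα _

/-- The weak limit of the fields `A n⁻¹ (ξ n)` is determined when their curls are compact. -/
theorem matL_limit_eq (S : IsSymmHLimit Ω α β A As) (hξ : WeakConv ξ ξ₀)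
    (hdiv : Tendsto (fun n => dv (ξ n)) atTop (𝓝 (dv ξ₀))) {k : ℕ → ℕ} (hk : Tendsto k atTop atTop)
    {w : L2V Ω} (hw : WeakConv (fun n => matL Ω (fun x => (A (k n) x)⁻¹) (ξ (k n))) w)
    (hc : CurlConvLoc (fun n => matL Ω (fun x => (A (k n) x)⁻¹) (ξ (k n))) w) :
    matL Ω As w = ξ₀ := by
  -- The product `A n ∇u n · w n = ∇u n · ξ n` has two limits: the div-curl lemma gives `τ·w`, the
  -- divergence-gradient version gives `ξ₀·∇v`. Taking `v` locally equal to each coordinate then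
  -- identifies `As w`.
  have key {v : H10 Ω} {u : ℕ → H10 Ω} {τ : L2V Ω} (hu : IsOscillating A As v u τ) :
      ∀ᵐ x ∂(leb Ω), (inner ℝ (τ x) (w x) : ℝ) = inner ℝ (ξ₀ x) (grad Ω v x) := by
    refine ae_eq_of_inner_mulV_eq S.isOpen fun ψ hψ => ?_
    have t1 := tendsto_div_curl S.isOpen S.bdd (hu.conv.comp_tendsto hk) (hu.tendsto_dv.comp hk)
      hw hc hψ
    have t2 := (tendsto_inner_mulV_grad S.isOpen S.bdd hξ hdiv hu.weak hψ).comp hk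
    refine tendsto_nhds_unique t1 (t2.congr fun n => ?_)
    have := inner_mulV_matL_swap hψ (S.matL_ae (k n)) (S.symm (k n))
      (matL Ω (fun x => (A (k n) x)⁻¹) (ξ (k n))) (grad Ω (u (k n)))
    rw [S.matL_cancel] at this
    exact this
  refine Lp.ext (ae_of_locally S.isOpen fun x hx => ?_)
  obtain ⟨χ, hχ, -, -, V, hV, hxV, h1⟩ := exists_cutoff isCompact_singleton S.isOpen
    (singleton_subset_iff.2 hx)
  refine ⟨V, hV.mem_nhds (hxV rfl), ?_⟩
  choose u τ hu using fun i => S.exists_isOscillating (linH Ω χ (stdb i))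
  filter_upwards [ae_all_iff.2 fun i => key (hu i), ae_all_iff.2 fun i => (hu i).flux,
    ae_all_iff.2 fun i => grad_linH hχ hV h1 (stdb i), S.matL_limit_ae w, S.elliptic_symm]
    with y h2 h3 h4 h5 h6 hy
  ext i
  have := h2 i
  rw [h3 i, h4 i hy, inner_act_comm h6.2, ← h5, real_inner_comm] at this
  simpa [stdb, EuclideanSpace.inner_single_right] using this

/-- If the curls are compact, there is no energy defect. -/
theorem tendsto_energy_eq (S : IsSymmHLimit Ω α β A As) (hξ : WeakConv ξ ξ₀)
    (hdiv : Tendsto (fun n => dv (ξ n)) atTop (𝓝 (dv ξ₀)))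
    {K : Set (Fin d → Fin d → HNegLoc Ω)} (hK : IsCompact K)
    (h : ∀ n, (fun i j => toLoc (curl (matL Ω (fun x => (A n x)⁻¹) (ξ n)) i j)) ∈ K)
    (hψ : IsTest Ω ψ)
    (hz : Tendsto (fun n => (inner ℝ (mulV Ω ψ (matL Ω (fun x => (A n x)⁻¹) (ξ n))) (ξ n) : ℝ)) atTop
      (𝓝 z)) : z = inner ℝ (mulV Ω ψ (matL Ω (fun x => (As x)⁻¹) ξ₀)) ξ₀ := by
  obtain ⟨C, hC⟩ := S.matL_inv_bounded hξ
  -- One subsequence suffices, since `z` is already the limit of the whole sequence of energies.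
  obtain ⟨k, w, hk, hw⟩ := exists_subseq_weakConv hC
  have hc := curlConvLoc_of_isCompact hw hK fun n => h (k n)
  have e : matL Ω (fun x => (As x)⁻¹) ξ₀ = w := by
    rw [← S.matL_limit_eq hξ hdiv hk.tendsto_atTop hw hc, S.matL_limit_inv_cancel]
  rw [e, hψ.inner_mulV_swap]
  refine tendsto_nhds_unique (hz.comp hk.tendsto_atTop) ?_
  have t := tendsto_div_curl S.isOpen S.bdd (hξ.comp_tendsto hk.tendsto_atTop)
    (hdiv.comp hk.tendsto_atTop) hw hc hψ
  exact t.congr fun n => hψ.inner_mulV_swap _ _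

end IsSymmHLimit

end HConv

end

/-! ### The theorem: passage from test functions to measures. -/

theorem lemma3p4 {d : ℕ} (hd : 0 < d) {Ω : Set (HConv.Vec d)} (hΩ : IsOpen Ω)
    (hΩb : Bornology.IsBounded Ω) {α β : ℝ} (hα : 0 < α) (hβ : 0 < β)
    -- the symmetric sequence in `M(α, β; Ω)` and its `H`-limit
    (A : ℕ → HConv.Vec d → Matrix (Fin d) (Fin d) ℝ)
    (hA : ∀ n, HConv.MClass α β Ω (A n))
    (hAsymm : ∀ n, ∀ᵐ x ∂(HConv.leb Ω), (A n x).IsSymm)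
    (As : HConv.Vec d → Matrix (Fin d) (Fin d) ℝ) (hAs : HConv.MeasurableField Ω As)
    (hconv : HConv.HConverges Ω A As)
    -- the vector fields
    (ξ : ℕ → HConv.L2V Ω) (ξ₀ : HConv.L2V Ω) (hξ : HConv.WeakConv ξ ξ₀)
    (hdiv : Tendsto (fun n => HConv.dv (ξ n)) atTop (𝓝 (HConv.dv ξ₀)))
    -- the limit measure, a finite signed Borel measure carried by `Ω`
    (ζ : SignedMeasure (HConv.Vec d)) (hζΩ : ζ.restrict Ω = ζ)
    (hζ : HConv.WeakStarConv Ω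
      (fun n x => inner ℝ (HConv.act (A n x)⁻¹ (ξ n x)) (ξ n x)) ζ) :
    Integrable (fun x => inner ℝ (HConv.act (As x)⁻¹ (ξ₀ x)) (ξ₀ x)) (HConv.leb Ω) ∧
    (HConv.leb Ω).withDensityᵥ (fun x => inner ℝ (HConv.act (As x)⁻¹ (ξ₀ x)) (ξ₀ x)) ≤ ζ ∧
    (ζ = (HConv.leb Ω).withDensityᵥ (fun x => inner ℝ (HConv.act (As x)⁻¹ (ξ₀ x)) (ξ₀ x)) ↔
      HConv.CurlCompactLoc Ω (fun n x => HConv.act (A n x)⁻¹ (ξ n x))) := by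
  have S : HConv.IsSymmHLimit Ω α β A As := ⟨hd, hΩ, hΩb, hα, hβ, hA, hAsymm, hAs, hconv⟩
  set g : HConv.Vec d → ℝ := fun x => inner ℝ (HConv.act (As x)⁻¹ (ξ₀ x)) (ξ₀ x) with hg
  have hae : (fun x => inner ℝ (HConv.matL Ω (fun x => (As x)⁻¹) ξ₀ x) (ξ₀ x)) =ᵐ[HConv.leb Ω] g := by
    filter_upwards [S.matL_limit_inv_ae ξ₀] with x hx
    rw [hx]
  have hgi : Integrable g (HConv.leb Ω) := (L2.integrable_inner _ _).congr hae
  have hgψ {ψ : HConv.Vec d → ℝ} (hψ : HConv.IsTest Ω ψ) :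
      ∫ᵛ x, ψ x ∂<•((HConv.leb Ω).withDensityᵥ g) =
        inner ℝ (HConv.mulV Ω ψ (HConv.matL Ω (fun x => (As x)⁻¹) ξ₀)) ξ₀ := by
    rw [HConv.integral_withDensityᵥ hgi hψ.continuous.measurable (hψ.integrable_mul hgi),
      hψ.inner_mulV_eq]
    refine integral_congr_ae ?_
    filter_upwards [hae] with x hx
    rw [← hx]
  have hz {ψ : HConv.Vec d → ℝ} (hψ : HConv.IsTest Ω ψ) : Tendsto (fun n =>
      (inner ℝ (HConv.mulV Ω ψ (HConv.matL Ω (fun x => (A n x)⁻¹) (ξ n))) (ξ n) : ℝ)) atTop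
        (𝓝 (∫ᵛ x, ψ x ∂<•ζ)) := by
    refine (hζ ψ hψ.continuous hψ.2.1 hψ.2.2).congr fun n => ?_
    rw [hψ.inner_mulV_eq]
    refine integral_congr_ae ?_
    filter_upwards [S.matL_inv_ae n (ξ n)] with x hx
    rw [hx, mul_comm]
  have hr := HConv.withDensityᵥ_leb_restrict hΩ hgi
  have hle : (HConv.leb Ω).withDensityᵥ g ≤ ζ :=
    HConv.signedMeasure_le_of_restrict_eq hΩ hr hζΩ fun ψ hψ h0 => by
      rw [hgψ hψ]
      exact S.le_of_tendsto_energy hξ hdiv hψ h0 (hz hψ)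
  refine ⟨hgi, hle, fun h => ?_, ?_⟩
  · refine ⟨_, fun n => S.matL_inv_ae n (ξ n), (S.curlConvLoc hξ hdiv fun ψ hψ => ?_).isCompact⟩
    rw [← hgψ hψ, ← h]
    exact hz hψ
  · rintro ⟨η, hη, K, hK, h⟩
    have e (n : ℕ) : η n = HConv.matL Ω (fun x => (A n x)⁻¹) (ξ n) :=
      Lp.ext ((hη n).trans (S.matL_inv_ae n (ξ n)).symm)
    simp_rw [e] at h
    refine le_antisymm (HConv.signedMeasure_le_of_restrict_eq hΩ hζΩ hr fun ψ hψ _ => ?_) hle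
    rw [hgψ hψ]
    exact (S.tendsto_energy_eq hξ hdiv hK h hψ (hz hψ)).le
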